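/- Let $\mathbb K=\mathbb R$ (with smooth, real-valued functions) or $\mathbb K=\mathbb C$ (with holomorphic functions), and let $g\ge 1$. **The KdV hierarchy.** For one unknown function $u$ of $x$ let $L=\partial_x^2-u$, and for $k\ge 0$ let $A_k=\partial_x^{2k+1}+\dots$ be the anti-symmetric differential operator whose coefficients are differential polynomials in $u$, which is homogeneous of degree $2k+1$ (with $\deg\partial_x=1$, $\deg u^{(n)}=n+2$) and for which $[L,A_k]$ is the operator of multiplication by a function $r_k[u]$. Thus $r_0[u]=u'$, $r_1[u]=\frac14(u'''-6uu')$, and so on. A stationary $g$-KdV (Novikov) equation is $r_g[u]+\sum_{k=0}^{g-1}a_k r_k[u]=0$ with constants $a_k\in\mathbb K$; it is called normalized if $a_{g-1}=0$. **Several variables.** For smooth functions $u_1,\dots,u_g$ on an open set $D\subset\mathbb K^g$ with coordinates $t_1=x,t_2,\dots,t_g$, write $\partial_i=\partial/\partial t_i$, let a prime denote $\partial_x=\partial_1$, and put $$\mathcal L=\partial_x^2-u_1,\qquad \mathcal U_i=\partial_x^2\partial_i-\tfrac12(u_1\partial_i+\partial_i u_1)-\tfrac14(u_i\partial_x+\partial_x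 u_i)-\partial_{i+1}\quad(1\le i\le g),$$ where the last term is absent for $i=g$. Let $\mathbf u(\xi)=\sum_{i=1}^g u_i\xi^i$. For constants $\mu_1,\dots,\mu_{2g}$ consider the relation $$4\Bigl(4\xi^{-1}+\sum_{i=1}^{2g}\mu_i\xi^i\Bigr)=\mathbf u'(\xi)^2+2\,\mathbf u''(\xi)\bigl(2-\mathbf u(\xi)\bigr)+4(\xi^{-1}+u_1)\bigl(2-\mathbf u(\xi)\bigr)^2\qquad(\ast)$$ on $D$, for all $\xi\ne0$. **Theorem.** (A) Let $\Omega\subset\mathbb K$ be open and connected, and let $v$ be a smooth function of $x\in\Omega$. The following are equivalent: 1. $v$ is a solution on $\Omega$ of a normalized stationary $g$-KdV equation. 2. There are an open set $D\supset\Omega\times\{0\}$ and smooth functions $u_1,\dots,u_g$ on $D$ with $u_1(x,0,\dots,0)=v(x)$ for $x\in\Omega$ such that the operators $\mathcal L,\mathcal U_1,\dots,\mathcal U_g$ commute pairwise. 3. There are $D$ and $u_1,\dots,u_g$ as in 2, except that it is only required that $\mathcal L$ commutes with every $\mathcal U_i$. 4. There are an open set $D\supset\Omega\times\{0\}$, smooth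 functions $u_1,\dots,u_g$ on $D$ with $u_1(x,0,\dots,0)=v(x)$ for $x\in\Omega$, and constants $\mu_1,\dots,\mu_{2g}$ such that $(\ast)$ holds on $D$. (B) Let $\Omega$ and $v$ be as in (A). Then $v$ is a solution of some (not necessarily normalized) stationary $g$-KdV equation if and only if there is a constant $c$ such that $v+c$ is a solution of a normalized one. (C) Let $D\subset\mathbb K^g$ be open and connected, and let $u_1,\dots,u_g$ be smooth functions on $D$. The operators $\mathcal L,\mathcal U_1,\dots,\mathcal U_g$ commute pairwise if and only if $\partial_iu_j=\partial_ju_i$ for all $i,j$ and there are constants $\mu_1,\dots,\mu_{2g}$ such that $(\ast)$ holds on $D$. Moreover, if $(\ast)$ holds on $D$ for some constants $\mu_1,\dots,\mu_{2g}$, then $u_1$, as a function of $x$ for fixed $t_2,\dots,t_g$, satisfies a normalized stationary $g$-KdV equation, with constants $a_0,\dots,a_{g-2}$ that are the same at all points of $D$. -/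

import Mathlib

open scoped ContDiff

noncomputable section

/-! ### Differential polynomials and the KdV hierarchy -/

/-- Differential polynomials in one unknown function `u`; the variable `X n` stands for the `n`-th
`x`-derivative of `u`. -/
abbrev DiffPoly : Type := MvPolynomial ℕ ℚ

/-- The total `x`-derivative, `u⁽ⁿ⁾ ↦ u⁽ⁿ⁺¹⁾`. -/
def totalD : Derivation ℚ DiffPoly DiffPoly :=
  MvPolynomial.mkDerivation ℚ (fun n => MvPolynomial.X (n + 1))

/-- Ordinary differential operators with coefficients in `DiffPoly`, as operators on `DiffPoly`. -/
abbrev DiffOp : Type := Module.End ℚ DiffPoly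

/-- The operator `∂ₓ`. -/
def opD : DiffOp := totalD.toLinearMap

/-- The operator of multiplication by `p`. -/
def opMul (p : DiffPoly) : DiffOp := LinearMap.mulLeft ℚ p

/-- The Schrödinger operator `∂ₓ² - u`. -/
def opL : DiffOp := opD ^ 2 - opMul (MvPolynomial.X 0)

/-- The grading in which `u⁽ⁿ⁾` has degree `n + 2`. -/
def diffWeight (n : ℕ) : ℕ := n + 2

/-- Formal conjugation: the anti-homomorphism with `∂ₓ* = -∂ₓ` and `f* = f`, as a relation. -/
inductive IsFormalAdjoint : DiffOp → DiffOp → Prop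
  | deriv : IsFormalAdjoint opD (-opD)
  | mul (p : DiffPoly) : IsFormalAdjoint (opMul p) (opMul p)
  | add {A A' B B' : DiffOp} : IsFormalAdjoint A A' → IsFormalAdjoint B B' →
      IsFormalAdjoint (A + B) (A' + B')
  | comp {A A' B B' : DiffOp} : IsFormalAdjoint A A' → IsFormalAdjoint B B' →
      IsFormalAdjoint (A * B) (B' * A')

/-- `A` is the `k`-th operator of the KdV hierarchy: it is anti-symmetric, it is homogeneous of
degree `2k+1` and of the form `∂ₓ^(2k+1) + lower order terms`, and `[A, L]` is an operator of
multiplication. These properties determine `A`. -/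
structure IsLaxOperator (k : ℕ) (A : DiffOp) : Prop where
  antisymm : IsFormalAdjoint A (-A)
  normalForm : ∃ p : ℕ → DiffPoly,
    (∀ i < 2 * k + 1, MvPolynomial.IsWeightedHomogeneous diffWeight (p i) (2 * k + 1 - i)) ∧
    A = opD ^ (2 * k + 1) + ∑ i ∈ Finset.range (2 * k + 1), opMul (p i) * opD ^ i
  comm : ∃ r : DiffPoly, A * opL - opL * A = opMul r

/-- The coefficients `h₀ = 1, h₁, h₂, …` of the formal solution `H = ∑ hₙ ξⁿ` of
`H'² - 2 H H'' + 4 (ξ⁻¹ + u) H² = 4 ξ⁻¹`. -/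
def resolventCoeff : ℕ → DiffPoly
  | 0 => 1
  | n + 1 => -(MvPolynomial.C (1 / 8 : ℚ)) *
      (4 * (∑ i : Fin n, resolventCoeff (i + 1) * resolventCoeff (n - i)) +
        ∑ i : Fin (n + 1),
          (totalD (resolventCoeff i) * totalD (resolventCoeff (n - i))
            - 2 * resolventCoeff i * totalD (totalD (resolventCoeff (n - i)))
            + 4 * MvPolynomial.X 0 * resolventCoeff i * resolventCoeff (n - i)))
  decreasing_by all_goals omega

/-- The operators `A₀ = ∂ₓ, A₁, A₂, …` of the KdV hierarchy; see `isLaxOperator_laxOperator`. -/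
def laxOperator : ℕ → DiffOp
  | 0 => opD
  | k + 1 => laxOperator k * opL + (opMul (resolventCoeff (k + 1)) * opD
      - opMul (MvPolynomial.C (1 / 2 : ℚ) * totalD (resolventCoeff (k + 1))))

/-- `r_k[u]`, the right-hand side of the `k`-th higher KdV equation `∂_t u = r_k[u]`: the function
by which `[L, A_k]` multiplies. -/
def kdvRHS (k : ℕ) : DiffPoly := (opL * laxOperator k - laxOperator k * opL) 1

/-! The following facts show that `laxOperator` is the KdV hierarchy. -/

theorem opD_apply (p : DiffPoly) : opD p = totalD p := rfl

theorem opMul_apply (p q : DiffPoly) : opMul p q = p * q := rfl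

/-- Coefficientwise total derivative of a formal power series. -/
def seriesD (F : PowerSeries DiffPoly) : PowerSeries DiffPoly :=
  PowerSeries.mk fun n => totalD (PowerSeries.coeff n F)

theorem seriesD_mul (F G : PowerSeries DiffPoly) :
    seriesD (F * G) = seriesD F * G + F * seriesD G := by
  ext1 n
  simp only [seriesD, PowerSeries.coeff_mk, PowerSeries.coeff_mul, map_add, map_sum,
    Derivation.leibniz, smul_eq_mul, ← Finset.sum_add_distrib]
  refine Finset.sum_congr rfl fun i _ => ?_
  ring

theorem seriesD_add (F G : PowerSeries DiffPoly) : seriesD (F + G) = seriesD F + seriesD G := by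
  ext1 n; simp [seriesD]

theorem seriesD_sub (F G : PowerSeries DiffPoly) : seriesD (F - G) = seriesD F - seriesD G := by
  ext1 n; simp [seriesD]

theorem seriesD_C (p : DiffPoly) : seriesD (PowerSeries.C p) = PowerSeries.C (totalD p) := by
  ext1 n
  simp only [seriesD, PowerSeries.coeff_mk, PowerSeries.coeff_C]
  split_ifs <;> simp

theorem seriesD_X : seriesD (PowerSeries.X : PowerSeries DiffPoly) = 0 := by
  ext1 n
  simp only [seriesD, PowerSeries.coeff_mk, PowerSeries.coeff_X]
  split_ifs <;> simp

/-- The generating series of `resolventCoeff`. -/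
def resolventSeries : PowerSeries DiffPoly := PowerSeries.mk resolventCoeff

theorem resolventSeries_quadratic :
    PowerSeries.X * (seriesD resolventSeries * seriesD resolventSeries
      - 2 * (resolventSeries * seriesD (seriesD resolventSeries))
      + 4 * (PowerSeries.C (MvPolynomial.X 0) * (resolventSeries * resolventSeries)))
      + 4 * (resolventSeries * resolventSeries) = 4 := by
  have four : (4 : PowerSeries DiffPoly) = PowerSeries.C (4 : DiffPoly) :=
    (map_ofNat PowerSeries.C 4).symm
  have two : (2 : PowerSeries DiffPoly) = PowerSeries.C (2 : DiffPoly) :=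
    (map_ofNat PowerSeries.C 2).symm
  rw [four, two]
  ext1 n
  cases n with
  | zero => simp [resolventSeries, resolventCoeff]
  | succ n =>
    rw [map_add, PowerSeries.coeff_succ_X_mul, map_add, map_sub]
    simp only [PowerSeries.coeff_C_mul]
    simp only [PowerSeries.coeff_mul, seriesD, resolventSeries,
      PowerSeries.coeff_mk, PowerSeries.coeff_C, Nat.succ_ne_zero, if_false,
      Finset.Nat.sum_antidiagonal_eq_sum_range_succ_mk, Nat.succ_eq_add_one]
    rw [Finset.sum_range_succ _ (n + 1),
      Finset.sum_range_succ' (fun i => resolventCoeff i * resolventCoeff (n + 1 - i)) n]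
    have h8 : (8 : DiffPoly) * MvPolynomial.C (1 / 8 : ℚ) = 1 := by
      have : (8 : DiffPoly) = MvPolynomial.C (8 : ℚ) := (map_ofNat MvPolynomial.C 8).symm
      rw [this, ← MvPolynomial.C_mul]; norm_num
    have h0 : resolventCoeff 0 = 1 := by rw [resolventCoeff]
    have hs : ∀ i ∈ Finset.range n, resolventCoeff (i + 1) * resolventCoeff (n + 1 - (i + 1))
        = resolventCoeff (i + 1) * resolventCoeff (n - i) := by
      intro i _; congr 2; omega
    rw [Finset.sum_congr rfl hs]
    have key : 8 * resolventCoeff (n + 1) = -(4 * (∑ i ∈ Finset.range n,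
        resolventCoeff (i + 1) * resolventCoeff (n - i)) +
        ∑ i ∈ Finset.range (n + 1),
          (totalD (resolventCoeff i) * totalD (resolventCoeff (n - i))
            - 2 * resolventCoeff i * totalD (totalD (resolventCoeff (n - i)))
            + 4 * MvPolynomial.X 0 * resolventCoeff i * resolventCoeff (n - i))) := by
      rw [resolventCoeff, Finset.sum_range, Finset.sum_range]
      linear_combination (-(4 * (∑ i : Fin n,
        resolventCoeff (i + 1) * resolventCoeff (n - i)) +
        ∑ i : Fin (n + 1),
          (totalD (resolventCoeff i) * totalD (resolventCoeff (n - i))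
            - 2 * resolventCoeff i * totalD (totalD (resolventCoeff (n - i)))
            + 4 * MvPolynomial.X 0 * resolventCoeff i * resolventCoeff (n - i)))) * h8
    rw [Finset.sum_add_distrib, Finset.sum_sub_distrib] at key
    simp only [mul_assoc, ← Finset.mul_sum] at key
    simp only [Nat.sub_zero, Nat.sub_self, h0]
    linear_combination key

theorem totalD_X (n : ℕ) : totalD (MvPolynomial.X n) = MvPolynomial.X (n + 1) := by
  simp [totalD]

/-- The Lenard recursion for `resolventCoeff`. -/
theorem resolventCoeff_lenard (n : ℕ) :
    4 * totalD (resolventCoeff (n + 1)) = totalD (totalD (totalD (resolventCoeff n)))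
      - 2 * MvPolynomial.X 1 * resolventCoeff n
      - 4 * MvPolynomial.X 0 * totalD (resolventCoeff n) := by
  have four : (4 : PowerSeries DiffPoly) = PowerSeries.C (4 : DiffPoly) :=
    (map_ofNat PowerSeries.C 4).symm
  have two : (2 : PowerSeries DiffPoly) = PowerSeries.C (2 : DiffPoly) :=
    (map_ofNat PowerSeries.C 2).symm
  have d4 : seriesD (4 : PowerSeries DiffPoly) = 0 := by
    rw [four, seriesD_C]
    have : (4 : DiffPoly) = ((4 : ℕ) : DiffPoly) := by norm_num
    rw [this, Derivation.map_natCast, map_zero]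
  have d2 : seriesD (2 : PowerSeries DiffPoly) = 0 := by
    rw [two, seriesD_C]
    have : (2 : DiffPoly) = ((2 : ℕ) : DiffPoly) := by norm_num
    rw [this, Derivation.map_natCast, map_zero]
  have h := congrArg seriesD resolventSeries_quadratic
  simp only [seriesD_mul, seriesD_add, seriesD_sub, seriesD_X, d4, d2, seriesD_C, totalD_X] at h
  have hne : (2 : PowerSeries DiffPoly) * resolventSeries ≠ 0 := by
    intro h0
    have := congrArg (PowerSeries.coeff 0) h0
    rw [two, PowerSeries.coeff_C_mul] at this
    simp [resolventSeries, resolventCoeff] at this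
  have h2 : 2 * resolventSeries * (PowerSeries.X * (- seriesD (seriesD (seriesD resolventSeries))
      + PowerSeries.C 2 * (PowerSeries.C (MvPolynomial.X 1) * resolventSeries)
      + PowerSeries.C 4 * (PowerSeries.C (MvPolynomial.X 0) * seriesD resolventSeries))
      + PowerSeries.C 4 * seriesD resolventSeries) = 0 := by
    rw [← four, ← two]
    linear_combination h
  have h3 := (mul_eq_zero.mp h2).resolve_left hne
  have h4 := congrArg (PowerSeries.coeff (n + 1)) h3
  rw [map_add, PowerSeries.coeff_succ_X_mul] at h4
  simp only [map_add, map_neg, PowerSeries.coeff_C_mul, seriesD, resolventSeries,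
    PowerSeries.coeff_mk, map_zero] at h4
  linear_combination h4

theorem opMul_add (p q : DiffPoly) : opMul (p + q) = opMul p + opMul q := by
  refine LinearMap.ext fun f => ?_
  simp [opMul_apply, add_mul]

theorem opD_mul_opMul (p : DiffPoly) : opD * opMul p = opMul p * opD + opMul (totalD p) := by
  refine LinearMap.ext fun f => ?_
  simp [opMul_apply, opD_apply, mul_comm]

theorem half_add_half : (MvPolynomial.C (1 / 2 : ℚ) : DiffPoly) * 2 = 1 := by
  have : (2 : DiffPoly) = MvPolynomial.C (2 : ℚ) := (map_ofNat MvPolynomial.C 2).symm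
  rw [this, ← MvPolynomial.C_mul]; norm_num

/-- `[L, A_k]` is multiplication by `-2 h_{k+1}'`. -/
theorem laxOperator_comm (k : ℕ) :
    opL * laxOperator k - laxOperator k * opL = opMul (-2 * totalD (resolventCoeff (k + 1))) := by
  have dC : totalD (MvPolynomial.C (1 / 2 : ℚ)) = 0 := MvPolynomial.derivation_C _ _
  induction k with
  | zero =>
    have h := resolventCoeff_lenard 0
    have h0 : resolventCoeff 0 = 1 := by rw [resolventCoeff]
    rw [h0] at h
    simp only [Derivation.map_one_eq_zero, map_zero] at h
    have h' : -2 * totalD (resolventCoeff (0 + 1)) = MvPolynomial.X 1 := by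
      linear_combination (-MvPolynomial.C (1 / 2 : ℚ)) * h
        + (2 * totalD (resolventCoeff (0 + 1)) + MvPolynomial.X 1) * half_add_half
    rw [h']
    refine LinearMap.ext fun f => ?_
    simp only [laxOperator, opL, LinearMap.sub_apply, Module.End.mul_apply, pow_two, opMul_apply,
      opD_apply, map_sub, Derivation.leibniz, totalD_X, smul_eq_mul]
    ring
  | succ k ih =>
    have h := resolventCoeff_lenard (k + 1)
    have h' : -2 * totalD (resolventCoeff (k + 1 + 1)) =
        -MvPolynomial.C (1 / 2 : ℚ) * totalD (totalD (totalD (resolventCoeff (k + 1))))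
        + MvPolynomial.X 1 * resolventCoeff (k + 1)
        + 2 * MvPolynomial.X 0 * totalD (resolventCoeff (k + 1)) := by
      linear_combination (-MvPolynomial.C (1 / 2 : ℚ)) * h
        + (2 * totalD (resolventCoeff (k + 1 + 1)) + MvPolynomial.X 1 * resolventCoeff (k + 1)
        + 2 * MvPolynomial.X 0 * totalD (resolventCoeff (k + 1))) * half_add_half
    have step : opL * laxOperator (k + 1) - laxOperator (k + 1) * opL
        = (opL * laxOperator k - laxOperator k * opL) * opL
        + (opL * (opMul (resolventCoeff (k + 1)) * opD
            - opMul (MvPolynomial.C (1 / 2 : ℚ) * totalD (resolventCoeff (k + 1))))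
          - (opMul (resolventCoeff (k + 1)) * opD
            - opMul (MvPolynomial.C (1 / 2 : ℚ) * totalD (resolventCoeff (k + 1)))) * opL) := by
      rw [laxOperator]
      have gen : ∀ {R : Type} [Ring R] (A L B : R), L * (A * L + B) - (A * L + B) * L
          = (L * A - A * L) * L + (L * B - B * L) := by
        intro R _ A L B; noncomm_ring
      exact gen _ _ _
    rw [step, ih, h']
    refine LinearMap.ext fun f => ?_
    simp only [opL, LinearMap.sub_apply, LinearMap.add_apply, Module.End.mul_apply, pow_two,
      opMul_apply, opD_apply, map_sub, map_add, Derivation.leibniz, totalD_X,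
      smul_eq_mul, dC, map_zero]
    linear_combination (- totalD (totalD (resolventCoeff (k + 1))) * totalD f) * half_add_half

theorem kdvRHS_eq (k : ℕ) : kdvRHS k = -2 * totalD (resolventCoeff (k + 1)) := by
  rw [kdvRHS, laxOperator_comm, opMul_apply, mul_one]

theorem opL_adjoint : IsFormalAdjoint opL opL := by
  have h : opL = opD * opD + opMul (-MvPolynomial.X 0) := by
    refine LinearMap.ext fun f => ?_
    simp [opL, opMul_apply, pow_two, sub_eq_add_neg]
  have := (IsFormalAdjoint.deriv.comp .deriv).add (.mul (-MvPolynomial.X 0))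
  have h2 : -opD * -opD = opD * opD := LinearMap.ext fun f => by simp
  rwa [h2, ← h] at this

theorem laxOperator_antisymm (k : ℕ) : IsFormalAdjoint (laxOperator k) (-laxOperator k) := by
  induction k with
  | zero => exact .deriv
  | succ k ih =>
    have h := (ih.comp opL_adjoint).add
      (((IsFormalAdjoint.mul (resolventCoeff (k + 1))).comp .deriv).add
        (.mul (-(MvPolynomial.C (1 / 2 : ℚ) * totalD (resolventCoeff (k + 1))))))
    have e1 : laxOperator k * opL + (opMul (resolventCoeff (k + 1)) * opD
        + opMul (-(MvPolynomial.C (1 / 2 : ℚ) * totalD (resolventCoeff (k + 1)))))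
        = laxOperator (k + 1) := by
      rw [laxOperator]
      refine LinearMap.ext fun f => ?_
      simp [opMul_apply, sub_eq_add_neg]
    have e2 : opL * -laxOperator k + (-opD * opMul (resolventCoeff (k + 1))
        + opMul (-(MvPolynomial.C (1 / 2 : ℚ) * totalD (resolventCoeff (k + 1)))))
        = -laxOperator (k + 1) := by
      have hc := laxOperator_comm k
      rw [laxOperator]
      refine LinearMap.ext fun f => ?_
      have hf := LinearMap.congr_fun hc f
      simp only [LinearMap.sub_apply, LinearMap.add_apply, LinearMap.neg_apply, map_neg,
        Module.End.mul_apply, opMul_apply, opD_apply, Derivation.leibniz, smul_eq_mul] at hf ⊢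
      linear_combination (-hf) - (totalD (resolventCoeff (k + 1)) * f) * half_add_half
    rwa [e1, e2] at h

theorem totalD_homogeneous {p : DiffPoly} {n : ℕ}
    (hp : MvPolynomial.IsWeightedHomogeneous diffWeight p n) :
    MvPolynomial.IsWeightedHomogeneous diffWeight (totalD p) (n + 1) := by
  rw [p.as_sum, map_sum]
  refine MvPolynomial.IsWeightedHomogeneous.sum _ _ _ fun s hs => ?_
  have hw := hp (MvPolynomial.mem_support_iff.mp hs)
  rw [totalD, MvPolynomial.mkDerivation_monomial]
  refine (MvPolynomial.weightedHomogeneousSubmodule ℚ diffWeight (n + 1)).smul_mem _ ?_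
  refine MvPolynomial.IsWeightedHomogeneous.sum _ _ _ fun i hi => ?_
  have hi' : 1 ≤ s i := Nat.one_le_iff_ne_zero.mpr (Finsupp.mem_support_iff.mp hi)
  have hs' : s = (s - Finsupp.single i 1) + Finsupp.single i 1 := by
    rw [tsub_add_cancel_of_le]; simpa using hi'
  have hw2 : Finsupp.weight diffWeight (s - Finsupp.single i 1) + diffWeight i = n := by
    rw [← hw]; conv_rhs => rw [hs', map_add, Finsupp.weight_single]
    simp
  dsimp only
  rw [smul_eq_mul]
  have := (MvPolynomial.isWeightedHomogeneous_monomial diffWeight (s - Finsupp.single i 1)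
    ((s i : ℕ) : ℚ) rfl).mul (MvPolynomial.isWeightedHomogeneous_X ℚ diffWeight (i + 1))
  convert this using 1
  simp only [diffWeight] at hw2 ⊢
  omega

theorem resolventCoeff_homogeneous (n : ℕ) :
    MvPolynomial.IsWeightedHomogeneous diffWeight (resolventCoeff n) (2 * n) := by
  induction n using Nat.strong_induction_on with
  | _ n ih =>
    cases n with
    | zero => rw [resolventCoeff]; exact MvPolynomial.isWeightedHomogeneous_one ℚ diffWeight
    | succ n =>
      have hS : ∀ {p q : DiffPoly} {m : ℕ}, MvPolynomial.IsWeightedHomogeneous diffWeight p m →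
          q = p → MvPolynomial.IsWeightedHomogeneous diffWeight q m := by
        intro p q m h e; rwa [e]
      have hC : ∀ (c : ℚ) {p : DiffPoly} {m : ℕ},
          MvPolynomial.IsWeightedHomogeneous diffWeight p m →
          MvPolynomial.IsWeightedHomogeneous diffWeight (MvPolynomial.C c * p) m := by
        intro c p m h
        have := (MvPolynomial.isWeightedHomogeneous_C diffWeight c).mul h
        rwa [zero_add] at this
      have four : (4 : DiffPoly) = MvPolynomial.C (4 : ℚ) := (map_ofNat MvPolynomial.C 4).symm
      have two : (-2 : DiffPoly) = MvPolynomial.C (-2 : ℚ) := by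
        rw [map_neg, map_ofNat]
      rw [resolventCoeff, ← map_neg]
      refine hC _ (MvPolynomial.IsWeightedHomogeneous.add ?_ ?_)
      · rw [four]
        refine hC _ (MvPolynomial.IsWeightedHomogeneous.sum _ _ _ fun i _ => ?_)
        have := (ih (i + 1) (by omega)).mul (ih (n - i) (by omega))
        convert this using 1
        omega
      · refine MvPolynomial.IsWeightedHomogeneous.sum _ _ _ fun i _ => ?_
        have a := ih i (by omega)
        have b := ih (n - i) (by omega)
        have t1 := (totalD_homogeneous a).mul (totalD_homogeneous b)
        have t2 := hC (-2) (a.mul (totalD_homogeneous (totalD_homogeneous b)))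
        have t3 := hC 4 ((MvPolynomial.isWeightedHomogeneous_X ℚ diffWeight 0).mul (a.mul b))
        have e1 : 2 * (i : ℕ) + 1 + (2 * (n - i) + 1) = 2 * (n + 1) := by omega
        have e2 : 2 * (i : ℕ) + (2 * (n - i) + 1 + 1) = 2 * (n + 1) := by omega
        have e3 : diffWeight 0 + (2 * (i : ℕ) + 2 * (n - i)) = 2 * (n + 1) := by
          simp only [diffWeight]; omega
        rw [e1] at t1
        rw [e2] at t2
        rw [e3] at t3
        refine hS ((t1.add t2).add t3) ?_
        rw [← four, ← two]; ring

/-- Homogeneous operators of degree `d` and order less than `m`. -/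
def homOp (d m : ℕ) : Submodule ℚ DiffOp :=
  Submodule.span ℚ {A | ∃ (i j : ℕ) (p : DiffPoly), i < m ∧ j + i = d ∧
    MvPolynomial.IsWeightedHomogeneous diffWeight p j ∧ A = opMul p * opD ^ i}

theorem homOp_mono {d m m' : ℕ} (h : m ≤ m') : homOp d m ≤ homOp d m' := by
  refine Submodule.span_mono ?_
  rintro A ⟨i, j, p, hi, hj, hp, rfl⟩
  exact ⟨i, j, p, by omega, hj, hp, rfl⟩

theorem homOp_mul_opD {d m : ℕ} {A : DiffOp} (hA : A ∈ homOp d m) :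
    A * opD ∈ homOp (d + 1) (m + 1) := by
  induction hA using Submodule.span_induction with
  | mem A h =>
    obtain ⟨i, j, p, hi, hj, hp, rfl⟩ := h
    refine Submodule.subset_span ⟨i + 1, j, p, by omega, by omega, hp, ?_⟩
    rw [pow_succ, mul_assoc]
  | zero => rw [zero_mul]; exact Submodule.zero_mem _
  | add A B _ _ hA hB => rw [add_mul]; exact Submodule.add_mem _ hA hB
  | smul c A _ hA => rw [smul_mul_assoc]; exact Submodule.smul_mem _ _ hA

theorem opMul_mul_homOp {d m e : ℕ} {q : DiffPoly}
    (hq : MvPolynomial.IsWeightedHomogeneous diffWeight q e) {A : DiffOp} (hA : A ∈ homOp d m) :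
    opMul q * A ∈ homOp (e + d) m := by
  induction hA using Submodule.span_induction with
  | mem A h =>
    obtain ⟨i, j, p, hi, hj, hp, rfl⟩ := h
    refine Submodule.subset_span ⟨i, e + j, q * p, hi, by omega, hq.mul hp, ?_⟩
    refine LinearMap.ext fun f => ?_
    simp [opMul_apply, mul_assoc]
  | zero => rw [mul_zero]; exact Submodule.zero_mem _
  | add A B _ _ hA hB => rw [mul_add]; exact Submodule.add_mem _ hA hB
  | smul c A _ hA => rw [mul_smul_comm]; exact Submodule.smul_mem _ _ hA

theorem opD_pow_mul_opMul (i : ℕ) : ∀ {q : DiffPoly} {e : ℕ},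
    MvPolynomial.IsWeightedHomogeneous diffWeight q e →
    opD ^ i * opMul q ∈ homOp (e + i) (i + 1) := by
  induction i with
  | zero =>
    intro q e hq
    exact Submodule.subset_span ⟨0, e, q, by omega, rfl, hq, by simp⟩
  | succ i ih =>
    intro q e hq
    rw [pow_succ, mul_assoc, opD_mul_opMul, mul_add, ← mul_assoc]
    refine Submodule.add_mem _ (homOp_mul_opD (ih hq)) ?_
    have := homOp_mono (Nat.le_succ (i + 1)) (ih (totalD_homogeneous hq))
    rwa [add_right_comm] at this

theorem homOp_mul_opMul {d m e : ℕ} {q : DiffPoly}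
    (hq : MvPolynomial.IsWeightedHomogeneous diffWeight q e) {A : DiffOp} (hA : A ∈ homOp d m) :
    A * opMul q ∈ homOp (d + e) m := by
  induction hA using Submodule.span_induction with
  | mem A h =>
    obtain ⟨i, j, p, hi, hj, hp, rfl⟩ := h
    rw [mul_assoc]
    have := homOp_mono (show i + 1 ≤ m by omega)
      (opMul_mul_homOp hp (opD_pow_mul_opMul i hq))
    rwa [show j + (e + i) = d + e by omega] at this
  | zero => rw [zero_mul]; exact Submodule.zero_mem _
  | add A B _ _ hA hB => rw [add_mul]; exact Submodule.add_mem _ hA hB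
  | smul c A _ hA => rw [smul_mul_assoc]; exact Submodule.smul_mem _ _ hA

theorem exists_of_mem_homOp {d m : ℕ} {A : DiffOp} (hA : A ∈ homOp d m) :
    ∃ p : ℕ → DiffPoly,
      (∀ i < m, MvPolynomial.IsWeightedHomogeneous diffWeight (p i) (d - i)) ∧
      A = ∑ i ∈ Finset.range m, opMul (p i) * opD ^ i := by
  have opMul_zero : opMul 0 = 0 := LinearMap.ext fun f => by simp [opMul_apply]
  induction hA using Submodule.span_induction with
  | mem A h =>
    obtain ⟨i, j, p, hi, hj, hp, rfl⟩ := h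
    refine ⟨fun l => if l = i then p else 0, fun l _ => ?_, ?_⟩
    · dsimp only
      split_ifs with h
      · rwa [h, show d - i = j by omega]
      · exact MvPolynomial.isWeightedHomogeneous_zero ℚ diffWeight _
    · rw [Finset.sum_eq_single i]
      · simp
      · intro l _ hl; simp [hl, opMul_zero]
      · intro h; exact absurd (Finset.mem_range.mpr hi) h
  | zero =>
    exact ⟨0, fun i _ => MvPolynomial.isWeightedHomogeneous_zero ℚ diffWeight _,
      by simp [opMul_zero]⟩
  | add A B _ _ hA hB =>
    obtain ⟨p, hp, rfl⟩ := hA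
    obtain ⟨q, hq, rfl⟩ := hB
    refine ⟨p + q, fun i hi => (hp i hi).add (hq i hi), ?_⟩
    simp [opMul_add, add_mul, Finset.sum_add_distrib]
  | smul c A _ hA =>
    obtain ⟨p, hp, rfl⟩ := hA
    refine ⟨c • p, fun i hi => (MvPolynomial.weightedHomogeneousSubmodule ℚ diffWeight
      (d - i)).smul_mem c (hp i hi), ?_⟩
    rw [Finset.smul_sum]
    refine Finset.sum_congr rfl fun i _ => LinearMap.ext fun f => ?_
    simp [opMul_apply]

theorem laxOperator_sub_mem (k : ℕ) :
    laxOperator k - opD ^ (2 * k + 1) ∈ homOp (2 * k + 1) (2 * k + 1) := by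
  induction k with
  | zero => simp [laxOperator]
  | succ k ih =>
    have hX : MvPolynomial.IsWeightedHomogeneous diffWeight (MvPolynomial.X 0 : DiffPoly) 2 :=
      MvPolynomial.isWeightedHomogeneous_X ℚ diffWeight 0
    have hh := resolventCoeff_homogeneous (k + 1)
    have e : laxOperator (k + 1) - opD ^ (2 * (k + 1) + 1)
        = (laxOperator k - opD ^ (2 * k + 1)) * opD * opD
        - (laxOperator k - opD ^ (2 * k + 1)) * opMul (MvPolynomial.X 0)
        - opD ^ (2 * k + 1) * opMul (MvPolynomial.X 0)
        + opMul (resolventCoeff (k + 1)) * opD ^ 1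
        - opMul (MvPolynomial.C (1 / 2 : ℚ) * totalD (resolventCoeff (k + 1))) * opD ^ 0 := by
      rw [laxOperator, opL, show 2 * (k + 1) + 1 = (2 * k + 1) + 2 by ring,
        pow_add opD (2 * k + 1) 2]
      have gen : ∀ {R : Type} [Ring R] (A T D U B C : R),
          A * (D ^ 2 - U) + (B * D - C) - T * D ^ 2
          = (A - T) * D * D - (A - T) * U - T * U + B * D ^ 1 - C * D ^ 0 := by
        intro R _ A T D U B C; noncomm_ring
      exact gen _ _ _ _ _ _
    rw [e]
    refine Submodule.sub_mem _ (Submodule.add_mem _ (Submodule.sub_mem _ (Submodule.sub_mem _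
      (homOp_mul_opD (homOp_mul_opD ih)) (homOp_mono (by omega) (homOp_mul_opMul hX ih))) ?_) ?_) ?_
    · have := homOp_mono (show 2 * k + 1 + 1 ≤ 2 * (k + 1) + 1 by omega)
        (opD_pow_mul_opMul (2 * k + 1) hX)
      rwa [show 2 + (2 * k + 1) = 2 * (k + 1) + 1 by ring] at this
    · exact Submodule.subset_span ⟨1, _, _, by omega, rfl, hh, rfl⟩
    · refine Submodule.subset_span ⟨0, _, _, by omega, rfl, ?_, rfl⟩
      have := (MvPolynomial.isWeightedHomogeneous_C diffWeight (1 / 2 : ℚ)).mul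
        (totalD_homogeneous hh)
      rwa [zero_add] at this

theorem isLaxOperator_laxOperator (k : ℕ) : IsLaxOperator k (laxOperator k) where
  antisymm := laxOperator_antisymm k
  normalForm := by
    obtain ⟨p, hp, h⟩ := exists_of_mem_homOp (laxOperator_sub_mem k)
    exact ⟨p, hp, by rw [← h]; abel⟩
  comm := ⟨-(-2 * totalD (resolventCoeff (k + 1))), by
    rw [← neg_sub, laxOperator_comm]
    refine LinearMap.ext fun f => ?_
    simp [opMul_apply]⟩

/-! ### Stationary equations for functions of one variable -/

section

variable {𝕜 : Type*} [RCLike 𝕜]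

/-- The value of a differential polynomial at a jet `(u, u', u'', …)`. -/
def evalJet (jet : ℕ → 𝕜) (p : DiffPoly) : 𝕜 := MvPolynomial.aeval jet p

/-- The jet satisfies `r_g + ∑_{k < m} a_k r_k = 0`. -/
def NovikovAt (g m : ℕ) (a : ℕ → 𝕜) (jet : ℕ → 𝕜) : Prop :=
  evalJet jet (kdvRHS g) + ∑ k ∈ Finset.range m, a k * evalJet jet (kdvRHS k) = 0

/-- `v` solves on `Ω` some stationary `g`-KdV equation `r_g[v] + ∑_{k=0}^{g-1} a_k r_k[v] = 0`. -/
def IsStationaryKdV (g : ℕ) (Ω : Set 𝕜) (v : 𝕜 → 𝕜) : Prop :=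
  ∃ a : ℕ → 𝕜, ∀ x ∈ Ω, NovikovAt g g a (fun n => iteratedDeriv n v x)

/-- `v` solves on `Ω` some stationary `g`-KdV equation in the normalization `a_{g-1} = 0`, that is,
`r_g[v] + ∑_{k=0}^{g-2} a_k r_k[v] = 0`. -/
def IsNormalizedStationaryKdV (g : ℕ) (Ω : Set 𝕜) (v : 𝕜 → 𝕜) : Prop :=
  ∃ a : ℕ → 𝕜, ∀ x ∈ Ω, NovikovAt g (g - 1) a (fun n => iteratedDeriv n v x)

/-! ### Functions of `t₁ = x, t₂, …, t_g`

The variable `tᵢ` and the function `uᵢ` of the mathematical text have index `i - 1 : Fin g`. -/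

variable {g : ℕ} [NeZero g]

/-- The partial derivative in the direction of the `i`-th coordinate. -/
def partialD (i : Fin g) (f : (Fin g → 𝕜) → 𝕜) : (Fin g → 𝕜) → 𝕜 :=
  fun t => fderiv 𝕜 f t (Pi.single i 1)

/-- `L = ∂ₓ² - u₁`. -/
def schrodingerOp (u : Fin g → (Fin g → 𝕜) → 𝕜) (f : (Fin g → 𝕜) → 𝕜) : (Fin g → 𝕜) → 𝕜 :=
  partialD 0 (partialD 0 f) - u 0 * f

/-- `∂_{i+1}`, which is absent (zero) for the last index. -/
def nextPartialD (i : Fin g) (f : (Fin g → 𝕜) → 𝕜) : (Fin g → 𝕜) → 𝕜 :=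
  if h : (i : ℕ) + 1 < g then partialD ⟨(i : ℕ) + 1, h⟩ f else 0

/-- `Uᵢ = ∂ₓ²∂ᵢ - ½ (u₁∂ᵢ + ∂ᵢu₁) - ¼ (uᵢ∂ₓ + ∂ₓuᵢ) - ∂_{i+1}`. -/
def multiOp (u : Fin g → (Fin g → 𝕜) → 𝕜) (i : Fin g) (f : (Fin g → 𝕜) → 𝕜) :
    (Fin g → 𝕜) → 𝕜 :=
  partialD 0 (partialD 0 (partialD i f))
    - (1 / 2 : 𝕜) • (u 0 * partialD i f + partialD i (u 0 * f))
    - (1 / 4 : 𝕜) • (u i * partialD 0 f + partialD 0 (u i * f))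
    - nextPartialD i f

/-- Two operators commute on the smooth functions on `D`. -/
def CommuteOn (D : Set (Fin g → 𝕜)) (A B : ((Fin g → 𝕜) → 𝕜) → ((Fin g → 𝕜) → 𝕜)) : Prop :=
  ∀ f : (Fin g → 𝕜) → 𝕜, ContDiffOn 𝕜 ∞ f D → ∀ t ∈ D, A (B f) t = B (A f) t

/-- The operator `L` commutes with all the operators `Uᵢ`. -/
def SchrodingerCommutes (D : Set (Fin g → 𝕜)) (u : Fin g → (Fin g → 𝕜) → 𝕜) : Prop :=
  ∀ i, CommuteOn D (schrodingerOp u) (multiOp u i)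

/-- The operators `L, U₁, …, U_g` commute pairwise. -/
def AllCommute (D : Set (Fin g → 𝕜)) (u : Fin g → (Fin g → 𝕜) → 𝕜) : Prop :=
  SchrodingerCommutes D u ∧ ∀ i j, CommuteOn D (multiOp u i) (multiOp u j)

/-- The generating function `∑ uᵢ ξⁱ`. -/
def genFun (u : Fin g → (Fin g → 𝕜) → 𝕜) (ξ : 𝕜) (t : Fin g → 𝕜) : 𝕜 :=
  ∑ i : Fin g, u i t * ξ ^ ((i : ℕ) + 1)

/-- The quadratic relation
`4 μ(ξ) = 𝐮'(ξ)² + 2 𝐮''(ξ) (2 - 𝐮(ξ)) + 4 (ξ⁻¹ + u₁) (2 - 𝐮(ξ))²`, where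
`μ(ξ) = 4 ξ⁻¹ + ∑_{i=1}^{2g} μᵢ ξⁱ`. -/
def QuadraticRelation (D : Set (Fin g → 𝕜)) (u : Fin g → (Fin g → 𝕜) → 𝕜) (μ : ℕ → 𝕜) : Prop :=
  ∀ t ∈ D, ∀ ξ : 𝕜, ξ ≠ 0 →
    4 * (4 * ξ⁻¹ + ∑ i ∈ Finset.Icc 1 (2 * g), μ i * ξ ^ i) =
      (genFun (fun i => partialD 0 (u i)) ξ t) ^ 2
      + 2 * genFun (fun i => partialD 0 (partialD 0 (u i))) ξ t * (2 - genFun u ξ t)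
      + 4 * (ξ⁻¹ + u 0 t) * (2 - genFun u ξ t) ^ 2

/-- `u₁, …, u_g` are smooth functions on an open neighbourhood `D` of `Ω × {0}`, and `u₁` restricts
to the function `v` of `x`, that is, `u₁(x, 0, …, 0) = v(x)` on `Ω`. -/
structure IsExtension (Ω : Set 𝕜) (v : 𝕜 → 𝕜) (D : Set (Fin g → 𝕜))
    (u : Fin g → (Fin g → 𝕜) → 𝕜) : Prop where
  isOpen : IsOpen D
  mem : ∀ x ∈ Ω, Pi.single 0 x ∈ D
  smooth : ∀ i, ContDiffOn 𝕜 ∞ (u i) D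
  restrict : ∀ x ∈ Ω, u 0 (Pi.single 0 x) = v x

end

end

/-! Write W(ξ) = 2 - 𝐮(ξ). After multiplication by ξ the right-hand side of (∗) is Q(W) = ξ(W'² -
2WW'' + 4u₁W²) + 4W² (`quadForm`), so (∗) says that Q(W) has constant coefficients. Differentiation
gives Q(W)' = 2W times the defect of the linear equation W''' = 4(ξ⁻¹ + u₁)W' + 2u₁'W (`IsLenard`).
As W is a unit in the ring of power series, Q(W)' = 0 is equivalent to this linear equation, whose
coefficients form the Lenard recursion. Commutation of L with all Uᵢ means ∂ᵢu₁ = uᵢ' together with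
exactly this recursion (`forall_algL_algU_iff`).

Link with the stationary equations: the formal resolvent H = ∑ hₙξⁿ has Q(H) = 4 and r_k =
-2h_{k+1}'. A solution of Q(W) = M with constant term 2 is unique, hence W = c · 2H with c the
constant series for which 16c² = M. The vanishing of the coefficient of ξ^(g+1) in W becomes, after
differentiation, a stationary equation with a_k = c_{g-k}. It is normalized because M has no linear
term, so that c₁ = 0 (`novikov_of_quadForm`). Conversely, a normalized stationary equation allows c
· 2H to be truncated at degree g without leaving the linear equation (`exists_lenard_of_novikov`).

Extension to t₂, …, t_g: the coefficients of W, W', W'' are coordinates of a phase space that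
carries commuting polynomial vector fields ∂ᵢ with generating function 2(ξ - η) ∂_η W(ξ) = ξ
(W(η)W'(ξ) - W'(η)W(ξ)) (`phaseDGen_gen`, `phaseD_comm`), and the system for u₁, …, u_g holds there
identically (`isKdVSystem_phase`). A solution v gives an integral curve of ∂ₓ. The other flows are
applied to it by a Taylor series in t₂, …, t_g only, so v need not be analytic; convergence near Ω ×
{0} comes from a majorant estimate (`exists_flow`).

Full commutation amounts to the linear equation, the symmetry ∂ᵢuⱼ = ∂ⱼuᵢ and an evolution law for W
along each ∂ⱼ. Under this law ξ ∂_{j+1}Q(W) = ∂ⱼQ(W), so all derivatives of Q(W) vanish. Conversely,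
if they vanish, the defect of the law is independent of x and is annihilated by a unit
(`isKdVSystem_of_serD_quadForm`).

For (B), replacing u by u + c acts on the r_k by a unitriangular matrix with constant entries, and
the entry next to the diagonal is a nonzero multiple of c. A suitable c therefore removes a_{g-1}.
-/

noncomputable section

/-! ### Differential algebra: power series over a differential ring -/

open PowerSeries in
/-- The coefficientwise extension of a derivation to formal power series. -/
def serD {𝕜 R : Type*} [CommRing 𝕜] [CommRing R] [Algebra 𝕜 R] (δ : Derivation 𝕜 R R) :
    Derivation 𝕜 (PowerSeries R) (PowerSeries R) where
  toFun F := PowerSeries.mk fun n => δ (coeff n F)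
  map_add' F G := by ext; simp
  map_smul' c F := by ext; simp
  map_one_eq_zero' := by
    ext n
    simp only [LinearMap.coe_mk, AddHom.coe_mk, coeff_mk, coeff_one, map_zero]
    split_ifs <;> simp
  leibniz' F G := by
    ext n
    simp only [LinearMap.coe_mk, AddHom.coe_mk, coeff_mk, coeff_mul, map_add, map_sum,
      Derivation.leibniz, smul_eq_mul, Finset.sum_add_distrib]
    congr 1
    rw [← Finset.Nat.sum_antidiagonal_swap]
    rfl

section SeriesAlgebra

variable {𝕜 R : Type*} [Field 𝕜] [CommRing R] [Algebra 𝕜 R]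

open PowerSeries

@[simp] theorem coeff_serD (δ : Derivation 𝕜 R R) (n : ℕ) (F : R⟦X⟧) :
    coeff n (serD δ F) = δ (coeff n F) := by
  simp [serD]

@[simp] theorem derivation_ofNat {A : Type*} [CommRing A] [Algebra 𝕜 A] (D : Derivation 𝕜 A A)
    (n : ℕ) [n.AtLeastTwo] : D (ofNat(n) : A) = 0 :=
  D.map_natCast n

@[simp] theorem serD_C (δ : Derivation 𝕜 R R) (r : R) : serD δ (C r) = C (δ r) := by
  ext n
  simp only [coeff_serD, coeff_C]
  split_ifs <;> simp

@[simp] theorem serD_X (δ : Derivation 𝕜 R R) : serD δ (X : R⟦X⟧) = 0 := by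
  ext n
  simp only [coeff_serD, coeff_X, map_zero]
  split_ifs <;> simp

theorem serD_map_algebraMap (δ : Derivation 𝕜 R R) (c : 𝕜⟦X⟧) :
    serD δ (map (algebraMap 𝕜 R) c) = 0 := by
  ext n
  simp

theorem serD_comm {δ ε : Derivation 𝕜 R R} (h : ∀ f, δ (ε f) = ε (δ f)) (F : R⟦X⟧) :
    serD δ (serD ε F) = serD ε (serD δ F) := by
  ext n
  simp [h]

/-- The quadratic form `X (F'² - 2 F F'' + 4 u F²) + 4 F²`. -/
def quadForm (δ : Derivation 𝕜 R R) (u : R) (F : R⟦X⟧) : R⟦X⟧ :=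
  X * (serD δ F ^ 2 - 2 * (F * serD δ (serD δ F)) + 4 * (C u * F ^ 2)) + 4 * F ^ 2

/-- The linear equation `F''' = 4 (ξ⁻¹ + u) F' + 2 u' F` for formal power series in `ξ`. -/
def IsLenard (δ : Derivation 𝕜 R R) (u : R) (F : R⟦X⟧) : Prop :=
  X * (serD δ (serD δ (serD δ F)) - 4 * (C u * serD δ F) - 2 * (C (δ u) * F)) = 4 * serD δ F

/-- The terms in F'F'' coming from F'² and FF'' cancel, and everything that remains is divisible by
F. -/
theorem serD_quadForm (δ : Derivation 𝕜 R R) (u : R) (F : R⟦X⟧) :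
    serD δ (quadForm δ u F) = 2 * F * (4 * serD δ F - X * (serD δ (serD δ (serD δ F))
      - 4 * (C u * serD δ F) - 2 * (C (δ u) * F))) := by
  simp only [quadForm, map_add, map_sub, Derivation.leibniz, pow_two, smul_eq_mul, serD_X, serD_C,
    derivation_ofNat]
  ring

theorem IsLenard.serD_quadForm {δ : Derivation 𝕜 R R} {u : R} {F : R⟦X⟧} (h : IsLenard δ u F) :
    serD δ (quadForm δ u F) = 0 := by
  rw [_root_.serD_quadForm, h, sub_self, mul_zero]

theorem isUnit_algebraMap_of_ne {c : 𝕜} (hc : c ≠ 0) : IsUnit (algebraMap 𝕜 R c) :=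
  (IsUnit.mk0 c hc).map _

/-- Rings of smooth functions may have zero divisors, so numerical factors are cancelled as units.
-/
theorem isUnit_ofNat_of_charZero [CharZero 𝕜] (n : ℕ) [n.AtLeastTwo] :
    IsUnit (ofNat(n) : R) := by
  have h : IsUnit (algebraMap 𝕜 R (ofNat(n))) := isUnit_algebraMap_of_ne (NeZero.ne _)
  rwa [map_ofNat] at h

/-- The constant term 2 makes the factor 2F of the derivative a unit. -/
theorem isLenard_of_serD_quadForm [CharZero 𝕜] {δ : Derivation 𝕜 R R} {u : R} {F : R⟦X⟧}
    (hF : constantCoeff F = 2) (h : serD δ (quadForm δ u F) = 0) : IsLenard δ u F := by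
  rw [serD_quadForm] at h
  have hu : IsUnit (2 * F) := by
    rw [isUnit_iff_constantCoeff, map_mul, hF, map_ofNat]
    exact (isUnit_ofNat_of_charZero (𝕜 := 𝕜) 2).mul (isUnit_ofNat_of_charZero (𝕜 := 𝕜) 2)
  exact (sub_eq_zero.mp ((hu.mul_right_eq_zero).mp h)).symm

/-- The degree-zero part of the equation reads 0 = 4F₀', which is automatic for F₀ = 2; the other
degrees are the Lenard recursion. -/
theorem isLenard_iff_coeff {δ : Derivation 𝕜 R R} {u : R} {F : R⟦X⟧}
    (hF : constantCoeff F = 2) : IsLenard δ u F ↔ ∀ k, δ (δ (δ (coeff k F)))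
      - 4 * (u * δ (coeff k F)) - 2 * (δ u * coeff k F) = 4 * δ (coeff (k + 1) F) := by
  have four : (4 : R⟦X⟧) = C (4 : R) := (map_ofNat C 4).symm
  have two : (2 : R⟦X⟧) = C (2 : R) := (map_ofNat C 2).symm
  rw [IsLenard, four, two, PowerSeries.ext_iff]
  constructor
  · intro h k
    simpa only [coeff_succ_X_mul, map_sub, coeff_C_mul, coeff_serD] using h (k + 1)
  · rintro h (_ | k)
    · rw [coeff_zero_X_mul, coeff_C_mul, coeff_serD, coeff_zero_eq_constantCoeff_apply, hF]
      simp
    · simpa only [coeff_succ_X_mul, map_sub, coeff_C_mul, coeff_serD] using h k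

/-- A solution of the quadratic equation is determined by its constant term. -/
theorem eq_of_quadForm_eq [CharZero 𝕜] {δ : Derivation 𝕜 R R} {u : R} {F G : R⟦X⟧}
    (hF : constantCoeff F = 2) (hG : constantCoeff G = 2)
    (h : quadForm δ u F = quadForm δ u G) : F = G := by
  -- If F - G = Xⁿ K, then the difference of the two equations is divisible by Xⁿ, and the constant
  -- term of the quotient is 16 K(0). Hence K(0) = 0 and one more power of X splits off.
  have key : ∀ n, ∃ K, F - G = X ^ n * K := by
    intro n
    induction n with
    | zero => exact ⟨F - G, by simp⟩
    | succ n ih =>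
      obtain ⟨K, hK⟩ := ih
      have hX : serD δ (X ^ n : R⟦X⟧) = 0 := by
        rw [Derivation.leibniz_pow, serD_X, smul_zero, smul_zero]
      have hF' : F = G + X ^ n * K := by rw [← hK]; ring
      have h1 : X ^ n * (X * ((serD δ F + serD δ G) * serD δ K - 2 * (K * serD δ (serD δ F))
          - 2 * (G * serD δ (serD δ K)) + 4 * (C u * ((F + G) * K))) + 4 * ((F + G) * K)) = 0 := by
        rw [hF'] at h ⊢
        simp only [quadForm, map_add, Derivation.leibniz, hX, smul_eq_mul, mul_zero, add_zero,
          zero_add] at h ⊢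
        linear_combination h
      have h2 : X * ((serD δ F + serD δ G) * serD δ K - 2 * (K * serD δ (serD δ F))
          - 2 * (G * serD δ (serD δ K)) + 4 * (C u * ((F + G) * K))) + 4 * ((F + G) * K) = 0 := by
        ext m
        have := congrArg (coeff (m + n)) h1
        rwa [coeff_X_pow_mul, map_zero] at this
      have h3 := congrArg constantCoeff h2
      simp only [map_add, map_mul, constantCoeff_X, zero_mul, zero_add, hF, hG, map_zero,
        map_ofNat] at h3
      have h4 : constantCoeff K = 0 := by
        have h16 : (16 : R) * constantCoeff K = 0 := by linear_combination h3
        exact ((isUnit_ofNat_of_charZero (𝕜 := 𝕜) 16).mul_right_eq_zero).mp h16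
      obtain ⟨K', rfl⟩ := X_dvd_iff.mpr h4
      exact ⟨K', by rw [hK]; ring⟩
  refine sub_eq_zero.mp ?_
  ext m
  obtain ⟨K, hK⟩ := key (m + 1)
  rw [hK, coeff_X_pow_mul', if_neg (by omega), map_zero]

/-- The coefficients of the square root with constant term `1` of a power series with constant
term `1`. -/
def sqrtCoeff (m : ℕ → 𝕜) : ℕ → 𝕜
  | 0 => 1
  | n + 1 => (m (n + 1) - ∑ i : Fin n, sqrtCoeff m (i + 1) * sqrtCoeff m (n - i)) / 2
  decreasing_by all_goals omega

theorem exists_sq_eq [CharZero 𝕜] (M : 𝕜⟦X⟧) (h0 : coeff 0 M = 1) :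
    ∃ c : 𝕜⟦X⟧, coeff 0 c = 1 ∧ c * c = M := by
  refine ⟨mk (sqrtCoeff fun n => coeff n M), by simp [sqrtCoeff], ?_⟩
  ext n
  rw [coeff_mul]
  simp only [coeff_mk, Finset.Nat.sum_antidiagonal_eq_sum_range_succ_mk]
  cases n with
  | zero => simp [sqrtCoeff, h0]
  | succ n =>
    rw [Finset.sum_range_succ, Finset.sum_range_succ']
    have e : sqrtCoeff (fun n => coeff n M) (n + 1) = (coeff (n + 1) M -
        ∑ i ∈ Finset.range n, sqrtCoeff (fun n => coeff n M) (i + 1) *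
          sqrtCoeff (fun n => coeff n M) (n - i)) / 2 := by
      rw [sqrtCoeff, Finset.sum_range]
    have e0 : sqrtCoeff (fun n => coeff n M) 0 = 1 := by rw [sqrtCoeff]
    have hs : ∀ i ∈ Finset.range n, sqrtCoeff (fun n => coeff n M) (i + 1) *
        sqrtCoeff (fun n => coeff n M) (n + 1 - (i + 1))
        = sqrtCoeff (fun n => coeff n M) (i + 1) * sqrtCoeff (fun n => coeff n M) (n - i) := by
      intro i _; congr 2; omega
    rw [Finset.sum_congr rfl hs, Nat.sub_self, Nat.sub_zero, e0]
    linear_combination 2 * e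

/-- The value in a differential algebra of a differential polynomial at `u`. -/
def evDiff [CharZero 𝕜] (δ : Derivation 𝕜 R R) (u : R) : DiffPoly →+* R :=
  MvPolynomial.eval₂Hom ((algebraMap 𝕜 R).comp (algebraMap ℚ 𝕜)) (fun n => δ^[n] u)

theorem evDiff_X [CharZero 𝕜] (δ : Derivation 𝕜 R R) (u : R) (n : ℕ) :
    evDiff δ u (MvPolynomial.X n) = δ^[n] u := by
  simp [evDiff]

theorem evDiff_C [CharZero 𝕜] (δ : Derivation 𝕜 R R) (u : R) (q : ℚ) :
    evDiff δ u (MvPolynomial.C q) = algebraMap 𝕜 R q := by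
  simp [evDiff]

theorem evDiff_totalD [CharZero 𝕜] (δ : Derivation 𝕜 R R) (u : R) (p : DiffPoly) :
    evDiff δ u (totalD p) = δ (evDiff δ u p) := by
  induction p using MvPolynomial.induction_on with
  | C q =>
    rw [evDiff_C, Derivation.map_algebraMap]
    have : totalD (MvPolynomial.C q) = 0 := MvPolynomial.derivation_C _ _
    rw [this, map_zero]
  | add p q hp hq => simp only [map_add, hp, hq]
  | mul_X p n hp =>
    simp only [Derivation.leibniz, map_mul, map_add, smul_eq_mul, hp, totalD_X, evDiff_X,
      Function.iterate_succ_apply']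

variable [CharZero 𝕜]

/-- The coefficients `hₙ[u]` of the formal resolvent. -/
def resolventAt (δ : Derivation 𝕜 R R) (u : R) (n : ℕ) : R := evDiff δ u (resolventCoeff n)

theorem resolventAt_zero (δ : Derivation 𝕜 R R) (u : R) : resolventAt δ u 0 = 1 := by
  rw [resolventAt, resolventCoeff, map_one]

theorem resolventAt_lenard (δ : Derivation 𝕜 R R) (u : R) (n : ℕ) :
    4 * δ (resolventAt δ u (n + 1)) = δ (δ (δ (resolventAt δ u n)))
      - 2 * (δ u * resolventAt δ u n) - 4 * (u * δ (resolventAt δ u n)) := by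
  have h := congrArg (evDiff δ u) (resolventCoeff_lenard n)
  simp only [map_mul, map_sub, map_ofNat, evDiff_totalD, evDiff_X, Function.iterate_zero, id,
    Function.iterate_one] at h
  simp only [resolventAt]
  linear_combination h

theorem resolventAt_one (δ : Derivation 𝕜 R R) (u : R) : 2 * resolventAt δ u 1 = -u := by
  have h0 : resolventCoeff 0 = 1 := by rw [resolventCoeff]
  rw [resolventAt, resolventCoeff]
  simp only [Fin.sum_univ_succ, Fin.sum_univ_zero, add_zero, Fin.val_zero, Nat.sub_self, h0, Derivation.map_one_eq_zero, map_mul,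
    map_neg, map_add, map_sub, map_zero, evDiff_X, evDiff_C, map_ofNat, map_one,
    Function.iterate_zero, id]
  have h8 : (8 : R) * algebraMap 𝕜 R ((1 / 8 : ℚ) : 𝕜) = 1 := by
    have : (8 : R) = algebraMap 𝕜 R 8 := (map_ofNat _ 8).symm
    rw [this, ← map_mul]
    norm_num
  linear_combination (-u) * h8

theorem coeff_const_mul_resolvent (δ : Derivation 𝕜 R R) (u : R) (c : 𝕜⟦X⟧) (n : ℕ) :
    coeff n (map (algebraMap 𝕜 R) c * (2 * mk (resolventAt δ u)))
      = ∑ j ∈ Finset.range (n + 1), algebraMap 𝕜 R (coeff j c) *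
        (2 * resolventAt δ u (n - j)) := by
  have h2 : (2 : R⟦X⟧) = C (2 : R) := (map_ofNat C 2).symm
  rw [coeff_mul, Finset.Nat.sum_antidiagonal_eq_sum_range_succ_mk]
  exact Finset.sum_congr rfl fun j _ => by rw [h2, coeff_C_mul, coeff_map, coeff_mk]

theorem quadForm_resolvent (δ : Derivation 𝕜 R R) (u : R) :
    quadForm δ u (mk (resolventAt δ u)) = 4 := by
  have h := congrArg (map (evDiff δ u)) resolventSeries_quadratic
  have hm : ∀ F, map (evDiff δ u) (seriesD F) = serD δ (map (evDiff δ u) F) := by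
    intro F; ext n; simp [seriesD, evDiff_totalD]
  have hr : map (evDiff δ u) resolventSeries = mk (resolventAt δ u) := by
    ext n; simp [resolventSeries, resolventAt]
  simp only [map_add, map_mul, map_sub, map_ofNat, hm, hr, map_X, map_C, evDiff_X,
    Function.iterate_zero, id] at h
  rw [quadForm]
  linear_combination h

/-- The resolvent multiplied by a series with constant coefficients. -/
theorem quadForm_const_mul (δ : Derivation 𝕜 R R) (u : R) (c : 𝕜⟦X⟧) (F : R⟦X⟧) :
    quadForm δ u (map (algebraMap 𝕜 R) c * F) = map (algebraMap 𝕜 R) c ^ 2 * quadForm δ u F := by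
  simp only [quadForm, Derivation.leibniz, map_add, smul_eq_mul, serD_map_algebraMap, mul_zero,
    add_zero]
  ring

/-- `r_k[u]`. -/
def kdvAt (δ : Derivation 𝕜 R R) (u : R) (k : ℕ) : R := evDiff δ u (kdvRHS k)

theorem kdvAt_eq (δ : Derivation 𝕜 R R) (u : R) (k : ℕ) :
    kdvAt δ u k = -2 * δ (resolventAt δ u (k + 1)) := by
  rw [kdvAt, kdvRHS_eq, map_mul, evDiff_totalD, resolventAt, map_neg, map_ofNat]

/-- A constant factor c multiplies the quadratic form by c², and 2H has quadratic form 16. So c · 2H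
has the same quadratic form and constant term as W, and uniqueness applies. -/
theorem eq_resolvent_mul (δ : Derivation 𝕜 R R) (u : R) {W : R⟦X⟧} (hW : constantCoeff W = 2)
    {c : 𝕜⟦X⟧} (hc : coeff 0 c = 1)
    (h : quadForm δ u W = 16 * map (algebraMap 𝕜 R) (c * c)) :
    W = map (algebraMap 𝕜 R) c * (2 * mk (resolventAt δ u)) := by
  refine eq_of_quadForm_eq (δ := δ) (u := u) hW ?_ ?_
  · rw [map_mul, map_mul, map_ofNat, constantCoeff_mk, resolventAt_zero]
    rw [← coeff_zero_eq_constantCoeff_apply, coeff_map, hc]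
    simp
  · have h2 : (2 : R⟦X⟧) = map (algebraMap 𝕜 R) 2 := (map_ofNat _ 2).symm
    rw [h, quadForm_const_mul, h2, quadForm_const_mul, quadForm_resolvent, ← h2, map_mul]
    ring

/-- If a series with vanishing `(g+1)`-st coefficient satisfies the quadratic equation with constant
right-hand side, then `u` satisfies a stationary equation. -/
theorem novikov_of_quadForm (g : ℕ) (M : 𝕜⟦X⟧) (h0 : coeff 0 M = 16) (h1 : coeff 1 M = 0) :
    ∃ a : ℕ → 𝕜, ∀ {R : Type*} [CommRing R] [Algebra 𝕜 R] (δ : Derivation 𝕜 R R) (u : R)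
      (W : R⟦X⟧), constantCoeff W = 2 → coeff (g + 1) W = 0 →
      quadForm δ u W = map (algebraMap 𝕜 R) M →
      kdvAt δ u g + ∑ k ∈ Finset.range (g - 1), algebraMap 𝕜 R (a k) * kdvAt δ u k = 0 := by
  obtain ⟨c, hc0, hc⟩ := exists_sq_eq (C (1 / 16) * M) (by rw [coeff_C_mul, h0]; norm_num)
  have hM : M = 16 * (c * c) := by
    have h16 : (16 : 𝕜⟦X⟧) = C (16 : 𝕜) := (map_ofNat C 16).symm
    rw [hc, ← mul_assoc, h16, ← map_mul]
    norm_num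
  -- This is the source of the normalization: c₁ will be the coefficient of r_{g-1}.
  have hc1 : coeff 1 c = 0 := by
    have := congrArg (coeff 1) hc
    rw [coeff_C_mul, h1, coeff_mul, Finset.Nat.sum_antidiagonal_eq_sum_range_succ_mk,
      Finset.sum_range_succ, Finset.sum_range_one] at this
    simp only [hc0, Nat.sub_zero, Nat.sub_self] at this
    linear_combination this / 2
  -- In 0 = ∑ⱼ 2cⱼ h_{g+1-j}' the term with index j is -cⱼ r_{g-j}; the last one vanishes since h₀ =
  -- 1. These constants depend on M and g only, not on the ring or on W.
  refine ⟨fun k => coeff (g - k) c, fun {R} _ _ δ u W hW hg hq => ?_⟩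
  have hq' : quadForm δ u W = 16 * map (algebraMap 𝕜 R) (c * c) := by
    rw [hq, hM, map_mul, map_ofNat]
  have hW' := eq_resolvent_mul δ u hW hc0 hq'
  have e := congrArg (fun F => δ (coeff (g + 1) F)) hW'
  simp only [hg, map_zero, coeff_const_mul_resolvent, map_sum,
    Derivation.leibniz, Derivation.map_algebraMap, smul_eq_mul, derivation_ofNat, mul_zero,
    add_zero] at e
  rw [Finset.sum_range_succ, Nat.sub_self, resolventAt_zero, Derivation.map_one_eq_zero, mul_zero,
    mul_zero, add_zero] at e
  simp only [kdvAt_eq]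
  cases g with
  | zero => simpa [hc0] using e.symm
  | succ g =>
    rw [Finset.sum_range_succ', Finset.sum_range_succ', hc0, zero_add, hc1, map_zero, zero_mul,
      add_zero, map_one, ← Finset.sum_range_reflect] at e
    have hs : ∀ k ∈ Finset.range g, algebraMap 𝕜 R (coeff (g - 1 - k + 1 + 1) c) *
        (2 * δ (resolventAt δ u (g + 1 + 1 - (g - 1 - k + 1 + 1))))
        = algebraMap 𝕜 R (coeff (g + 1 - k) c) * (2 * δ (resolventAt δ u (k + 1))) := by
      intro k hk
      rw [Finset.mem_range] at hk
      have e1 : g - 1 - k + 1 + 1 = g + 1 - k := by omega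
      have e2 : g + 1 + 1 - (g + 1 - k) = k + 1 := by omega
      rw [e1, e2]
    rw [Finset.sum_congr rfl hs] at e
    simp only [Nat.add_sub_cancel]
    have hs2 : ∑ k ∈ Finset.range g, algebraMap 𝕜 R (coeff (g + 1 - k) c) *
        (-2 * δ (resolventAt δ u (k + 1))) = -∑ k ∈ Finset.range g,
        algebraMap 𝕜 R (coeff (g + 1 - k) c) * (2 * δ (resolventAt δ u (k + 1))) := by
      rw [← Finset.sum_neg_distrib]
      exact Finset.sum_congr rfl fun k _ => by ring
    rw [hs2]
    simp only [Nat.sub_zero] at e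
    linear_combination e

/-- Conversely, a solution of a normalized stationary equation determines a polynomial solution of
the linear equation. -/
theorem exists_lenard_of_novikov (g : ℕ) (δ : Derivation 𝕜 R R) (u : R) (a : ℕ → 𝕜)
    (h : kdvAt δ u (g + 1) + ∑ k ∈ Finset.range g, algebraMap 𝕜 R (a k) * kdvAt δ u k = 0) :
    ∃ W : R⟦X⟧, constantCoeff W = 2 ∧ coeff 1 W = -u ∧ (∀ k, g + 1 < k → coeff k W = 0) ∧
      IsLenard δ u W := by
  -- The genus is g + 1 here, so cⱼ = a_{g+1-j} for j ≥ 2, and c₁ = 0 encodes the normalization.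
  set c : ℕ → 𝕜 := fun j => if j = 0 then 1 else if j = 1 then 0 else a (g + 1 - j) with hc
  set F : R⟦X⟧ := map (algebraMap 𝕜 R) (mk c) * (2 * mk (resolventAt δ u)) with hF
  have hcoeff : ∀ n, coeff n F = ∑ j ∈ Finset.range (n + 1), algebraMap 𝕜 R (c j) *
      (2 * resolventAt δ u (n - j)) := by
    intro n
    simp only [hF, coeff_const_mul_resolvent, coeff_mk]
  have hF0 : constantCoeff F = 2 := by
    rw [← coeff_zero_eq_constantCoeff_apply, hcoeff]
    simp [hc, resolventAt_zero]
  have hFL : IsLenard δ u F := by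
    refine isLenard_of_serD_quadForm hF0 ?_
    have h2' : (2 : R⟦X⟧) = map (algebraMap 𝕜 R) 2 := (map_ofNat _ 2).symm
    have h4' : (4 : R⟦X⟧) = map (algebraMap 𝕜 R) 4 := (map_ofNat _ 4).symm
    rw [hF, h2', quadForm_const_mul, quadForm_const_mul, quadForm_resolvent, h4', ← map_pow,
      ← map_pow, ← map_mul, ← map_mul, serD_map_algebraMap]
  have hFg : δ (coeff (g + 2) F) = 0 := by
    rw [hcoeff]
    simp only [map_sum, Derivation.leibniz, Derivation.map_algebraMap, smul_eq_mul,
      derivation_ofNat, mul_zero, add_zero]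
    rw [Finset.sum_range_succ, Nat.sub_self, resolventAt_zero, Derivation.map_one_eq_zero,
      mul_zero, mul_zero, add_zero, Finset.sum_range_succ', Finset.sum_range_succ',
      ← Finset.sum_range_reflect]
    simp only [kdvAt_eq] at h
    have hs : ∀ k ∈ Finset.range g, algebraMap 𝕜 R (c (g - 1 - k + 1 + 1)) *
        (2 * δ (resolventAt δ u (g + 2 - (g - 1 - k + 1 + 1))))
        = -(algebraMap 𝕜 R (a k) * (-2 * δ (resolventAt δ u (k + 1)))) := by
      intro k hk
      rw [Finset.mem_range] at hk
      have e1 : c (g - 1 - k + 1 + 1) = a k := by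
        simp only [hc]
        rw [if_neg (by omega), if_neg (by omega)]
        congr 1; omega
      have e2 : g + 2 - (g - 1 - k + 1 + 1) = k + 1 := by omega
      rw [e1, e2]; ring
    rw [Finset.sum_congr rfl hs, Finset.sum_neg_distrib]
    have e0 : c 0 = 1 := by simp [hc]
    have e1 : c (0 + 1) = 0 := by simp [hc]
    rw [e0, e1, map_one, map_zero, Nat.sub_zero]
    linear_combination -h
  -- Truncation affects the recursion only at the passage from index g + 1 to g + 2, and there the
  -- discarded coefficient has derivative zero by `hFg`.
  refine ⟨mk fun k => if k ≤ g + 1 then coeff k F else 0, ?_, ?_, ?_, ?_⟩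
  · rw [← coeff_zero_eq_constantCoeff_apply, coeff_mk, if_pos (by omega),
      coeff_zero_eq_constantCoeff_apply, hF0]
  · rw [coeff_mk, if_pos (by omega), hcoeff, Finset.sum_range_succ, Finset.sum_range_one]
    simp [hc, resolventAt_one]
  · intro k hk
    rw [coeff_mk, if_neg (by omega)]
  · rw [isLenard_iff_coeff (by rw [← coeff_zero_eq_constantCoeff_apply, coeff_mk,
      if_pos (by omega), coeff_zero_eq_constantCoeff_apply, hF0])]
    rw [isLenard_iff_coeff hF0] at hFL
    intro k
    simp only [coeff_mk]
    rcases lt_trichotomy k (g + 1) with hk | rfl | hk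
    · rw [if_pos (by omega), if_pos (by omega)]
      exact hFL k
    · rw [if_pos le_rfl, if_neg (by omega), hFL (g + 1), hFg, map_zero]
    · rw [if_neg (by omega), if_neg (by omega)]
      simp

/-! ### Adding a constant -/

/-- Under u ↦ u + c the Lenard recursion acquires the extra term -4c hₙ'. By induction hₙ₊₁[u + c]
and ∑ βⱼ (hⱼ₊₁[u] - c hⱼ[u]) have the same derivative, so they differ by a constant, which is a
multiple of h₀. The subleading coefficient starts at -c/2 and decreases by c at each step. -/
theorem resolventAt_add_const (δ : Derivation 𝕜 R R)
    (hker : ∀ f, δ f = 0 → ∃ k : 𝕜, f = algebraMap 𝕜 R k) (u : R) (c : 𝕜) (n : ℕ) :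
    ∃ β : ℕ → 𝕜, resolventAt δ (u + algebraMap 𝕜 R c) n
        = ∑ j ∈ Finset.range (n + 1), algebraMap 𝕜 R (β j) * resolventAt δ u j ∧
      β n = 1 ∧ ∀ m, n = m + 1 → β m = -c * (m + 1 / 2) := by
  have h4 := isUnit_ofNat_of_charZero (𝕜 := 𝕜) (R := R) 4
  have h2 := isUnit_ofNat_of_charZero (𝕜 := 𝕜) (R := R) 2
  induction n with
  | zero => exact ⟨fun _ => 1, by simp [resolventAt_zero], rfl, fun m hm => by omega⟩
  | succ n ih =>
    cases n with
    | zero =>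
      refine ⟨fun j => if j = 1 then 1 else -c / 2, ?_, by simp, fun m hm => ?_⟩
      · refine h2.mul_left_cancel ?_
        rw [zero_add, resolventAt_one, Finset.sum_range_succ, Finset.sum_range_one,
          resolventAt_zero]
        have e := resolventAt_one δ u
        have e2 : (2 : R) * algebraMap 𝕜 R (-c / 2) = -algebraMap 𝕜 R c := by
          have : (2 : R) = algebraMap 𝕜 R 2 := (map_ofNat _ 2).symm
          rw [this, ← map_mul, ← map_neg]
          congr 1; ring
        simp only [if_true, zero_ne_one, if_false, map_one]
        linear_combination -e - e2
      · obtain rfl : m = 0 := by omega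
        simp; ring
    | succ n =>
      obtain ⟨β, hβ, hβ1, hβ2⟩ := ih
      have hd : δ (resolventAt δ (u + algebraMap 𝕜 R c) (n + 1 + 1)
          - ∑ j ∈ Finset.range (n + 1 + 1), algebraMap 𝕜 R (β j) * resolventAt δ u (j + 1)
          + algebraMap 𝕜 R c *
            ∑ j ∈ Finset.range (n + 1 + 1), algebraMap 𝕜 R (β j) * resolventAt δ u j) = 0 := by
        refine h4.mul_left_cancel ?_
        have hl := resolventAt_lenard δ (u + algebraMap 𝕜 R c) (n + 1)
        rw [hβ] at hl
        have hs : ∑ j ∈ Finset.range (n + 1 + 1), algebraMap 𝕜 R (β j) *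
              (4 * δ (resolventAt δ u (j + 1)))
            = ∑ j ∈ Finset.range (n + 1 + 1), algebraMap 𝕜 R (β j) *
              (δ (δ (δ (resolventAt δ u j)))
              - 2 * (δ u * resolventAt δ u j) - 4 * (u * δ (resolventAt δ u j))) :=
          Finset.sum_congr rfl fun j _ => by rw [resolventAt_lenard]
        simp only [mul_sub, Finset.sum_sub_distrib, mul_left_comm (algebraMap 𝕜 R (β _)),
          ← Finset.mul_sum] at hs
        simp only [map_add, map_sub, map_sum, Derivation.leibniz, Derivation.map_algebraMap,
          smul_eq_mul, mul_zero, add_zero] at hl ⊢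
        linear_combination hl - hs
      obtain ⟨k, hk⟩ := hker _ hd
      -- The integration constant enters at j = 0. The value of `β` at n + 2 lies outside its range
      -- and is arbitrary, so it is replaced by zero.
      refine ⟨fun j => (if j = 0 then k else β (j - 1)) - (if j = n + 1 + 1 then 0 else c * β j),
        ?_, ?_, ?_⟩
      · have e1 : ∀ j ∈ Finset.range (n + 1 + 1), algebraMap 𝕜 R
            ((if j = 0 then k else β (j - 1)) - (if j = n + 1 + 1 then 0 else c * β j)) *
              resolventAt δ u j = algebraMap 𝕜 R (if j = 0 then k else β (j - 1)) *
              resolventAt δ u j - algebraMap 𝕜 R c * (algebraMap 𝕜 R (β j) *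
              resolventAt δ u j) := by
          intro j hj
          rw [Finset.mem_range] at hj
          rw [if_neg (show j ≠ n + 1 + 1 by omega), map_sub, map_mul]; ring
        rw [Finset.sum_range_succ, Finset.sum_congr rfl e1, Finset.sum_sub_distrib,
          ← Finset.mul_sum, Finset.sum_range_succ' (fun j => algebraMap 𝕜 R
            (if j = 0 then k else β (j - 1)) * resolventAt δ u j)]
        rw [Finset.sum_range_succ (fun j => algebraMap 𝕜 R (β j) * resolventAt δ u (j + 1))] at hk
        have e3 : (fun j => (if j = 0 then k else β (j - 1)) -
            if j = n + 1 + 1 then 0 else c * β j) (n + 2) = 1 := by simp [hβ1]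
        rw [hβ1, map_one] at hk
        rw [e3, map_one]
        simp only [Nat.add_eq_zero_iff, one_ne_zero, and_false, if_false, if_true,
          Nat.add_sub_cancel, resolventAt_zero]
        linear_combination hk
      · simp [hβ1]
      · intro m hm
        obtain rfl : m = n + 1 := by omega
        simp only [Nat.add_eq_zero_iff, one_ne_zero, and_false, if_false, Nat.add_sub_cancel, hβ1]
        rw [if_neg (by omega), hβ2 n rfl]
        push_cast; ring

/-- The shift is unitriangular on r₀, …, r_{m+1}. Only the change of the coefficient of r_m is
recorded: it is proportional to c with a nonzero factor, so it can be given any value. -/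
theorem novikov_add_const (δ : Derivation 𝕜 R R)
    (hker : ∀ f, δ f = 0 → ∃ k : 𝕜, f = algebraMap 𝕜 R k) (u : R) (c : 𝕜) (m : ℕ) (a : ℕ → 𝕜) :
    ∃ a' : ℕ → 𝕜, a' m = a m - c * (m + 3 / 2) ∧
      kdvAt δ (u + algebraMap 𝕜 R c) (m + 1)
        + ∑ k ∈ Finset.range (m + 1), algebraMap 𝕜 R (a k) * kdvAt δ (u + algebraMap 𝕜 R c) k
      = kdvAt δ u (m + 1) + ∑ k ∈ Finset.range (m + 1), algebraMap 𝕜 R (a' k) * kdvAt δ u k := by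
  choose β hβ hβ1 hβ2 using fun n => resolventAt_add_const δ hker u c n
  have hr : ∀ k, kdvAt δ (u + algebraMap 𝕜 R c) k
      = ∑ j ∈ Finset.range (k + 1), algebraMap 𝕜 R (β (k + 1) (j + 1)) * kdvAt δ u j := by
    intro k
    simp only [kdvAt_eq]
    rw [hβ, Finset.sum_range_succ', map_add, resolventAt_zero]
    simp only [map_sum, Derivation.leibniz, Derivation.map_algebraMap, smul_eq_mul, mul_zero,
      add_zero, Derivation.map_one_eq_zero, Finset.mul_sum]
    exact Finset.sum_congr rfl fun j _ => by ring
  have hr' : ∀ k ∈ Finset.range (m + 1), algebraMap 𝕜 R (a k) * kdvAt δ (u + algebraMap 𝕜 R c) k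
      = ∑ j ∈ Finset.range (m + 1), algebraMap 𝕜 R (a k * if j ≤ k then β (k + 1) (j + 1) else 0)
        * kdvAt δ u j := by
    intro k hk
    rw [Finset.mem_range] at hk
    rw [hr, Finset.mul_sum]
    rw [← Finset.sum_subset (s₁ := Finset.range (k + 1)) (s₂ := Finset.range (m + 1))]
    · refine Finset.sum_congr rfl fun j hj => ?_
      rw [Finset.mem_range] at hj
      rw [if_pos (by omega), map_mul]; ring
    · exact Finset.range_subset_range.mpr (by omega)
    · intro j _ hj
      rw [Finset.mem_range] at hj
      rw [if_neg (by omega)]; simp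
  refine ⟨fun j => β (m + 1 + 1) (j + 1) + ∑ k ∈ Finset.range (m + 1),
    a k * if j ≤ k then β (k + 1) (j + 1) else 0, ?_, ?_⟩
  · simp only []
    rw [Finset.sum_range_succ, Finset.sum_eq_zero, if_pos le_rfl, hβ1, hβ2 (m + 1 + 1) (m + 1) rfl]
    · push_cast; ring
    · intro k hk
      rw [Finset.mem_range] at hk
      rw [if_neg (by omega), mul_zero]
  · rw [Finset.sum_congr rfl hr', hr, Finset.sum_range_succ _ (m + 1), hβ1, map_one, one_mul,
      Finset.sum_comm]
    simp only [map_add, map_sum, add_mul, Finset.sum_add_distrib, Finset.sum_mul]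
    ring

end SeriesAlgebra

end

noncomputable section

/-! ### The operators `L`, `Uᵢ` over a differential algebra -/

section Operators

variable {𝕜 R : Type*} [Field 𝕜] [CharZero 𝕜] [CommRing R] [Algebra 𝕜 R] {g : ℕ}

open PowerSeries

/-- `∂_{i+1}`, or zero if `i` is the last index. -/
def nextDer (d : Fin g → Derivation 𝕜 R R) (i : Fin g) : Derivation 𝕜 R R :=
  if h : (i : ℕ) + 1 < g then d ⟨i + 1, h⟩ else 0

/-- The polynomial `2 - ∑ uᵢ ξⁱ` as a power series. -/
def wSeries (u : Fin g → R) : R⟦X⟧ :=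
  mk fun n => if n = 0 then 2 else if h : n - 1 < g then -u ⟨n - 1, h⟩ else 0

theorem coeff_zero_wSeries (u : Fin g → R) : coeff 0 (wSeries u) = 2 := by
  simp [wSeries]

theorem constantCoeff_wSeries (u : Fin g → R) : constantCoeff (wSeries u) = 2 := by
  rw [← coeff_zero_eq_constantCoeff_apply, coeff_zero_wSeries]

theorem coeff_succ_wSeries (u : Fin g → R) (i : Fin g) :
    coeff ((i : ℕ) + 1) (wSeries u) = -u i := by
  simp [wSeries]

theorem coeff_wSeries_of_lt (u : Fin g → R) {n : ℕ} (h : g < n) : coeff n (wSeries u) = 0 := by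
  rw [wSeries, coeff_mk, if_neg (by omega), dif_neg (by omega)]

theorem coeff_one_wSeries [NeZero g] (u : Fin g → R) : coeff 1 (wSeries u) = -u 0 := by
  simpa using coeff_succ_wSeries u 0

theorem derivation_coeff_wSeries (D : Derivation 𝕜 R R) {d : Fin g → Derivation 𝕜 R R}
    {u : Fin g → R} {v : R} (h : ∀ i, d i v = D (u i)) (i : Fin g) :
    D (coeff ((i : ℕ) + 1 + 1) (wSeries u)) = -nextDer d i v := by
  by_cases hi : (i : ℕ) + 1 < g
  · have := coeff_succ_wSeries u ⟨i + 1, hi⟩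
    rw [this, nextDer, dif_pos hi, map_neg, h]
  · rw [coeff_wSeries_of_lt u (by omega), nextDer, dif_neg hi, map_zero]
    simp

theorem nextDer_comm {d : Fin g → Derivation 𝕜 R R} {D : Derivation 𝕜 R R}
    (h : ∀ i f, D (d i f) = d i (D f)) (i : Fin g) (f : R) :
    D (nextDer d i f) = nextDer d i (D f) := by
  rw [nextDer]
  split_ifs
  · exact h _ f
  · simp

variable [NeZero g]

/-- The operator `L = ∂ₓ² - u₁`. -/
def algL (d : Fin g → Derivation 𝕜 R R) (u : Fin g → R) (f : R) : R := d 0 (d 0 f) - u 0 * f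

/-- The operator `4 Uᵢ`. -/
def algU (d : Fin g → Derivation 𝕜 R R) (u : Fin g → R) (i : Fin g) (f : R) : R :=
  4 * d 0 (d 0 (d i f)) - 2 * (u 0 * d i f + d i (u 0 * f)) - (u i * d 0 f + d 0 (u i * f))
    - 4 * nextDer d i f

/-- Testing on 1, x, x², x³ yields the coefficients one after the other, up to the units 2 and 6. -/
theorem coeff_eq_zero_of_thirdOrder {δ : Derivation 𝕜 R R} {x : R} (hx : δ x = 1) {s p q r : R}
    (h : ∀ f, s * δ (δ (δ f)) + p * δ (δ f) + q * δ f + r * f = 0) :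
    s = 0 ∧ p = 0 ∧ q = 0 ∧ r = 0 := by
  have h2 := isUnit_ofNat_of_charZero (𝕜 := 𝕜) (R := R) 2
  have h6 := isUnit_ofNat_of_charZero (𝕜 := 𝕜) (R := R) 6
  have e0 := h 1
  have e1 := h x
  have e2 := h (x * x)
  have e3 := h (x * (x * x))
  simp only [Derivation.map_one_eq_zero, map_zero, mul_zero, zero_add, mul_one] at e0
  simp only [hx, Derivation.map_one_eq_zero, map_zero, mul_zero, zero_add, mul_one, e0, zero_mul,
    add_zero] at e1
  simp only [Derivation.leibniz, hx, Derivation.map_one_eq_zero, map_zero, mul_zero, zero_add,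
    mul_one, e0, e1, zero_mul, add_zero, smul_eq_mul, map_add] at e2
  have e2' : p = 0 := h2.mul_right_eq_zero.mp (by linear_combination e2)
  simp only [Derivation.leibniz, hx, Derivation.map_one_eq_zero, map_zero, mul_zero, zero_add,
    mul_one, e0, e1, e2', zero_mul, add_zero, smul_eq_mul, map_add] at e3
  exact ⟨h6.mul_right_eq_zero.mp (by linear_combination e3), e2', e1, e0⟩

/-- The compatibility conditions: `L` commutes with the operators `Uᵢ`. -/
structure IsLaxCompatible (d : Fin g → Derivation 𝕜 R R) (u : Fin g → R) : Prop where
  first : ∀ i, d i (u 0) = d 0 (u i)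
  next : ∀ i, d 0 (d 0 (d 0 (u i))) - 4 * (u 0 * d 0 (u i)) - 2 * (d 0 (u 0) * u i)
    = 4 * nextDer d i (u 0)

/-- By the hypothesis the right-hand side is 4u_{i+1}', or zero for the last index, which is the
recursion for the coefficients of W. The step from W₀ = 2 to W₁ = -u₁ is an identity, and beyond
degree g everything vanishes. -/
theorem isLenard_wSeries_iff {d : Fin g → Derivation 𝕜 R R} {u : Fin g → R}
    (h : ∀ i, d i (u 0) = d 0 (u i)) :
    IsLenard (d 0) (u 0) (wSeries u) ↔ ∀ i, d 0 (d 0 (d 0 (u i))) - 4 * (u 0 * d 0 (u i))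
      - 2 * (d 0 (u 0) * u i) = 4 * nextDer d i (u 0) := by
  rw [isLenard_iff_coeff (constantCoeff_wSeries u)]
  constructor
  · intro hk i
    have := hk (i + 1)
    rw [derivation_coeff_wSeries (d 0) h, coeff_succ_wSeries] at this
    simp only [map_neg] at this
    linear_combination -this
  · rintro hk (_ | k)
    · rw [coeff_zero_wSeries, coeff_one_wSeries]
      simp only [derivation_ofNat, map_zero, map_neg]
      ring
    · by_cases hkg : k < g
      · have := hk ⟨k, hkg⟩
        have e := coeff_succ_wSeries u ⟨k, hkg⟩
        have e2 := derivation_coeff_wSeries (d 0) h ⟨k, hkg⟩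
        simp only at e e2
        rw [e, e2]
        simp only [map_neg]
        linear_combination -this
      · rw [coeff_wSeries_of_lt u (by omega), coeff_wSeries_of_lt u (by omega)]
        simp

theorem IsLaxCompatible.isLenard {d : Fin g → Derivation 𝕜 R R} {u : Fin g → R}
    (h : IsLaxCompatible d u) : IsLenard (d 0) (u 0) (wSeries u) :=
  (isLenard_wSeries_iff h.first).mpr h.next

/-- All mixed derivatives of f cancel. What is left has order two in ∂ₓ alone, so powers of x
suffice as test functions. -/
theorem algL_algU_sub {d : Fin g → Derivation 𝕜 R R} (hd : ∀ i j f, d i (d j f) = d j (d i f))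
    (u : Fin g → R) (i : Fin g) (f : R) :
    algL d u (algU d u i f) - algU d u i (algL d u f) =
      4 * (d i (u 0) - d 0 (u i)) * d 0 (d 0 f)
      + 4 * (d 0 (d i (u 0)) - d 0 (d 0 (u i))) * d 0 f
      + (2 * d 0 (d 0 (d i (u 0))) - 4 * (d i (u 0) * u 0) - 2 * (u i * d 0 (u 0))
        - d 0 (d 0 (d 0 (u i))) - 4 * nextDer d i (u 0)) * f := by
  have he := nextDer_comm (d := d) (D := d 0) (hd 0) i
  have h0 := fun f => hd i 0 f
  simp only [algL, algU]
  generalize nextDer d i = e at *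
  generalize d i = a at *
  generalize d 0 = δ at *
  simp only [map_add, map_sub, Derivation.leibniz, smul_eq_mul, derivation_ofNat, map_zero, h0, ← he]
  ring

theorem forall_algL_algU_iff {d : Fin g → Derivation 𝕜 R R}
    (hd : ∀ i j f, d i (d j f) = d j (d i f)) (u : Fin g → R) {x : R} (hx : d 0 x = 1) :
    (∀ i f, algL d u (algU d u i f) = algU d u i (algL d u f)) ↔ IsLaxCompatible d u := by
  have h4 := isUnit_ofNat_of_charZero (𝕜 := 𝕜) (R := R) 4
  constructor
  · intro h
    have key : ∀ i, d i (u 0) = d 0 (u i) ∧ 2 * d 0 (d 0 (d i (u 0))) - 4 * (d i (u 0) * u 0)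
        - 2 * (u i * d 0 (u 0)) - d 0 (d 0 (d 0 (u i))) - 4 * nextDer d i (u 0) = 0 := by
      intro i
      obtain ⟨-, h1, -, h3⟩ := coeff_eq_zero_of_thirdOrder (s := 0) hx fun f => by
        have := algL_algU_sub hd u i f
        rw [h i f, sub_self] at this
        rw [zero_mul, zero_add, ← this]
      exact ⟨sub_eq_zero.mp (h4.mul_right_eq_zero.mp h1), h3⟩
    refine ⟨fun i => (key i).1, fun i => ?_⟩
    have := (key i).2
    rw [(key i).1] at this
    linear_combination this
  · intro h i f
    refine sub_eq_zero.mp ?_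
    have := h.next i
    rw [algL_algU_sub hd, h.first]
    linear_combination f * this

/-- Up to the multiple 4∂ᵢL the operator 4Uᵢ has order one. This reduces the commutators of the Uᵢ
to first-order computations. -/
theorem algU_eq {d : Fin g → Derivation 𝕜 R R} (hd : ∀ i j f, d i (d j f) = d j (d i f))
    {u : Fin g → R} (h : ∀ i, d i (u 0) = d 0 (u i)) (i : Fin g) (f : R) :
    algU d u i f = 4 * d i (algL d u f) + d 0 (u i) * f - 2 * (u i * d 0 f)
      - 4 * nextDer d i f := by
  simp only [algL, algU, map_sub, Derivation.leibniz, smul_eq_mul, h, hd i 0]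
  ring

/-- The obstruction to the commutation of `Uᵢ` and `Uⱼ`. -/
def flowDefect (d : Fin g → Derivation 𝕜 R R) (u : Fin g → R) (i j : Fin g) : R :=
  2 * (nextDer d i (u j) - nextDer d j (u i)) + (u i * d 0 (u j) - u j * d 0 (u i))

/-- Both factors are expanded by `algU_eq`, and L is moved past the remaining Uⱼ by `hL`. The terms
with derivatives other than ∂ₓ then cancel. -/
theorem algU_algU_sub {d : Fin g → Derivation 𝕜 R R} (hd : ∀ i j f, d i (d j f) = d j (d i f))
    {u : Fin g → R} (h : ∀ i, d i (u 0) = d 0 (u i))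
    (hL : ∀ i f, algL d u (algU d u i f) = algU d u i (algL d u f)) (i j : Fin g) (f : R) :
    algU d u i (algU d u j f) - algU d u j (algU d u i f) =
      8 * (d j (u i) - d i (u j)) * d 0 (algL d u f)
      - 4 * d 0 (d j (u i) - d i (u j)) * algL d u f
      + 4 * flowDefect d u i j * d 0 f - 2 * d 0 (flowDefect d u i j) * f := by
  rw [algU_eq hd h i, algU_eq hd h j (algU d u i f), hL, hL]
  simp only [algU_eq hd h, flowDefect]
  generalize algL d u (algL d u f) = K
  generalize algL d u f = G
  have e1 := hd i 0
  have e2 := hd j 0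
  have e3 := fun f => hd i j f
  have e4 := nextDer_comm (d := d) (D := d 0) (hd 0) i
  have e5 := nextDer_comm (d := d) (D := d 0) (hd 0) j
  have e7 := nextDer_comm (d := d) (D := d j) (hd j) i
  have e8 := nextDer_comm (d := d) (D := d i) (hd i) j
  have e9 := nextDer_comm (d := d) (D := d j) (hd j) j
  have e10 := nextDer_comm (d := d) (D := nextDer d i)
    (fun k f => (nextDer_comm (d := d) (D := d k) (hd k) i f).symm) j
  generalize nextDer d i = p at *
  generalize nextDer d j = q at *
  generalize d i = a at *
  generalize d j = b at *
  generalize d 0 = δ at *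
  simp only [map_add, map_sub, Derivation.leibniz, smul_eq_mul, derivation_ofNat, e1, e2, e3,
    ← e4, ← e5, ← e7, ← e8, ← e9, e10]
  ring

/-- The conditions under which all the operators commute. -/
structure IsKdVSystem (d : Fin g → Derivation 𝕜 R R) (u : Fin g → R) : Prop
    extends IsLaxCompatible d u where
  symm : ∀ i j, d i (u j) = d j (u i)
  flow : ∀ i j, flowDefect d u i j = 0

theorem forall_algU_algU_iff {d : Fin g → Derivation 𝕜 R R}
    (hd : ∀ i j f, d i (d j f) = d j (d i f)) (u : Fin g → R) {x : R} (hx : d 0 x = 1) :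
    ((∀ i f, algL d u (algU d u i f) = algU d u i (algL d u f)) ∧
      ∀ i j f, algU d u i (algU d u j f) = algU d u j (algU d u i f)) ↔ IsKdVSystem d u := by
  have h8 := isUnit_ofNat_of_charZero (𝕜 := 𝕜) (R := R) 8
  have h4 := isUnit_ofNat_of_charZero (𝕜 := 𝕜) (R := R) 4
  constructor
  · rintro ⟨hL, hU⟩
    have hc := (forall_algL_algU_iff hd u hx).mp hL
    have key : ∀ i j, d j (u i) - d i (u j) = 0 ∧ flowDefect d u i j = 0 := by
      intro i j
      -- With L written out, the commutator has order three in ∂ₓ. Its leading coefficient gives the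
      -- symmetry, after which the coefficient of ∂ₓf reduces to the defect.
      obtain ⟨h1, -, h3, -⟩ := coeff_eq_zero_of_thirdOrder hx
        (s := 8 * (d j (u i) - d i (u j))) (p := - 4 * d 0 (d j (u i) - d i (u j)))
        (q := 4 * flowDefect d u i j - 8 * (d j (u i) - d i (u j)) * u 0)
        (r := 4 * d 0 (d j (u i) - d i (u j)) * u 0 - 8 * (d j (u i) - d i (u j)) * d 0 (u 0)
          - 2 * d 0 (flowDefect d u i j)) fun f => by
        have := algU_algU_sub hd hc.first hL i j f
        rw [hU, sub_self] at this
        simp only [algL, map_sub, Derivation.leibniz, smul_eq_mul] at this ⊢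
        linear_combination -this
      have h1' := h8.mul_right_eq_zero.mp h1
      refine ⟨h1', h4.mul_right_eq_zero.mp ?_⟩
      rw [h1'] at h3
      linear_combination h3
    exact ⟨hc, fun i j => (sub_eq_zero.mp (key i j).1).symm, fun i j => (key i j).2⟩
  · intro h
    have hL := (forall_algL_algU_iff hd u hx).mpr h.toIsLaxCompatible
    refine ⟨hL, fun i j f => sub_eq_zero.mp ?_⟩
    rw [algU_algU_sub hd h.first hL, h.flow, h.symm i j]
    simp

/-! ### The quadratic relation -/

/-- The series whose vanishing expresses the evolution of `W` along `∂_{j+1}`. -/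
def flowSeries (d : Fin g → Derivation 𝕜 R R) (u : Fin g → R) (j : Fin g) : R⟦X⟧ :=
  2 * (X * serD (nextDer d j) (wSeries u)) - 2 * serD (d j) (wSeries u)
    + X * (C (u j) * serD (d 0) (wSeries u) - C (d 0 (u j)) * wSeries u)

theorem coeff_zero_flowSeries (d : Fin g → Derivation 𝕜 R R) (u : Fin g → R) (j : Fin g) :
    coeff 0 (flowSeries d u j) = 0 := by
  have h2 : (2 : R⟦X⟧) = C (2 : R) := (map_ofNat C 2).symm
  rw [flowSeries, h2]
  simp only [map_add, map_sub, coeff_C_mul, coeff_zero_X_mul, coeff_serD, coeff_zero_wSeries,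
    derivation_ofNat]
  simp

theorem coeff_succ_flowSeries (d : Fin g → Derivation 𝕜 R R) (u : Fin g → R) (j : Fin g) (k : ℕ) :
    coeff (k + 1) (flowSeries d u j) = 2 * nextDer d j (coeff k (wSeries u))
      - 2 * d j (coeff (k + 1) (wSeries u)) + (u j * d 0 (coeff k (wSeries u))
        - d 0 (u j) * coeff k (wSeries u)) := by
  have h2 : (2 : R⟦X⟧) = C (2 : R) := (map_ofNat C 2).symm
  rw [flowSeries, h2]
  simp only [map_add, map_sub, coeff_C_mul, coeff_succ_X_mul, coeff_serD]

theorem coeff_flowSeries_of_symm {d : Fin g → Derivation 𝕜 R R} {u : Fin g → R}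
    (hs : ∀ i j, d i (u j) = d j (u i)) (i j : Fin g) :
    coeff ((i : ℕ) + 1 + 1) (flowSeries d u j) = flowDefect d u i j := by
  rw [coeff_succ_flowSeries, derivation_coeff_wSeries (d j) (v := u j) (fun i => hs i j),
    coeff_succ_wSeries, flowDefect]
  simp only [map_neg]
  ring

theorem flowSeries_eq_zero_iff {d : Fin g → Derivation 𝕜 R R} {u : Fin g → R}
    (hs : ∀ i j, d i (u j) = d j (u i)) (j : Fin g) :
    flowSeries d u j = 0 ↔ ∀ i, flowDefect d u i j = 0 := by
  constructor
  · intro h i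
    rw [← coeff_flowSeries_of_symm hs, h, map_zero]
  · intro h
    ext n
    rcases n with _ | _ | k
    · simp [coeff_zero_flowSeries]
    · rw [coeff_succ_flowSeries, coeff_zero_wSeries, coeff_one_wSeries]
      simp only [derivation_ofNat, map_neg, hs j 0, map_zero]
      ring
    · by_cases hk : k < g
      · rw [coeff_flowSeries_of_symm hs ⟨k, hk⟩ j, h, map_zero]
      · rw [coeff_succ_flowSeries, coeff_wSeries_of_lt u (by omega),
          coeff_wSeries_of_lt u (by omega)]
        simp

/-- The linearization of the quadratic form. -/
def quadLin (δ : Derivation 𝕜 R R) (u : R) (F G : R⟦X⟧) : R⟦X⟧ :=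
  X * (2 * (serD δ F * serD δ G) - 2 * (serD δ (serD δ F) * G) - 2 * (F * serD δ (serD δ G))
    + 8 * (C u * (F * G))) + 8 * (F * G)

/-- Here D, E, a stand for ∂ⱼ, ∂_{j+1}, uⱼ. The variation of the quadratic form along 2ξE - 2D
consists of its linearization at W and of a part from the variation of u. By `h1` and `h2` that part
equals the linearization applied to the Wronskian ξ(aW' - a'W), modulo the linear equation for W. -/
theorem quadLin_flow {δ D E : Derivation 𝕜 R R} (hD : ∀ f, D (δ f) = δ (D f))
    (hE : ∀ f, E (δ f) = δ (E f)) {u a : R} {W : R⟦X⟧} (hW : IsLenard δ u W) (h1 : D u = δ a)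
    (h2 : δ (δ (δ a)) - 4 * (u * δ a) - 2 * (δ u * a) = 4 * E u) :
    quadLin δ u W (2 * (X * serD E W) - 2 * serD D W + X * (C a * serD δ W - C (δ a) * W))
      = 2 * (X * serD E (quadForm δ u W)) - 2 * serD D (quadForm δ u W) := by
  have h2' := congrArg (C : R →+* R⟦X⟧) h2
  simp only [map_sub, map_mul, map_ofNat] at h2'
  rw [IsLenard] at hW
  simp only [quadForm, quadLin, map_add, map_sub, Derivation.leibniz, pow_two, smul_eq_mul,
    serD_X, serD_C, derivation_ofNat, serD_comm hD, serD_comm hE, h1, mul_zero, add_zero, zero_add]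
  linear_combination (2 * X ^ 2 * W ^ 2) * h2' - (2 * X * W * C a) * hW

/-- Induction on the index: the linear equation handles ∂ₓ, and the vanishing of the flow series
turns `quadLin_flow` into ξ ∂_{j+1}Q = ∂ⱼQ = 0, where ξ can be cancelled. -/
theorem IsKdVSystem.serD_quadForm {d : Fin g → Derivation 𝕜 R R}
    (hd : ∀ i j f, d i (d j f) = d j (d i f)) {u : Fin g → R} (h : IsKdVSystem d u) (j : Fin g) :
    serD (d j) (quadForm (d 0) (u 0) (wSeries u)) = 0 := by
  have hu2 := isUnit_ofNat_of_charZero (𝕜 := 𝕜) (R := R⟦X⟧) 2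
  have key : ∀ n (hn : n < g), serD (d ⟨n, hn⟩) (quadForm (d 0) (u 0) (wSeries u)) = 0 := by
    intro n
    induction n with
    | zero => intro hn; exact h.isLenard.serD_quadForm
    | succ n ih =>
      intro hn
      have hn' : n < g := by omega
      have hq := quadLin_flow (hd ⟨n, hn'⟩ 0)
        (fun f => (nextDer_comm (d := d) (D := d 0) (hd 0) ⟨n, hn'⟩ f).symm) h.isLenard
        (h.first ⟨n, hn'⟩) (h.next ⟨n, hn'⟩)
      have hf := (flowSeries_eq_zero_iff h.symm ⟨n, hn'⟩).mpr fun i => h.flow i _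
      rw [flowSeries] at hf
      have he : nextDer d ⟨n, hn'⟩ = d ⟨n + 1, hn⟩ := by rw [nextDer, dif_pos hn]
      rw [hf, ih hn', mul_zero, sub_zero, he] at hq
      have h0 : X * serD (d ⟨n + 1, hn⟩) (quadForm (d 0) (u 0) (wSeries u)) = 0 := by
        refine hu2.mul_right_eq_zero.mp ?_
        rw [← hq, quadLin]
        simp
      ext m
      have := congrArg (coeff (m + 1)) h0
      rwa [coeff_succ_X_mul] at this
  exact key j j.2

/-- By `quadLin_flow` the flow series S is annihilated by the linearized quadratic form. Since S' =
0, this differential equation for S collapses to multiplication by a series with constant term 16,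
which is a unit. -/
theorem isKdVSystem_of_serD_quadForm {d : Fin g → Derivation 𝕜 R R}
    (hd : ∀ i j f, d i (d j f) = d j (d i f)) {u : Fin g → R} (hs : ∀ i j, d i (u j) = d j (u i))
    (h : ∀ j, serD (d j) (quadForm (d 0) (u 0) (wSeries u)) = 0) : IsKdVSystem d u := by
  have hfirst : ∀ i, d i (u 0) = d 0 (u i) := fun i => hs i 0
  have hL := isLenard_of_serD_quadForm (constantCoeff_wSeries u) (h 0)
  have hnext := (isLenard_wSeries_iff hfirst).mp hL
  refine ⟨⟨hfirst, hnext⟩, hs, fun i j => ?_⟩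
  revert i
  rw [← flowSeries_eq_zero_iff hs]
  have hu2 := isUnit_ofNat_of_charZero (𝕜 := 𝕜) (R := R) 2
  have hδ : serD (d 0) (flowSeries d u j) = 0 := by
    ext n
    rw [coeff_serD]
    rcases n with _ | _ | k
    · simp [coeff_zero_flowSeries]
    · rw [coeff_succ_flowSeries, coeff_zero_wSeries, coeff_one_wSeries]
      simp only [derivation_ofNat, map_neg, hs j 0, map_zero]
      ring_nf
      simp
    · by_cases hk : k < g
      · rw [coeff_flowSeries_of_symm hs ⟨k, hk⟩ j, flowDefect]
        generalize (⟨k, hk⟩ : Fin g) = i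
        refine hu2.mul_right_eq_zero.mp ?_
        have e1 : d 0 (nextDer d i (u j)) = d j (nextDer d i (u 0)) := by
          rw [nextDer_comm (hd 0), nextDer_comm (hd j), hs 0 j]
        have e2 : d 0 (nextDer d j (u i)) = d i (nextDer d j (u 0)) := by
          rw [nextDer_comm (hd 0), nextDer_comm (hd i), hs 0 i]
        have e3 := congrArg (d j) (hnext i)
        -- Cross-differentiation: ∂ⱼ of the recursion for i minus ∂ᵢ of the one for j is, by the
        -- symmetry, the x-derivative of the defect up to a factor.
        have e4 := congrArg (d i) (hnext j)
        simp only [map_add, map_sub, Derivation.leibniz, smul_eq_mul, derivation_ofNat, e1, e2,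
          hd j 0, hd i 0, hs j i, hs j 0, hs i 0, map_zero] at e3 e4 ⊢
        linear_combination e4 - e3
      · rw [coeff_succ_flowSeries, coeff_wSeries_of_lt u (by omega),
          coeff_wSeries_of_lt u (by omega)]
        simp
  have hq := quadLin_flow (hd j 0)
    (fun f => (nextDer_comm (d := d) (D := d 0) (hd 0) j f).symm) hL (hfirst j) (hnext j)
  have he : serD (nextDer d j) (quadForm (d 0) (u 0) (wSeries u)) = 0 := by
    rw [nextDer]
    split_ifs with hj
    · exact h _
    · ext n; simp
  rw [← flowSeries, he, h j, quadLin, hδ] at hq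
  have hu : IsUnit (8 * wSeries u - 2 * (X * serD (d 0) (serD (d 0) (wSeries u)))
      + 8 * (X * (C (u 0) * wSeries u))) := by
    rw [isUnit_iff_constantCoeff]
    simp only [map_add, map_sub, map_mul, constantCoeff_X, zero_mul, mul_zero, map_ofNat,
      constantCoeff_wSeries, add_zero, sub_zero]
    exact (isUnit_ofNat_of_charZero (𝕜 := 𝕜) 8).mul hu2
  refine hu.mul_right_eq_zero.mp ?_
  simp only [map_zero] at hq
  linear_combination hq

end Operators

end

noncomputable section

/-! ### The polynomial phase space -/

/-- In generating functions the recursion compares E(i+1, j) with E(i, j+1). Multiplied by y and by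
x respectively, both sums become the full generating function of E, because E vanishes on the
boundary of the index square. -/
theorem two_mul_telescope {R : Type*} [CommRing R] {g : ℕ} {E c : ℕ → ℕ → R}
    (hE0 : ∀ j, E 0 j = 0) (h0E : ∀ i, E i 0 = 0) (hEg : ∀ j, E (g + 1) j = 0)
    (hgE : ∀ i, E i (g + 1) = 0) (h : ∀ i j, 2 * E (i + 1) j = 2 * E i (j + 1) + c i j) (x y : R) :
    2 * ((x - y) * ∑ i ∈ Finset.range g, ∑ j ∈ Finset.range (g + 1), y ^ i * x ^ j * E (i + 1) j)
      = x * ∑ i ∈ Finset.range (g + 1), ∑ j ∈ Finset.range (g + 1), y ^ i * x ^ j * c i j := by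
  have hS : ∑ i ∈ Finset.range g, ∑ j ∈ Finset.range (g + 1), y ^ i * x ^ j * E (i + 1) j
      = ∑ i ∈ Finset.range (g + 1), ∑ j ∈ Finset.range (g + 1), y ^ i * x ^ j * E (i + 1) j := by
    rw [Finset.sum_range_succ _ g]
    simp [hEg]
  have hx : x * ∑ i ∈ Finset.range (g + 1), ∑ j ∈ Finset.range (g + 1), y ^ i * x ^ j * E i (j + 1)
      = ∑ i ∈ Finset.range (g + 2), ∑ j ∈ Finset.range (g + 2), y ^ i * x ^ j * E i j := by
    rw [Finset.sum_range_succ _ (g + 1), Finset.mul_sum]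
    simp only [hEg, mul_zero, Finset.sum_const_zero, add_zero]
    refine Finset.sum_congr rfl fun i _ => ?_
    rw [Finset.sum_range_succ' _ (g + 1), h0E, mul_zero, add_zero, Finset.mul_sum]
    exact Finset.sum_congr rfl fun j _ => by ring
  have hy : y * ∑ i ∈ Finset.range (g + 1), ∑ j ∈ Finset.range (g + 1), y ^ i * x ^ j * E (i + 1) j
      = ∑ i ∈ Finset.range (g + 2), ∑ j ∈ Finset.range (g + 2), y ^ i * x ^ j * E i j := by
    rw [Finset.sum_range_succ' _ (g + 1), Finset.mul_sum]
    simp only [hE0, mul_zero, Finset.sum_const_zero, add_zero]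
    refine Finset.sum_congr rfl fun i _ => ?_
    rw [Finset.sum_range_succ _ (g + 1), hgE, mul_zero, add_zero, Finset.mul_sum]
    exact Finset.sum_congr rfl fun j _ => by ring
  have hc : 2 * ∑ i ∈ Finset.range (g + 1), ∑ j ∈ Finset.range (g + 1), y ^ i * x ^ j * E (i + 1) j
      = 2 * (∑ i ∈ Finset.range (g + 1), ∑ j ∈ Finset.range (g + 1), y ^ i * x ^ j * E i (j + 1))
      + ∑ i ∈ Finset.range (g + 1), ∑ j ∈ Finset.range (g + 1), y ^ i * x ^ j * c i j := by
    simp only [Finset.mul_sum, ← Finset.sum_add_distrib]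
    refine Finset.sum_congr rfl fun i _ => Finset.sum_congr rfl fun j _ => ?_
    linear_combination (y ^ i * x ^ j) * h i j
  rw [hS]
  linear_combination x * hc + 2 * hx - 2 * hy

section Mumford

variable {𝕜 : Type*} [Field 𝕜] [CharZero 𝕜] {g : ℕ}

open MvPolynomial

/-- Coefficient identities may be checked on generating functions at generic ξ, where differences
such as ξ - η can be cancelled. -/
theorem eq_zero_of_forall_sum_pow {σ : Type*} {N : ℕ} {a : ℕ → MvPolynomial σ 𝕜} (S : Finset 𝕜)
    (h : ∀ ξ ∉ S, ∑ n ∈ Finset.range N, C ξ ^ n * a n = 0) {n : ℕ} (hn : n < N) : a n = 0 := by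
  set p : Polynomial (MvPolynomial σ 𝕜) := ∑ n ∈ Finset.range N, Polynomial.monomial n (a n)
  have hp : p = 0 := by
    refine Polynomial.eq_zero_of_infinite_isRoot p ?_
    have hinf : Set.Infinite ((C : 𝕜 → MvPolynomial σ 𝕜) '' (↑S)ᶜ) :=
      (S.finite_toSet.infinite_compl).image (C_injective σ 𝕜).injOn
    refine hinf.mono ?_
    rintro _ ⟨ξ, hξ, rfl⟩
    rw [Set.mem_ofPred_eq, Polynomial.IsRoot, Polynomial.eval_finsetSum]
    rw [← h ξ (by simpa using hξ)]
    exact Finset.sum_congr rfl fun n _ => by rw [Polynomial.eval_monomial, mul_comm]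
  have := congrArg (fun q => Polynomial.coeff q n) hp
  simpa [p, Polynomial.finsetSum_coeff, Polynomial.coeff_monomial, hn] using this

variable (𝕜 g) in
/-- Polynomial functions of the coefficients of `W`, `W'`, `W''`. -/
abbrev PhaseAlg : Type _ := MvPolynomial (Fin 3 × Fin g) 𝕜

variable (𝕜 g) in
/-- The coefficients of `W`, `W'`, `W''`. -/
def phaseVar (a : Fin 3) (n : ℕ) : PhaseAlg 𝕜 g :=
  if n = 0 then (if a = 0 then 2 else 0) else if h : n - 1 < g then X (a, ⟨n - 1, h⟩) else 0

local notation "w₀" => phaseVar 𝕜 g 0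
local notation "w₁" => phaseVar 𝕜 g 1
local notation "w₂" => phaseVar 𝕜 g 2

theorem phaseVar_succ (a : Fin 3) (j : Fin g) : phaseVar 𝕜 g a ((j : ℕ) + 1) = X (a, j) := by
  simp [phaseVar]

theorem phaseVar_of_lt (a : Fin 3) {n : ℕ} (h : g < n) : phaseVar 𝕜 g a n = 0 := by
  rw [phaseVar, if_neg (by omega), dif_neg (by omega)]

theorem phaseVar_zero : w₀ 0 = 2 := by simp [phaseVar]

theorem phaseVar_one_zero : w₁ 0 = 0 := by simp [phaseVar]

theorem phaseVar_two_zero : w₂ 0 = 0 := by simp [phaseVar]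

variable (𝕜 g) in
/-- The coefficients of `W'''`. -/
def phaseThird (n : ℕ) : PhaseAlg 𝕜 g :=
  4 * w₁ (n + 1) - 4 * (w₀ 1 * w₁ n) - 2 * (w₁ 1 * w₀ n)

theorem phaseThird_zero : phaseThird 𝕜 g 0 = 0 := by
  rw [phaseThird, phaseVar_zero, phaseVar_one_zero]; ring

theorem phaseThird_of_lt {n : ℕ} (h : g < n) : phaseThird 𝕜 g n = 0 := by
  rw [phaseThird, phaseVar_of_lt 0 h, phaseVar_of_lt 1 h, phaseVar_of_lt 1 (by omega)]; ring

variable (𝕜 g) in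
/-- A derivation of the phase space given by its values on `W`, `W'`, `W''`. -/
def phaseDer (F : Fin 3 → ℕ → PhaseAlg 𝕜 g) : Derivation 𝕜 (PhaseAlg 𝕜 g) (PhaseAlg 𝕜 g) :=
  mkDerivation 𝕜 fun p => F p.1 (p.2 + 1)

theorem phaseDer_phaseVar (F : Fin 3 → ℕ → PhaseAlg 𝕜 g) (k : Fin 3)
    (h0 : F k 0 = 0) (hg : ∀ n, g < n → F k n = 0) (n : ℕ) :
    phaseDer 𝕜 g F (phaseVar 𝕜 g k n) = F k n := by
  rcases n with _ | n
  · rw [h0, phaseVar, if_pos rfl]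
    split_ifs <;> simp
  · by_cases hn : n < g
    · have := phaseVar_succ (𝕜 := 𝕜) k ⟨n, hn⟩
      simp only at this
      rw [this, phaseDer, mkDerivation_X]
    · rw [phaseVar_of_lt k (by omega), hg _ (by omega), map_zero]

variable (𝕜 g) in
/-- The vector field `∂ₓ`. -/
def phaseX : Derivation 𝕜 (PhaseAlg 𝕜 g) (PhaseAlg 𝕜 g) :=
  phaseDer 𝕜 g ![w₁, w₂, phaseThird 𝕜 g]

local notation "∂" => phaseX 𝕜 g

theorem phaseX_zero (n : ℕ) : ∂ (w₀ n) = w₁ n :=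
  phaseDer_phaseVar _ 0 phaseVar_one_zero (fun _ h => phaseVar_of_lt 1 h) n

theorem phaseX_one (n : ℕ) : ∂ (w₁ n) = w₂ n :=
  phaseDer_phaseVar _ 1 phaseVar_two_zero (fun _ h => phaseVar_of_lt 2 h) n

theorem phaseX_two (n : ℕ) : ∂ (w₂ n) = phaseThird 𝕜 g n :=
  phaseDer_phaseVar _ 2 phaseThird_zero (fun _ h => phaseThird_of_lt h) n

variable (𝕜 g) in
/-- The Wronskian of coefficients. -/
def phaseW (l m : ℕ) : PhaseAlg 𝕜 g := w₀ l * w₁ m - w₁ l * w₀ m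

variable (𝕜 g) in
/-- The derivative `∂ᵢ Wⱼ`. -/
def phaseE (i j : ℕ) : PhaseAlg 𝕜 g :=
  C (1 / 2) * ∑ l ∈ Finset.range i, phaseW 𝕜 g l (i + j - 1 - l)

local notation "ℰ" => phaseE 𝕜 g

theorem two_mul_phaseE (i j : ℕ) :
    2 * ℰ i j = ∑ l ∈ Finset.range i, phaseW 𝕜 g l (i + j - 1 - l) := by
  have : (2 : PhaseAlg 𝕜 g) * C (1 / 2) = 1 := by
    have h : (2 : PhaseAlg 𝕜 g) = C 2 := (map_ofNat C 2).symm
    rw [h, ← map_mul]; norm_num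
  rw [phaseE, ← mul_assoc, this, one_mul]

theorem two_phase_cancel {p q : PhaseAlg 𝕜 g} (h : 2 * p = 2 * q) : p = q :=
  mul_left_cancel₀ two_ne_zero h

theorem phaseE_zero_left (j : ℕ) : ℰ 0 j = 0 := by simp [phaseE]

theorem phaseE_step (i j : ℕ) : 2 * ℰ (i + 1) j = 2 * ℰ i (j + 1) + phaseW 𝕜 g i j := by
  rw [two_mul_phaseE, two_mul_phaseE, Finset.sum_range_succ]
  congr 1
  · exact Finset.sum_congr rfl fun l _ => by congr 1; omega
  · congr 1; omega

/-- The Wronskian is antisymmetric, so reversing the order of summation changes the sign. -/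
theorem phaseE_zero_right (i : ℕ) : ℰ i 0 = 0 := by
  refine two_phase_cancel ?_
  rw [mul_zero]
  refine two_phase_cancel ?_
  rw [mul_zero, two_mul_phaseE, two_mul]
  nth_rewrite 1 [← Finset.sum_range_reflect]
  rw [← Finset.sum_add_distrib]
  refine Finset.sum_eq_zero fun l hl => ?_
  rw [Finset.mem_range] at hl
  have e1 : i + 0 - 1 - (i - 1 - l) = l := by omega
  have e2 : i + 0 - 1 - l = i - 1 - l := by omega
  rw [e1, e2, phaseW, phaseW]
  ring

/-- Going from (i+1, j) to (i, j+1) adds the Wronskian of (i, j); going back in the transposed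
indices adds that of (j, i), which cancels it. -/
theorem phaseE_symm (i j : ℕ) : ℰ i j = ℰ j i := by
  induction i generalizing j with
  | zero => rw [phaseE_zero_left, phaseE_zero_right]
  | succ i ih =>
    refine two_phase_cancel ?_
    rw [phaseE_step, ih, phaseE_step, phaseW, phaseW]
    ring

theorem phaseE_one (j : ℕ) : ℰ 1 j = w₁ j := by
  refine two_phase_cancel ?_
  rw [phaseE_step, phaseE_zero_left, phaseW, phaseVar_zero, phaseVar_one_zero]; ring

theorem phaseE_of_lt_right (i : ℕ) {j : ℕ} (h : g < j) : ℰ i j = 0 := by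
  rw [phaseE, Finset.sum_eq_zero, mul_zero]
  intro l hl
  rw [Finset.mem_range] at hl
  rw [phaseW, phaseVar_of_lt 0 (show g < i + j - 1 - l by omega), phaseVar_of_lt 1 (by omega)]
  ring

theorem phaseE_of_lt_left {i : ℕ} (h : g < i) (j : ℕ) : ℰ i j = 0 := by
  rw [phaseE_symm, phaseE_of_lt_right j h]

variable (𝕜 g) in
/-- The vector fields `∂ᵢ`. -/
def phaseD (i : ℕ) : Derivation 𝕜 (PhaseAlg 𝕜 g) (PhaseAlg 𝕜 g) :=
  phaseDer 𝕜 g ![fun j => ℰ (i + 1) j, fun j => ∂ (ℰ (i + 1) j), fun j => ∂ (∂ (ℰ (i + 1) j))]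

theorem phaseD_zero (i n : ℕ) : phaseD 𝕜 g i (w₀ n) = ℰ (i + 1) n :=
  phaseDer_phaseVar _ 0 (phaseE_zero_right _) (fun _ h => phaseE_of_lt_right _ h) n

theorem phaseD_one (i n : ℕ) : phaseD 𝕜 g i (w₁ n) = ∂ (ℰ (i + 1) n) :=
  phaseDer_phaseVar _ 1 (by simp [phaseE_zero_right]) (fun _ h => by simp [phaseE_of_lt_right _ h]) n

theorem phaseD_two (i n : ℕ) : phaseD 𝕜 g i (w₂ n) = ∂ (∂ (ℰ (i + 1) n)) :=
  phaseDer_phaseVar _ 2 (by simp [phaseE_zero_right]) (fun _ h => by simp [phaseE_of_lt_right _ h]) n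

theorem phaseDer_ext {D D' : Derivation 𝕜 (PhaseAlg 𝕜 g) (PhaseAlg 𝕜 g)}
    (h : ∀ k n, D (phaseVar 𝕜 g k n) = D' (phaseVar 𝕜 g k n)) : D = D' := by
  refine derivation_ext fun p => ?_
  rw [← phaseVar_succ]
  exact h _ _

theorem phaseD_zero_eq : phaseD 𝕜 g 0 = ∂ := by
  refine phaseDer_ext fun k n => ?_
  fin_cases k
  · exact (phaseD_zero 0 n).trans (by rw [zero_add, phaseE_one, ← phaseX_zero]; rfl)
  · exact (phaseD_one 0 n).trans (by rw [zero_add, phaseE_one]; rfl)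
  · exact (phaseD_two 0 n).trans (by rw [zero_add, phaseE_one, phaseX_one]; rfl)

/-! #### Generating functions -/

variable (g) in
/-- The values of `W`, `W'`, `W''` at `ξ`. -/
def phaseGen (k : Fin 3) (ξ : 𝕜) : PhaseAlg 𝕜 g :=
  ∑ n ∈ Finset.range (g + 1), C ξ ^ n * phaseVar 𝕜 g k n

variable (g) in
/-- The value of `W'''` at `ξ`. -/
def phaseGenThird (ξ : 𝕜) : PhaseAlg 𝕜 g :=
  ∑ n ∈ Finset.range (g + 1), C ξ ^ n * phaseThird 𝕜 g n

variable (g) in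
/-- The generating vector field `∑ ηⁱ ∂ᵢ`. -/
def phaseDGen (η : 𝕜) : Derivation 𝕜 (PhaseAlg 𝕜 g) (PhaseAlg 𝕜 g) :=
  ∑ i ∈ Finset.range g, η ^ i • phaseD 𝕜 g i

theorem derivation_C_pow_mul (D : Derivation 𝕜 (PhaseAlg 𝕜 g) (PhaseAlg 𝕜 g)) (ξ : 𝕜) (n : ℕ)
    (p : PhaseAlg 𝕜 g) : D (C ξ ^ n * p) = C ξ ^ n * D p := by
  rw [← map_pow, ← smul_eq_C_mul, ← smul_eq_C_mul, D.map_smul]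

theorem phaseDGen_apply (η : 𝕜) (p : PhaseAlg 𝕜 g) :
    phaseDGen g η p = ∑ i ∈ Finset.range g, C η ^ i * phaseD 𝕜 g i p := by
  rw [phaseDGen, ← Derivation.coeFnAddMonoidHom_apply, map_sum, Finset.sum_apply]
  exact Finset.sum_congr rfl fun i _ => by
    rw [Derivation.coeFnAddMonoidHom_apply, Derivation.smul_apply, smul_eq_C_mul, map_pow]

theorem phaseX_gen_zero (ξ : 𝕜) : ∂ (phaseGen g 0 ξ) = phaseGen g 1 ξ := by
  simp only [phaseGen, map_sum, derivation_C_pow_mul, phaseX_zero]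

theorem phaseX_gen_one (ξ : 𝕜) : ∂ (phaseGen g 1 ξ) = phaseGen g 2 ξ := by
  simp only [phaseGen, map_sum, derivation_C_pow_mul, phaseX_one]

theorem phaseX_gen_two (ξ : 𝕜) : ∂ (phaseGen g 2 ξ) = phaseGenThird g ξ := by
  simp only [phaseGen, phaseGenThird, map_sum, derivation_C_pow_mul, phaseX_two]

theorem phaseGenThird_eq (ξ : 𝕜) : C ξ * phaseGenThird g ξ = 4 * phaseGen g 1 ξ
    - C ξ * (4 * (w₀ 1 * phaseGen g 1 ξ) + 2 * (w₁ 1 * phaseGen g 0 ξ)) := by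
  have h : phaseGen g 1 ξ = ∑ n ∈ Finset.range (g + 1), C ξ ^ (n + 1) * w₁ (n + 1) := by
    rw [phaseGen, Finset.sum_range_succ', Finset.sum_range_succ _ g, phaseVar_one_zero,
      phaseVar_of_lt 1 (Nat.lt_succ_self g)]
    simp
  nth_rewrite 1 [h]
  simp only [phaseGen, phaseGenThird, phaseThird, Finset.mul_sum, ← Finset.sum_add_distrib,
    ← Finset.sum_sub_distrib]
  exact Finset.sum_congr rfl fun n _ => by ring

/-- Closed form of the flows: the recursion `phaseE_step` telescopes, which produces the factor ξ -
η. -/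
theorem phaseDGen_gen (η ξ : 𝕜) : 2 * ((C ξ - C η) * phaseDGen g η (phaseGen g 0 ξ))
    = C ξ * (phaseGen g 0 η * phaseGen g 1 ξ - phaseGen g 1 η * phaseGen g 0 ξ) := by
  have h := two_mul_telescope (E := phaseE 𝕜 g) (c := phaseW 𝕜 g) (g := g) phaseE_zero_left
    phaseE_zero_right (phaseE_of_lt_left (Nat.lt_succ_self g))
    (fun i => phaseE_of_lt_right i (Nat.lt_succ_self g)) phaseE_step (C ξ) (C η)
  have e1 : phaseDGen g η (phaseGen g 0 ξ) = ∑ i ∈ Finset.range g, ∑ j ∈ Finset.range (g + 1),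
      C η ^ i * C ξ ^ j * ℰ (i + 1) j := by
    rw [phaseDGen_apply]
    refine Finset.sum_congr rfl fun i _ => ?_
    simp only [phaseGen, map_sum, derivation_C_pow_mul, phaseD_zero, Finset.mul_sum, mul_assoc]
  rw [e1, h]
  congr 1
  simp only [phaseGen, Finset.sum_mul_sum, ← Finset.sum_sub_distrib]
  exact Finset.sum_congr rfl fun i _ => Finset.sum_congr rfl fun j _ => by rw [phaseW]; ring

theorem phaseDGen_gen_one (η ξ : 𝕜) :
    phaseDGen g η (phaseGen g 1 ξ) = ∂ (phaseDGen g η (phaseGen g 0 ξ)) := by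
  simp only [phaseDGen_apply, phaseGen, map_sum, derivation_C_pow_mul, phaseD_zero, phaseD_one]

theorem phaseDGen_one_one (η : 𝕜) :
    phaseDGen g η (w₁ 1) = ∂ (phaseDGen g η (w₀ 1)) := by
  simp only [phaseDGen_apply, map_sum, derivation_C_pow_mul, phaseD_zero, phaseD_one]

theorem phaseDGen_zero_one (η : 𝕜) : C η * phaseDGen g η (w₀ 1) = phaseGen g 1 η := by
  rw [phaseDGen_apply, phaseGen, Finset.sum_range_succ', phaseVar_one_zero, mul_zero, add_zero,
    Finset.mul_sum]
  refine Finset.sum_congr rfl fun i _ => ?_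
  rw [phaseD_zero, phaseE_symm, phaseE_one]; ring

/-! #### Commutation -/

theorem C_sub_ne_zero {ξ η : 𝕜} (h : ξ ≠ η) : (C ξ - C η : PhaseAlg 𝕜 g) ≠ 0 := by
  rw [← map_sub, C_ne_zero]
  exact sub_ne_zero.mpr h

/-- W''' is not a coordinate but a function of W and W', so compatibility with ∂ₓ has to be proved
for it. After multiplication by 2(ξ - η)ξη both sides can be computed from the closed form of the
flow, differentiated up to three times, and the formulas for W'''(ξ) and W'''(η). -/
theorem phaseDGen_third {ξ η : 𝕜} (hξ : ξ ≠ 0) (hη : η ≠ 0) (h : ξ ≠ η) :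
    phaseDGen g η (phaseGenThird g ξ) = ∂ (∂ (∂ (phaseDGen g η (phaseGen g 0 ξ)))) := by
  have hx : (C ξ : PhaseAlg 𝕜 g) ≠ 0 := C_ne_zero.mpr hξ
  have hy : (C η : PhaseAlg 𝕜 g) ≠ 0 := C_ne_zero.mpr hη
  have hxy : (C ξ - C η : PhaseAlg 𝕜 g) ≠ 0 := C_sub_ne_zero h
  have A := congrArg (phaseDGen g η) (phaseGenThird_eq (g := g) ξ)
  have B0 := phaseDGen_gen (g := g) η ξ
  have V := phaseDGen_zero_one (g := g) η
  have V' := congrArg ∂ V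
  have Tx := phaseGenThird_eq (g := g) ξ
  have Ty := phaseGenThird_eq (g := g) η
  have Tx' := congrArg ∂ Tx
  have Ty' := congrArg ∂ Ty
  have B1 := congrArg ∂ B0
  have B2 := congrArg ∂ B1
  have B3 := congrArg ∂ B2
  simp only [map_add, map_sub, Derivation.leibniz, smul_eq_mul, derivation_ofNat, mul_zero,
    add_zero, phaseX_gen_zero, phaseX_gen_one, phaseX_gen_two, phaseDGen_gen_one, phaseDGen_one_one,
    derivation_C, phaseX_zero, phaseX_one, sub_self, smul_zero] at A V' Tx' Ty' B1 B2 B3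
  refine mul_left_cancel₀ two_ne_zero (mul_left_cancel₀ hxy (mul_left_cancel₀ hx
    (mul_left_cancel₀ hy ?_)))
  generalize phaseDGen g η (phaseGenThird g ξ) = DT at *
  generalize phaseDGen g η (phaseGen g 0 ξ) = f at *
  generalize phaseDGen g η (w₀ 1) = DV at *
  generalize (C ξ : PhaseAlg 𝕜 g) = x at *
  generalize (C η : PhaseAlg 𝕜 g) = y at *
  linear_combination 2 * (x - y) * y * A + 4 * y * B1 - 4 * x * w₀ 1 * y * B1
    - 2 * x * y * w₁ 1 * B0 - 8 * (x - y) * x * phaseGen g 1 ξ * V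
    - 4 * (x - y) * x * phaseGen g 0 ξ * V' - x * y * B3 - 2 * x * y * phaseGen g 1 η * Tx
    - x * y * phaseGen g 0 η * Tx' + x ^ 2 * phaseGen g 0 ξ * Ty' + 2 * x ^ 2 * phaseGen g 1 ξ * Ty

/-- Once the denominators x - y, x - z, y - z are cleared, each order of differentiation is
expressed by W and its derivatives at the three points, and the expressions agree. -/
theorem phaseX_phaseDGen_comm_gen (y z x : 𝕜) (hxy : x ≠ y) (hxz : x ≠ z) (hyz : y ≠ z) :
    phaseDGen g y (phaseDGen g z (phaseGen g 0 x)) =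
      phaseDGen g z (phaseDGen g y (phaseGen g 0 x)) := by
  have hxy' : (C x - C y : PhaseAlg 𝕜 g) ≠ 0 := C_sub_ne_zero hxy
  have hxz' : (C x - C z : PhaseAlg 𝕜 g) ≠ 0 := C_sub_ne_zero hxz
  have hyz' : (C y - C z : PhaseAlg 𝕜 g) ≠ 0 := C_sub_ne_zero hyz
  have Kz := phaseDGen_gen (g := g) z x
  have Ky := phaseDGen_gen (g := g) y x
  have L := phaseDGen_gen (g := g) y z
  have M := phaseDGen_gen (g := g) z y
  have Ky' := congrArg ∂ Ky
  have Kz' := congrArg ∂ Kz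
  have L' := congrArg ∂ L
  have M' := congrArg ∂ M
  have DKz := congrArg (phaseDGen g y) Kz
  have DKy := congrArg (phaseDGen g z) Ky
  simp only [map_add, map_sub, Derivation.leibniz, smul_eq_mul, derivation_ofNat, mul_zero,
    add_zero, phaseX_gen_zero, phaseX_gen_one, phaseDGen_gen_one,
    derivation_C, sub_self, smul_zero] at Ky' Kz' L' M' DKz DKy
  refine mul_left_cancel₀ (two_ne_zero) (mul_left_cancel₀ two_ne_zero
    (mul_left_cancel₀ two_ne_zero (mul_left_cancel₀ hxy' (mul_left_cancel₀ hxz'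
    (mul_left_cancel₀ hyz' ?_)))))
  generalize phaseDGen g y (phaseDGen g z (phaseGen g 0 x)) = P at *
  generalize phaseDGen g z (phaseDGen g y (phaseGen g 0 x)) = Q at *
  generalize phaseDGen g y (phaseGen g 0 x) = fy at *
  generalize phaseDGen g z (phaseGen g 0 x) = fz at *
  generalize phaseDGen g y (phaseGen g 0 z) = h at *
  generalize phaseDGen g z (phaseGen g 0 y) = k at *
  generalize (C x : PhaseAlg 𝕜 g) = a at *
  generalize (C y : PhaseAlg 𝕜 g) = b at *
  generalize (C z : PhaseAlg 𝕜 g) = c at *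
  linear_combination 4 * (a - b) * (b - c) * DKz - 4 * (a - c) * (b - c) * DKy
    - 2 * a * (a - b) * phaseGen g 1 x * L + 2 * a * (a - b) * phaseGen g 0 x * L'
    + 2 * a * (b - c) * phaseGen g 0 z * Ky' - 2 * a * (b - c) * phaseGen g 1 z * Ky
    - 2 * a * (a - c) * phaseGen g 1 x * M + 2 * a * (a - c) * phaseGen g 0 x * M'
    - 2 * a * (b - c) * phaseGen g 0 y * Kz' + 2 * a * (b - c) * phaseGen g 1 y * Kz

theorem phaseD_third {i : ℕ} (hi : i < g) {n : ℕ} (hn : n < g + 1) :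
    phaseD 𝕜 g i (phaseThird 𝕜 g n) = ∂ (∂ (∂ (ℰ (i + 1) n))) := by
  classical
  refine sub_eq_zero.mp ?_
  refine eq_zero_of_forall_sum_pow (N := g)
    (a := fun i => phaseD 𝕜 g i (phaseThird 𝕜 g n) - ∂ (∂ (∂ (ℰ (i + 1) n)))) {0} ?_ hi
  intro η hη
  rw [Finset.mem_singleton] at hη
  refine eq_zero_of_forall_sum_pow (N := g + 1) (a := fun n => ∑ i ∈ Finset.range g, C η ^ i *
    (phaseD 𝕜 g i (phaseThird 𝕜 g n) - ∂ (∂ (∂ (ℰ (i + 1) n))))) {0, η} ?_ hn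
  intro ξ hξ
  simp only [Finset.mem_insert, Finset.mem_singleton, not_or] at hξ
  have h := phaseDGen_third (g := g) hξ.1 hη hξ.2
  simp only [phaseDGen_apply, phaseGen, phaseGenThird, map_sum, derivation_C_pow_mul,
    phaseD_zero] at h
  rw [← sub_eq_zero, ← Finset.sum_sub_distrib] at h
  rw [← h]
  simp only [Finset.mul_sum, ← Finset.sum_sub_distrib]
  exact Finset.sum_congr rfl fun n _ => Finset.sum_congr rfl fun i _ => by ring

/-- On W and W' this is how the fields were defined; only W'' needs an argument, namely
`phaseD_third`. For i ≥ g the field is zero. -/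
theorem phaseX_phaseD_comm (i : ℕ) (p : PhaseAlg 𝕜 g) : ∂ (phaseD 𝕜 g i p) = phaseD 𝕜 g i (∂ p) := by
  by_cases hi : i < g
  · have h : ⁅∂, phaseD 𝕜 g i⁆ = 0 := by
      refine phaseDer_ext fun k n => ?_
      rw [Derivation.commutator_apply, Derivation.zero_apply, sub_eq_zero]
      fin_cases k
      · exact (congrArg ∂ (phaseD_zero i n)).trans
          ((phaseD_one i n).symm.trans (congrArg (phaseD 𝕜 g i) (phaseX_zero n).symm))
      · exact (congrArg ∂ (phaseD_one i n)).trans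
          ((phaseD_two i n).symm.trans (congrArg (phaseD 𝕜 g i) (phaseX_one n).symm))
      · refine (congrArg ∂ (phaseD_two i n)).trans
          (Eq.trans ?_ (congrArg (phaseD 𝕜 g i) (phaseX_two n).symm))
        by_cases hn : n < g + 1
        · exact (phaseD_third hi hn).symm
        · rw [phaseE_of_lt_right _ (by omega), phaseThird_of_lt (by omega)]
          simp
    have := congrArg (fun D => D p) h
    simp only [Derivation.commutator_apply, Derivation.zero_apply] at this
    exact sub_eq_zero.mp this
  · have h : phaseD 𝕜 g i = 0 := by
      refine phaseDer_ext fun k n => ?_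
      have hE : ∀ n, ℰ (i + 1) n = 0 := phaseE_of_lt_left (by omega)
      fin_cases k
      · exact (phaseD_zero i n).trans (by simp [hE])
      · exact (phaseD_one i n).trans (by simp [hE])
      · exact (phaseD_two i n).trans (by simp [hE])
    simp [h]

theorem phaseD_comm_zero {i k n : ℕ} (hi : i < g) (hk : k < g) (hn : n < g + 1) :
    phaseD 𝕜 g i (phaseD 𝕜 g k (w₀ n)) = phaseD 𝕜 g k (phaseD 𝕜 g i (w₀ n)) := by
  classical
  refine sub_eq_zero.mp ?_
  refine eq_zero_of_forall_sum_pow (N := g) (a := fun i => phaseD 𝕜 g i (phaseD 𝕜 g k (w₀ n))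
    - phaseD 𝕜 g k (phaseD 𝕜 g i (w₀ n))) ∅ ?_ hi
  intro y _
  refine eq_zero_of_forall_sum_pow (N := g) (a := fun k => ∑ i ∈ Finset.range g, C y ^ i *
    (phaseD 𝕜 g i (phaseD 𝕜 g k (w₀ n)) - phaseD 𝕜 g k (phaseD 𝕜 g i (w₀ n)))) {y} ?_ hk
  intro z hz
  rw [Finset.mem_singleton] at hz
  refine eq_zero_of_forall_sum_pow (N := g + 1) (a := fun n => ∑ k ∈ Finset.range g, C z ^ k *
    ∑ i ∈ Finset.range g, C y ^ i *
    (phaseD 𝕜 g i (phaseD 𝕜 g k (w₀ n)) - phaseD 𝕜 g k (phaseD 𝕜 g i (w₀ n)))) {y, z} ?_ hn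
  intro x hx
  simp only [Finset.mem_insert, Finset.mem_singleton, not_or] at hx
  have h := phaseX_phaseDGen_comm_gen (g := g) y z x hx.1 hx.2 (Ne.symm hz)
  simp only [phaseDGen_apply, phaseGen, map_sum, derivation_C_pow_mul, Finset.mul_sum] at h
  conv_rhs at h => enter [2, n]; rw [Finset.sum_comm]
  rw [← sub_eq_zero] at h
  rw [← h]
  simp only [Finset.mul_sum, ← Finset.sum_sub_distrib]
  exact Finset.sum_congr rfl fun n _ => Finset.sum_congr rfl fun k _ =>
    Finset.sum_congr rfl fun i _ => by ring

/-- Commutation on W comes from the generating functions; it passes to W' and W'' because both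
fields commute with ∂ₓ. -/
theorem phaseD_comm {i k : ℕ} (hi : i < g) (hk : k < g) (p : PhaseAlg 𝕜 g) :
    phaseD 𝕜 g i (phaseD 𝕜 g k p) = phaseD 𝕜 g k (phaseD 𝕜 g i p) := by
  have h0 : ∀ n, phaseD 𝕜 g i (phaseD 𝕜 g k (w₀ n)) = phaseD 𝕜 g k (phaseD 𝕜 g i (w₀ n)) := by
    intro n
    by_cases hn : n < g + 1
    · exact phaseD_comm_zero hi hk hn
    · simp [phaseVar_of_lt 0 (show g < n by omega)]
  have h1 : ∀ n, phaseD 𝕜 g i (phaseD 𝕜 g k (w₁ n)) = phaseD 𝕜 g k (phaseD 𝕜 g i (w₁ n)) := by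
    intro n
    rw [← phaseX_zero]
    simp only [← phaseX_phaseD_comm, h0]
  have h2 : ∀ n, phaseD 𝕜 g i (phaseD 𝕜 g k (w₂ n)) = phaseD 𝕜 g k (phaseD 𝕜 g i (w₂ n)) := by
    intro n
    rw [← phaseX_one]
    simp only [← phaseX_phaseD_comm, h1]
  have h : ⁅phaseD 𝕜 g i, phaseD 𝕜 g k⁆ = 0 := by
    refine phaseDer_ext fun l n => ?_
    rw [Derivation.commutator_apply, Derivation.zero_apply, sub_eq_zero]
    fin_cases l
    · exact h0 n
    · exact h1 n
    · exact h2 n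
  have := congrArg (fun D => D p) h
  simp only [Derivation.commutator_apply, Derivation.zero_apply] at this
  exact sub_eq_zero.mp this

/-- The compatibility and symmetry conditions are the symmetry of ℰ, the linear equation is the
definition of W''', and the recursion `phaseE_step` is the vanishing of the defect. -/
theorem isKdVSystem_phase [NeZero g] :
    IsKdVSystem (fun i : Fin g => phaseD 𝕜 g i) (fun j : Fin g => -w₀ ((j : ℕ) + 1)) := by
  have hnext : ∀ (i : Fin g) (n : ℕ),
      nextDer (fun i : Fin g => phaseD 𝕜 g i) i (w₀ n) = ℰ (i + 2) n := by
    intro i n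
    rw [nextDer]
    split_ifs with hi
    · exact phaseD_zero _ _
    · rw [phaseE_of_lt_left (by omega)]; simp
  refine ⟨⟨fun i => ?_, fun i => ?_⟩, fun i j => ?_, fun i j => ?_⟩
  · simp only [map_neg, phaseD_zero, Fin.val_zero, zero_add]
    rw [phaseE_symm]
  · simp only [Fin.val_zero, phaseD_zero_eq, map_neg, phaseX_zero, phaseX_one, phaseX_two, zero_add,
      hnext]
    rw [phaseE_symm, phaseE_one, phaseThird]
    ring
  · simp only [map_neg, phaseD_zero]
    rw [phaseE_symm]
  · simp only [flowDefect, Fin.val_zero, phaseD_zero_eq, map_neg, hnext, phaseX_zero]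
    have e := phaseE_step (𝕜 := 𝕜) (g := g) (i + 1) (j + 1)
    rw [phaseE_symm (i + 1), phaseW] at e
    linear_combination -e

/-- A polynomial solution of the linear equation is a curve in the phase space. -/
theorem exists_phase_hom {R : Type*} [CommRing R] [Algebra 𝕜 R] (δ : Derivation 𝕜 R R) {u : R}
    {W : PowerSeries R} (h0 : PowerSeries.constantCoeff W = 2) (h1 : PowerSeries.coeff 1 W = -u)
    (hg : ∀ k, g < k → PowerSeries.coeff k W = 0) (hL : IsLenard δ u W) :
    ∃ φ : PhaseAlg 𝕜 g →ₐ[𝕜] R, (∀ n, φ (w₀ n) = PowerSeries.coeff n W) ∧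
      ∀ p, φ (∂ p) = δ (φ p) := by
  have h0' : PowerSeries.coeff 0 W = 2 := by
    rw [PowerSeries.coeff_zero_eq_constantCoeff_apply, h0]
  have hφ : ∃ φ : PhaseAlg 𝕜 g →ₐ[𝕜] R, ∀ k n, φ (phaseVar 𝕜 g k n)
      = δ^[(k : ℕ)] (PowerSeries.coeff n W) := by
    refine ⟨aeval fun p => δ^[(p.1 : ℕ)] (PowerSeries.coeff (p.2 + 1) W), fun k n => ?_⟩
    rcases n with _ | n
    · rw [phaseVar, if_pos rfl, h0']
      fin_cases k
      · simp
      · simp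
      · simp
    · by_cases hn : n < g
      · have := phaseVar_succ (𝕜 := 𝕜) k ⟨n, hn⟩
        simp only at this
        rw [this, aeval_X]
      · rw [phaseVar_of_lt k (by omega), hg _ (by omega), map_zero]
        fin_cases k <;> simp
  obtain ⟨φ, hφ⟩ := hφ
  have e0 : ∀ n, φ (w₀ n) = PowerSeries.coeff n W := hφ 0
  have e1 : ∀ n, φ (w₁ n) = δ (PowerSeries.coeff n W) := hφ 1
  have e2 : ∀ n, φ (w₂ n) = δ (δ (PowerSeries.coeff n W)) := hφ 2
  -- The linear equation for W enters here: it makes φ carry the prescribed W''' to the true third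
  -- derivative.
  have e3 : ∀ n, φ (phaseThird 𝕜 g n) = δ (δ (δ (PowerSeries.coeff n W))) := by
    intro n
    have := (isLenard_iff_coeff h0).mp hL n
    simp only [phaseThird, map_sub, map_mul, map_ofNat, e0, e1, h1, map_neg]
    linear_combination -this
  refine ⟨φ, e0, fun p => ?_⟩
  induction p using MvPolynomial.induction_on with
  | C a =>
    rw [derivation_C, map_zero, ← algebraMap_eq, AlgHom.commutes, Derivation.map_algebraMap]
  | add p q hp hq => simp only [map_add, hp, hq]
  | mul_X p x hp =>
    simp only [Derivation.leibniz, map_mul, map_add, smul_eq_mul, hp]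
    congr 2
    obtain ⟨k, j⟩ := x
    rw [← phaseVar_succ]
    fin_cases k
    · exact (congrArg φ (phaseX_zero _)).trans ((e1 _).trans (congrArg δ (e0 _).symm))
    · exact (congrArg φ (phaseX_one _)).trans ((e2 _).trans (congrArg δ (e1 _).symm))
    · exact (congrArg φ (phaseX_two _)).trans ((e3 _).trans (congrArg δ (e2 _).symm))

theorem IsKdVSystem.map [NeZero g] {R S : Type*} [CommRing R] [Algebra 𝕜 R] [CommRing S] [Algebra 𝕜 S]
    {d : Fin g → Derivation 𝕜 R R} {u : Fin g → R} (h : IsKdVSystem d u)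
    {e : Fin g → Derivation 𝕜 S S} (φ : R →ₐ[𝕜] S) (hφ : ∀ i f, φ (d i f) = e i (φ f)) :
    IsKdVSystem e fun i => φ (u i) := by
  have hn : ∀ i f, φ (nextDer d i f) = nextDer e i (φ f) := by
    intro i f
    rw [nextDer, nextDer]
    split_ifs
    · exact hφ _ f
    · simp
  refine ⟨⟨fun i => ?_, fun i => ?_⟩, fun i j => ?_, fun i j => ?_⟩
  · simpa only [hφ] using congrArg φ (h.first i)
  · simpa only [hφ, map_sub, map_mul, map_ofNat, hn] using congrArg φ (h.next i)
  · simpa only [hφ] using congrArg φ (h.symm i j)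
  · simpa only [flowDefect, hφ, map_sub, map_add, map_mul, map_ofNat, hn, map_zero]
      using congrArg φ (h.flow i j)

end Mumford

end

noncomputable section

/-! ### The algebra of smooth functions on an open set -/

section SmoothAlgebra

open TopologicalSpace

variable {𝕜 : Type*} [RCLike 𝕜] {E E' : Type*} [NormedAddCommGroup E] [NormedSpace 𝕜 E]
  [NormedAddCommGroup E'] [NormedSpace 𝕜 E']

/-- Extension by zero. -/
def zeroExt (D : Opens E) (f : D → 𝕜) : E → 𝕜 := Function.extend Subtype.val f 0

theorem zeroExt_apply {D : Opens E} (f : D → 𝕜) (t : D) : zeroExt D f t = f t :=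
  Subtype.val_injective.extend_apply f 0 t

theorem zeroExt_eqOn {D : Opens E} {f : D → 𝕜} {F : E → 𝕜} (h : ∀ t : D, f t = F t) :
    Set.EqOn (zeroExt D f) F D := fun t ht => by
  rw [← h ⟨t, ht⟩, ← zeroExt_apply f ⟨t, ht⟩]

theorem contDiffOn_zeroExt {D : Opens E} {f : D → 𝕜} {F : E → 𝕜} (hF : ContDiffOn 𝕜 ∞ F D)
    (h : ∀ t : D, f t = F t) : ContDiffOn 𝕜 ∞ (zeroExt D f) D :=
  hF.congr (zeroExt_eqOn h)

/-- The smooth functions on an open set. -/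
def smoothAlg (𝕜 : Type*) [RCLike 𝕜] {E : Type*} [NormedAddCommGroup E] [NormedSpace 𝕜 E]
    (D : Opens E) : Subalgebra 𝕜 (D → 𝕜) where
  carrier := {f | ContDiffOn 𝕜 ∞ (zeroExt D f) D}
  mul_mem' {f g} hf hg := contDiffOn_zeroExt (hf.mul hg) fun t => by
    simp [zeroExt_apply]
  add_mem' {f g} hf hg := contDiffOn_zeroExt (hf.add hg) fun t => by
    simp [zeroExt_apply]
  algebraMap_mem' c := contDiffOn_zeroExt (F := fun _ => c) contDiffOn_const fun _ => rfl

variable {D : Opens E}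

/-- The restriction to `D` of a function that is smooth on `D`. -/
def toSmooth {F : E → 𝕜} (hF : ContDiffOn 𝕜 ∞ F D) : smoothAlg 𝕜 D :=
  ⟨fun t => F t, contDiffOn_zeroExt hF fun _ => rfl⟩

@[simp] theorem toSmooth_apply {F : E → 𝕜} (hF : ContDiffOn 𝕜 ∞ F D) (t : D) :
    (toSmooth hF).1 t = F t := rfl

theorem smoothAlg_ext {f f' : smoothAlg 𝕜 D} (h : ∀ t, f.1 t = f'.1 t) : f = f' :=
  Subtype.ext (funext h)

theorem smoothAlg_contDiffOn (f : smoothAlg 𝕜 D) : ContDiffOn 𝕜 ∞ (zeroExt D f.1) D := f.2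

theorem smoothAlg_differentiableAt (f : smoothAlg 𝕜 D) (t : D) :
    DifferentiableAt 𝕜 (zeroExt D f.1) t :=
  ((smoothAlg_contDiffOn f).contDiffAt (D.isOpen.mem_nhds t.2)).differentiableAt (by simp)

theorem contDiffOn_fderiv_apply {F : E → 𝕜} {s : Set E} (hs : IsOpen s)
    (hF : ContDiffOn 𝕜 ∞ F s) (v : E) : ContDiffOn 𝕜 ∞ (fun t => fderiv 𝕜 F t v) s :=
  (hF.fderiv_of_isOpen hs (by simp)).clm_apply contDiffOn_const

theorem fderiv_eq_of_eqOn {F G : E → 𝕜} {s : Set E} (hs : IsOpen s) (h : Set.EqOn F G s) {t : E}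
    (ht : t ∈ s) : fderiv 𝕜 F t = fderiv 𝕜 G t :=
  (h.eventuallyEq_of_mem (hs.mem_nhds ht)).fderiv_eq

/-- The directional derivative. -/
def dirD (𝕜 : Type*) [RCLike 𝕜] {E : Type*} [NormedAddCommGroup E] [NormedSpace 𝕜 E]
    (D : Opens E) (v : E) : Derivation 𝕜 (smoothAlg 𝕜 D) (smoothAlg 𝕜 D) where
  toFun f := toSmooth (contDiffOn_fderiv_apply D.isOpen (smoothAlg_contDiffOn f) v)
  map_add' f f' := smoothAlg_ext fun t => by
    have h : Set.EqOn (zeroExt D (f + f').1) (zeroExt D f.1 + zeroExt D f'.1) D :=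
      zeroExt_eqOn fun t => by simp [zeroExt_apply]
    simp only [toSmooth_apply]
    rw [fderiv_eq_of_eqOn D.isOpen h t.2, fderiv_add (smoothAlg_differentiableAt f t) (smoothAlg_differentiableAt f' t)]
    rfl
  map_smul' c f := smoothAlg_ext fun t => by
    have h : Set.EqOn (zeroExt D (c • f).1) (c • zeroExt D f.1) D :=
      zeroExt_eqOn fun t => by simp [zeroExt_apply]
    simp only [toSmooth_apply]
    rw [fderiv_eq_of_eqOn D.isOpen h t.2, fderiv_const_smul (smoothAlg_differentiableAt f t)]
    rfl
  map_one_eq_zero' := smoothAlg_ext fun t => by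
    have h : Set.EqOn (zeroExt D (1 : smoothAlg 𝕜 D).1) (fun _ => 1) D :=
      zeroExt_eqOn fun t => rfl
    simp only [LinearMap.coe_mk, AddHom.coe_mk, toSmooth_apply]
    rw [fderiv_eq_of_eqOn D.isOpen h t.2]
    simp
  leibniz' f f' := smoothAlg_ext fun t => by
    have h : Set.EqOn (zeroExt D (f * f').1) (zeroExt D f.1 * zeroExt D f'.1) D :=
      zeroExt_eqOn fun t => by simp [zeroExt_apply]
    simp only [LinearMap.coe_mk, AddHom.coe_mk, toSmooth_apply]
    rw [fderiv_eq_of_eqOn D.isOpen h t.2, fderiv_mul (smoothAlg_differentiableAt f t) (smoothAlg_differentiableAt f' t)]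
    simp [zeroExt_apply]

theorem dirD_apply (v : E) {f : smoothAlg 𝕜 D} {F : E → 𝕜} (h : ∀ t : D, f.1 t = F t) (t : D) :
    (dirD 𝕜 D v f).1 t = fderiv 𝕜 F t v := by
  have : (dirD 𝕜 D v f).1 t = fderiv 𝕜 (zeroExt D f.1) t v := rfl
  rw [this, fderiv_eq_of_eqOn D.isOpen (zeroExt_eqOn h) t.2]

theorem dirD_comm (v w : E) (f : smoothAlg 𝕜 D) : dirD 𝕜 D v (dirD 𝕜 D w f) = dirD 𝕜 D w (dirD 𝕜 D v f) := by
  refine smoothAlg_ext fun t => ?_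
  have key : ∀ v w : E, (dirD 𝕜 D v (dirD 𝕜 D w f)).1 t
      = fderiv 𝕜 (fderiv 𝕜 (zeroExt D f.1)) t v w := by
    intro v w
    rw [dirD_apply v (F := fun t => fderiv 𝕜 (zeroExt D f.1) t w) fun _ => rfl]
    have hd : DifferentiableAt 𝕜 (fderiv 𝕜 (zeroExt D f.1)) t :=
      (((smoothAlg_contDiffOn f).fderiv_of_isOpen D.isOpen (m := ∞) (by simp)).contDiffAt
        (D.isOpen.mem_nhds t.2)).differentiableAt (by simp)
    rw [fderiv_clm_apply hd (differentiableAt_const w)]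
    simp
  rw [key, key]
  have hs : IsSymmSndFDerivAt 𝕜 (zeroExt D f.1) t :=
    ((smoothAlg_contDiffOn f).contDiffAt (D.isOpen.mem_nhds t.2)).isSymmSndFDerivAt (by
      rw [minSmoothness_of_isRCLikeNormedField]; exact WithTop.coe_le_coe.mpr le_top)
  exact hs v w

theorem exists_eq_algebraMap_of_dirD_eq_zero (hD : IsPreconnected (D : Set E))
    {f : smoothAlg 𝕜 D} (h : ∀ t : D, fderiv 𝕜 (zeroExt D f.1) t = 0) :
    ∃ k : 𝕜, f = algebraMap 𝕜 _ k := by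
  let _ : NormedSpace ℝ E := .restrictScalars ℝ 𝕜 E
  obtain ⟨a, ha⟩ := D.isOpen.exists_is_const_of_fderiv_eq_zero hD
    (fun t ht => (smoothAlg_differentiableAt f ⟨t, ht⟩).differentiableWithinAt) (fun t ht => h ⟨t, ht⟩)
  refine ⟨a, smoothAlg_ext fun t => ?_⟩
  rw [← zeroExt_apply f.1 t, ha t t.2]
  rfl

/-- Composition with a continuous linear map. -/
def smoothPull {D' : Opens E'} (L : E' →L[𝕜] E) (hL : ∀ x ∈ D', L x ∈ D) :
    smoothAlg 𝕜 D →ₐ[𝕜] smoothAlg 𝕜 D' where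
  toFun f := toSmooth (F := fun x => zeroExt D f.1 (L x))
    ((smoothAlg_contDiffOn f).comp L.contDiff.contDiffOn hL)
  map_one' := smoothAlg_ext fun x => zeroExt_apply _ (⟨L x, hL x x.2⟩ : D)
  map_zero' := smoothAlg_ext fun x => zeroExt_apply _ (⟨L x, hL x x.2⟩ : D)
  map_mul' f f' := smoothAlg_ext fun x => by
    have := fun f : D → 𝕜 => zeroExt_apply f (⟨L x, hL x x.2⟩ : D)
    simp only at this
    simp [this]
  map_add' f f' := smoothAlg_ext fun x => by
    have := fun f : D → 𝕜 => zeroExt_apply f (⟨L x, hL x x.2⟩ : D)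
    simp only at this
    simp [this]
  commutes' c := smoothAlg_ext fun x => zeroExt_apply _ (⟨L x, hL x x.2⟩ : D)

theorem smoothPull_apply {D' : Opens E'} (L : E' →L[𝕜] E) (hL : ∀ x ∈ D', L x ∈ D)
    (f : smoothAlg 𝕜 D) (x : D') : (smoothPull L hL f).1 x = f.1 ⟨L x, hL x x.2⟩ :=
  zeroExt_apply f.1 (⟨L x, hL x x.2⟩ : D)

theorem dirD_smoothPull {D' : Opens E'} (L : E' →L[𝕜] E) (hL : ∀ x ∈ D', L x ∈ D) (v : E')
    (f : smoothAlg 𝕜 D) : dirD 𝕜 D' v (smoothPull L hL f) = smoothPull L hL (dirD 𝕜 D (L v) f) := by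
  refine smoothAlg_ext fun x => ?_
  rw [smoothPull_apply, dirD_apply v (F := fun x => zeroExt D f.1 (L x)) fun _ => rfl,
    dirD_apply (L v) fun t => (zeroExt_apply f.1 t).symm]
  have : HasFDerivAt (zeroExt D f.1 ∘ L) _ (x : E') :=
    (smoothAlg_differentiableAt f ⟨L x, hL x x.2⟩).hasFDerivAt.comp (x : E') L.hasFDerivAt
  rw [show (fun x => zeroExt D f.1 (L x)) = zeroExt D f.1 ∘ L from rfl, this.fderiv]
  rfl

end SmoothAlgebra

end

noncomputable section

/-! ### Majorants of polynomials under derivations -/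

section Majorant

variable {𝕜 : Type*} [RCLike 𝕜] {σ : Type*}

open MvPolynomial

/-- `p` is a sum of monomials of degree at most `d` whose absolute values at `(r, …, r)` sum up to
at most `c`. -/
inductive Majorized (r : ℝ) (d : ℕ) : MvPolynomial σ 𝕜 → ℝ → Prop
  | monomial {s : σ →₀ ℕ} {a : 𝕜} {c : ℝ} : s.degree ≤ d → ‖a‖ * r ^ s.degree ≤ c →
      Majorized r d (monomial s a) c
  | add {p q : MvPolynomial σ 𝕜} {c c' : ℝ} : Majorized r d p c → Majorized r d q c' →
      Majorized r d (p + q) (c + c')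

theorem Majorized.zero {r : ℝ} {d : ℕ} {c : ℝ} (hc : 0 ≤ c) :
    Majorized r d (0 : MvPolynomial σ 𝕜) c := by
  rw [← monomial_zero (s := 0)]
  exact .monomial (by simp) (by simpa)

theorem Majorized.nonneg {r : ℝ} (hr : 1 ≤ r) {d : ℕ} {p : MvPolynomial σ 𝕜} {c : ℝ}
    (h : Majorized r d p c) : 0 ≤ c := by
  induction h with
  | monomial _ h => exact le_trans (by positivity) h
  | add _ _ h h' => exact add_nonneg h h'

theorem Majorized.mono_degree {r : ℝ} {d d' : ℕ} (hd : d ≤ d') {p : MvPolynomial σ 𝕜} {c : ℝ}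
    (h : Majorized r d p c) : Majorized r d' p c := by
  induction h with
  | monomial h h' => exact .monomial (h.trans hd) h'
  | add _ _ h h' => exact .add h h'

theorem Majorized.mono {r : ℝ} {d : ℕ} {p : MvPolynomial σ 𝕜} {c c' : ℝ}
    (h : Majorized r d p c) (hc : c ≤ c') : Majorized r d p c' := by
  have := h.add (.zero (sub_nonneg.mpr hc))
  rwa [add_zero, add_sub_cancel] at this

theorem Majorized.sum {r : ℝ} {d : ℕ} {ι : Type*} (s : Finset ι) {p : ι → MvPolynomial σ 𝕜}
    {c : ι → ℝ} (h : ∀ i ∈ s, Majorized r d (p i) (c i)) :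
    Majorized r d (∑ i ∈ s, p i) (∑ i ∈ s, c i) := by
  classical
  induction s using Finset.induction_on with
  | empty => exact .zero le_rfl
  | insert i s hi ih =>
    rw [Finset.sum_insert hi, Finset.sum_insert hi]
    exact (h i (by simp)).add (ih fun j hj => h j (by simp [hj]))

theorem Majorized.monomial_mul {r : ℝ} (hr : 1 ≤ r) {d : ℕ} {p : MvPolynomial σ 𝕜} {c : ℝ}
    (h : Majorized r d p c) (s : σ →₀ ℕ) (a : 𝕜) :
    Majorized r (s.degree + d) (MvPolynomial.monomial s a * p) (‖a‖ * r ^ s.degree * c) := by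
  induction h with
  | @monomial s' a' c h h' =>
    rw [MvPolynomial.monomial_mul]
    refine .monomial (by rw [map_add]; omega) ?_
    rw [norm_mul, map_add, pow_add]
    calc ‖a‖ * ‖a'‖ * (r ^ s.degree * r ^ s'.degree)
        = ‖a‖ * r ^ s.degree * (‖a'‖ * r ^ s'.degree) := by ring
      _ ≤ ‖a‖ * r ^ s.degree * c := mul_le_mul_of_nonneg_left h' (by positivity)
  | add _ _ h h' =>
    rw [mul_add, mul_add]
    exact h.add h'

theorem exists_majorized (r : ℝ) (p : MvPolynomial σ 𝕜) : ∃ d c, Majorized r d p c := by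
  induction p using MvPolynomial.induction_on' with
  | monomial s a => exact ⟨_, _, .monomial le_rfl le_rfl⟩
  | add p q hp hq =>
    obtain ⟨d, c, h⟩ := hp
    obtain ⟨d', c', h'⟩ := hq
    exact ⟨_, _, (h.mono_degree (le_max_left d d')).add (h'.mono_degree (le_max_right d d'))⟩

theorem Majorized.norm_le {r : ℝ} {d : ℕ} {p : MvPolynomial σ 𝕜} {c : ℝ}
    (h : Majorized r d p c) {ε : MvPolynomial σ 𝕜 →ₐ[𝕜] 𝕜} (hε : ∀ k, ‖ε (X k)‖ ≤ r) :
    ‖ε p‖ ≤ c := by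
  induction h with
  | @monomial s a c h h' =>
    refine le_trans ?_ h'
    have : ε (MvPolynomial.monomial s a) = a * s.prod fun k m => ε (X k) ^ m := by
      conv_lhs => rw [aeval_unique ε]
      rw [aeval_monomial]
      rfl
    rw [this, norm_mul, Finsupp.prod, norm_prod, Finsupp.degree_apply, ← Finset.prod_pow_eq_pow_sum]
    refine mul_le_mul_of_nonneg_left (Finset.prod_le_prod (fun _ _ => norm_nonneg _) ?_)
      (norm_nonneg _)
    intro k _
    rw [norm_pow]
    exact pow_le_pow_left₀ (norm_nonneg _) (hε k) _
  | add _ _ h h' =>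
    rw [map_add]
    exact (norm_add_le _ _).trans (add_le_add h h')

/-- In a monomial of degree at most d a derivation replaces one of at most d factors by a polynomial
of degree at most e + 1 and size M. So the degree grows by e and the bound by the factor dM; r ≥ 1
absorbs the lost power of r. -/
theorem Majorized.derivation {r : ℝ} (hr : 1 ≤ r) {d e : ℕ} {M : ℝ} (hM : 0 ≤ M)
    {p : MvPolynomial σ 𝕜} {c : ℝ} (h : Majorized r d p c)
    {D : Derivation 𝕜 (MvPolynomial σ 𝕜) (MvPolynomial σ 𝕜)}
    (hD : ∀ k, Majorized r (e + 1) (D (X k)) M) : Majorized r (d + e) (D p) (d * M * c) := by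
  induction h with
  | @monomial s a c h h' =>
    have hc : 0 ≤ c := le_trans (by positivity) h'
    have hDe : D = mkDerivation 𝕜 fun i => D (X i) :=
      derivation_ext fun i => (mkDerivation_X 𝕜 (fun i => D (X i)) i).symm
    have key : D (MvPolynomial.monomial s a) = ∑ i ∈ s.support,
        MvPolynomial.monomial (s - Finsupp.single i 1) (a * (s i : 𝕜)) * D (X i) := by
      conv_lhs => rw [hDe]
      rw [mkDerivation_monomial, Finsupp.sum, Finset.smul_sum]
      refine Finset.sum_congr rfl fun i _ => ?_
      rw [smul_eq_mul, ← smul_mul_assoc, smul_monomial, smul_eq_mul]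
    have hle : ∑ i ∈ s.support, (s i : ℝ) * (M * c) ≤ d * M * c := by
      rw [← Finset.sum_mul, mul_assoc]
      refine mul_le_mul_of_nonneg_right ?_ (by positivity)
      have := h
      rw [Finsupp.degree_apply] at this
      exact_mod_cast this
    rw [key]
    refine (Majorized.sum _ fun i hi => ?_).mono hle
    have hi0 : 1 ≤ s i := Nat.one_le_iff_ne_zero.mpr (Finsupp.mem_support_iff.mp hi)
    have hs : s - Finsupp.single i 1 + Finsupp.single i 1 = s :=
      tsub_add_cancel_of_le (Finsupp.single_le_iff.mpr hi0)
    have hdeg : (s - Finsupp.single i 1).degree + 1 = s.degree := by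
      conv_rhs => rw [← hs, map_add, Finsupp.degree_single]
    refine ((hD i).monomial_mul hr _ _).mono_degree (by omega) |>.mono ?_
    rw [norm_mul, RCLike.norm_natCast]
    have hpow : r ^ (s - Finsupp.single i 1).degree ≤ r ^ s.degree :=
      pow_le_pow_right₀ hr (by omega)
    calc ‖a‖ * (s i : ℝ) * r ^ (s - Finsupp.single i 1).degree * M
        = (s i : ℝ) * (M * (‖a‖ * r ^ (s - Finsupp.single i 1).degree)) := by ring
      _ ≤ (s i : ℝ) * (M * (‖a‖ * r ^ s.degree)) := by gcongr
      _ ≤ (s i : ℝ) * (M * c) := by gcongr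
  | add _ _ h h' =>
    rw [map_add, mul_add]
    exact h.add h'

theorem exists_majorized_family [Finite σ] {ι : Type*} [Finite ι] {r : ℝ} (hr : 1 ≤ r)
    (f : ι → σ → MvPolynomial σ 𝕜) :
    ∃ (e : ℕ) (M : ℝ), 1 ≤ e ∧ 0 ≤ M ∧ ∀ i k, Majorized r (e + 1) (f i k) M := by
  have := Fintype.ofFinite σ
  have := Fintype.ofFinite ι
  choose d c h using fun i k => exists_majorized r (f i k)
  have hc : ∀ i k, 0 ≤ c i k := fun i k => (h i k).nonneg hr
  -- The summand 1 secures e ≥ 1, which the comparison with the factorial requires.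
  refine ⟨∑ i, ∑ k, d i k + 1, ∑ i, ∑ k, c i k, by omega,
    Finset.sum_nonneg fun i _ => Finset.sum_nonneg fun k _ => hc i k, fun i k => ?_⟩
  refine ((h i k).mono_degree ?_).mono ?_
  · have h1 := Finset.single_le_sum (f := fun k => d i k) (fun _ _ => Nat.zero_le _)
      (Finset.mem_univ k)
    have h2 := Finset.single_le_sum (f := fun i => ∑ k, d i k) (fun _ _ => Nat.zero_le _)
      (Finset.mem_univ i)
    omega
  · exact (Finset.single_le_sum (f := fun k => c i k) (fun k _ => hc i k)
      (Finset.mem_univ k)).trans (Finset.single_le_sum (f := fun i => ∑ k, c i k)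
      (fun i _ => Finset.sum_nonneg fun k _ => hc i k) (Finset.mem_univ i))

end Majorant

end

noncomputable section

/-! ### Integration of polynomial vector fields -/

section Flow

open MvPolynomial TopologicalSpace

variable {𝕜 : Type*} [RCLike 𝕜] {σ : Type*} {g : ℕ} [NeZero g]

/-- The term of order `n` in `t₂, …, t_g` of the Taylor series at `(x, 0, …, 0)` of `p` along the
flows of the vector fields `Y i`, where `ε p` is `p` along the orbit of `Y 0`. -/
def flowTerm (Y : Fin g → Derivation 𝕜 (MvPolynomial σ 𝕜) (MvPolynomial σ 𝕜))
    (ε : MvPolynomial σ 𝕜 → 𝕜 → 𝕜) : ℕ → MvPolynomial σ 𝕜 → (Fin g → 𝕜) → 𝕜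
  | 0, p, t => ε p (t 0)
  | n + 1, p, t =>
    ((n : 𝕜) + 1)⁻¹ * ∑ i ∈ Finset.univ.erase 0, t i * flowTerm Y ε n (Y i p) t

variable {Y : Fin g → Derivation 𝕜 (MvPolynomial σ 𝕜) (MvPolynomial σ 𝕜)}
  {ε : MvPolynomial σ 𝕜 → 𝕜 → 𝕜}

theorem succ_mul_flowTerm_succ (n : ℕ) (p : MvPolynomial σ 𝕜) (t : Fin g → 𝕜) :
    ((n : 𝕜) + 1) * flowTerm Y ε (n + 1) p t
      = ∑ i ∈ Finset.univ.erase 0, t i * flowTerm Y ε n (Y i p) t := by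
  rw [flowTerm, mul_inv_cancel_left₀ (Nat.cast_add_one_ne_zero n)]

section Point

variable {t : Fin g → 𝕜} {φ : MvPolynomial σ 𝕜 →ₐ[𝕜] 𝕜}

theorem flowTerm_add (hφ : ∀ p, ε p (t 0) = φ p) (n : ℕ) (p q : MvPolynomial σ 𝕜) :
    flowTerm Y ε n (p + q) t = flowTerm Y ε n p t + flowTerm Y ε n q t := by
  induction n generalizing p q with
  | zero => simp [flowTerm, hφ]
  | succ n ih => simp only [flowTerm, map_add, ih, mul_add, Finset.sum_add_distrib]

theorem flowTerm_smul (hφ : ∀ p, ε p (t 0) = φ p) (n : ℕ) (a : 𝕜) (p : MvPolynomial σ 𝕜) :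
    flowTerm Y ε n (a • p) t = a * flowTerm Y ε n p t := by
  induction n generalizing p with
  | zero => simp [flowTerm, hφ]
  | succ n ih =>
    simp only [flowTerm, Derivation.map_smul, ih, mul_left_comm _ a, ← Finset.mul_sum]

theorem flowTerm_zero_right (hφ : ∀ p, ε p (t 0) = φ p) (n : ℕ) :
    flowTerm Y ε n 0 t = 0 := by
  have := flowTerm_smul (Y := Y) hφ n 0 0
  rwa [zero_smul, zero_mul] at this

theorem flowTerm_one (hφ : ∀ p, ε p (t 0) = φ p) (n : ℕ) :
    flowTerm Y ε n 1 t = if n = 0 then 1 else 0 := by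
  cases n with
  | zero => simp [flowTerm, hφ]
  | succ n => simp [flowTerm, flowTerm_zero_right hφ]

/-- The series in one auxiliary variable with these terms satisfies G(p)' = ∑ tᵢ G(Yᵢp). By the
Leibniz rule G(pq) and G(p)G(q) obey the same differential recursion, with the same constant term.
-/
theorem flowTerm_mul (hφ : ∀ p, ε p (t 0) = φ p) (n : ℕ) (p q : MvPolynomial σ 𝕜) :
    flowTerm Y ε n (p * q) t
      = ∑ kl ∈ Finset.HasAntidiagonal.antidiagonal n, flowTerm Y ε kl.1 p t * flowTerm Y ε kl.2 q t := by
  let G : MvPolynomial σ 𝕜 → PowerSeries 𝕜 := fun p => PowerSeries.mk fun n => flowTerm Y ε n p t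
  have hG : ∀ p, PowerSeries.derivative 𝕜 (G p)
      = ∑ i ∈ Finset.univ.erase 0, PowerSeries.C (t i) * G (Y i p) := by
    intro p
    ext n
    rw [PowerSeries.coeff_derivative, map_sum]
    simp only [G, PowerSeries.coeff_C_mul, PowerSeries.coeff_mk]
    rw [← succ_mul_flowTerm_succ, mul_comm]
  suffices h : PowerSeries.coeff n (G (p * q)) = PowerSeries.coeff n (G p * G q) by
    simpa [G, PowerSeries.coeff_mul] using h
  induction n generalizing p q with
  | zero => simp [G, flowTerm, hφ]
  | succ n ih =>
    refine mul_right_cancel₀ (Nat.cast_add_one_ne_zero n : (n : 𝕜) + 1 ≠ 0) ?_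
    rw [← PowerSeries.coeff_derivative, ← PowerSeries.coeff_derivative, Derivation.leibniz, hG, hG,
      hG, smul_eq_mul, smul_eq_mul, Finset.mul_sum, Finset.mul_sum, ← Finset.sum_add_distrib,
      map_sum, map_sum]
    refine Finset.sum_congr rfl fun i _ => ?_
    have hadd : ∀ p q, G (p + q) = G p + G q := fun p q => by
      ext n
      simp [G, flowTerm_add hφ]
    rw [Derivation.leibniz, smul_eq_mul, smul_eq_mul, hadd, mul_left_comm, mul_left_comm (G q),
      ← mul_add, PowerSeries.coeff_C_mul, PowerSeries.coeff_C_mul, map_add, map_add, ih, ih]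

/-- The j-th derivation meets a polynomial of degree at most d + je, so it contributes the factor (d
+ je)M, and summing over the directions gives the sum of the |tᵢ|. -/
theorem norm_flowTerm_mul_factorial_le (hφ : ∀ p, ε p (t 0) = φ p) {r M : ℝ} (hr : 1 ≤ r)
    (hM : 0 ≤ M) {e : ℕ} (hY : ∀ i k, Majorized r (e + 1) (Y i (X k)) M)
    (hb : ∀ k, ‖φ (X k)‖ ≤ r) (n : ℕ) {d : ℕ} {c : ℝ} {p : MvPolynomial σ 𝕜}
    (hp : Majorized r d p c) :
    ‖flowTerm Y ε n p t‖ * n.factorial ≤ (M * ∑ i ∈ Finset.univ.erase 0, ‖t i‖) ^ n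
      * (∏ j ∈ Finset.range n, (d + j * e : ℕ)) * c := by
  induction n generalizing d c p with
  | zero => simpa [flowTerm, hφ] using hp.norm_le hb
  | succ n ih =>
    set τ := ∑ i ∈ Finset.univ.erase 0, ‖t i‖ with hτ
    have h1 : ‖flowTerm Y ε (n + 1) p t‖ * (n + 1 : ℕ)
        ≤ ∑ i ∈ Finset.univ.erase 0, ‖t i‖ * ‖flowTerm Y ε n (Y i p) t‖ := by
      have : ‖flowTerm Y ε (n + 1) p t‖ * (n + 1 : ℕ)
          = ‖((n : 𝕜) + 1) * flowTerm Y ε (n + 1) p t‖ := by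
        rw [norm_mul, mul_comm, ← RCLike.norm_natCast (K := 𝕜), Nat.cast_add, Nat.cast_one]
      rw [this, succ_mul_flowTerm_succ]
      exact (norm_sum_le _ _).trans_eq (by simp only [norm_mul])
    rw [Nat.factorial_succ, Nat.cast_mul, ← mul_assoc]
    calc ‖flowTerm Y ε (n + 1) p t‖ * (n + 1 : ℕ) * n.factorial
        ≤ (∑ i ∈ Finset.univ.erase 0, ‖t i‖ * ‖flowTerm Y ε n (Y i p) t‖) * n.factorial := by
          gcongr
      _ = ∑ i ∈ Finset.univ.erase 0,
            ‖t i‖ * (‖flowTerm Y ε n (Y i p) t‖ * n.factorial) := by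
          rw [Finset.sum_mul]
          simp only [mul_assoc]
      _ ≤ ∑ i ∈ Finset.univ.erase 0, ‖t i‖ * ((M * τ) ^ n
            * (∏ j ∈ Finset.range n, (d + e + j * e : ℕ)) * (d * M * c)) := by
          refine Finset.sum_le_sum fun i _ => mul_le_mul_of_nonneg_left ?_ (norm_nonneg _)
          exact ih (hp.derivation hr hM (hY i))
      _ = _ := by
          rw [← Finset.sum_mul, ← hτ, Finset.prod_range_succ', Nat.zero_mul, Nat.add_zero]
          have : ∀ j, d + (j + 1) * e = d + e + j * e := fun j => by ring
          simp only [this]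
          push_cast
          ring

/-- Degrees grow linearly, hence the product grows like n! times a geometric factor; the n! is
absorbed by that of the Taylor coefficients. -/
theorem prod_range_add_mul_le (d e n : ℕ) (he : 1 ≤ e) :
    ∏ j ∈ Finset.range n, (d + j * e) ≤ n.factorial * ((2 * e) ^ n * 2 ^ d) := by
  calc ∏ j ∈ Finset.range n, (d + j * e) ≤ ∏ j ∈ Finset.range n, e * (d + 1 + j) := by
        refine Finset.prod_le_prod (fun _ _ => Nat.zero_le _) fun j _ => ?_
        nlinarith
    _ = e ^ n * (n.factorial * (d + n).choose n) := by
        rw [Finset.prod_mul_distrib, Finset.prod_const, Finset.card_range,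
          ← Nat.ascFactorial_eq_prod_range, Nat.ascFactorial_eq_factorial_mul_choose]
    _ ≤ e ^ n * (n.factorial * 2 ^ (d + n)) := by
        gcongr
        exact Nat.choose_le_two_pow _ _
    _ = n.factorial * ((2 * e) ^ n * 2 ^ d) := by ring

/-- The smallness condition on t does not involve p, which enters only through the constant 2^d c.
One neighbourhood therefore serves all polynomials. -/
theorem norm_flowTerm_le (hφ : ∀ p, ε p (t 0) = φ p) {r M : ℝ} (hr : 1 ≤ r)
    (hM : 0 ≤ M) {e : ℕ} (he : 1 ≤ e) (hY : ∀ i k, Majorized r (e + 1) (Y i (X k)) M)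
    (hb : ∀ k, ‖φ (X k)‖ ≤ r)
    (ht : 2 * e * M * ∑ i ∈ Finset.univ.erase 0, ‖t i‖ ≤ 1 / 2)
    {d : ℕ} {c : ℝ} {p : MvPolynomial σ 𝕜} (hp : Majorized r d p c) (n : ℕ) :
    ‖flowTerm Y ε n p t‖ ≤ (1 / 2) ^ n * (2 ^ d * c) := by
  set τ := ∑ i ∈ Finset.univ.erase 0, ‖t i‖ with hτ
  have hτ0 : 0 ≤ τ := Finset.sum_nonneg fun i _ => norm_nonneg _
  have hc : 0 ≤ c := hp.nonneg hr
  have h := norm_flowTerm_mul_factorial_le hφ hr hM hY hb n hp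
  rw [← hτ] at h
  refine le_of_mul_le_mul_right (h.trans ?_) (Nat.cast_pos.mpr n.factorial_pos : (0 : ℝ) < _)
  have h2 : ((∏ j ∈ Finset.range n, (d + j * e) : ℕ) : ℝ)
      ≤ n.factorial * ((2 * e) ^ n * 2 ^ d) := by
    exact_mod_cast prod_range_add_mul_le d e n he
  calc (M * τ) ^ n * ((∏ j ∈ Finset.range n, (d + j * e) : ℕ) : ℝ) * c
      ≤ (M * τ) ^ n * (n.factorial * ((2 * e) ^ n * 2 ^ d)) * c := by gcongr
    _ = (2 * e * M * τ) ^ n * (2 ^ d * c) * n.factorial := by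
        rw [mul_pow (2 * (e : ℝ) * M), mul_pow (2 * (e : ℝ)), mul_pow M]
        ring
    _ ≤ (1 / 2) ^ n * (2 ^ d * c) * n.factorial := by gcongr

end Point

/-- The partial derivatives of `flowTerm Y ε n p`. -/
def flowTermD (Y : Fin g → Derivation 𝕜 (MvPolynomial σ 𝕜) (MvPolynomial σ 𝕜))
    (ε : MvPolynomial σ 𝕜 → 𝕜 → 𝕜) (i : Fin g) (n : ℕ) (p : MvPolynomial σ 𝕜) (t : Fin g → 𝕜) : 𝕜 :=
  if i = 0 then flowTerm Y ε n (Y 0 p) t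
  else if n = 0 then 0 else flowTerm Y ε (n - 1) (Y i p) t

/-- Because the fields commute, ∂ₓ acts by p ↦ Y₀p at the same order, and ∂/∂tᵢ acts by p ↦ Yᵢp and
lowers the order by one. -/
theorem hasFDerivAt_flowTerm (hY : ∀ i j p, Y i (Y j p) = Y j (Y i p)) {t : Fin g → 𝕜}
    (hε : ∀ p, HasDerivAt (ε p) (ε (Y 0 p) (t 0)) (t 0)) (n : ℕ) (p : MvPolynomial σ 𝕜) :
    HasFDerivAt (flowTerm Y ε n p)
      (∑ i, flowTermD Y ε i n p t • ContinuousLinearMap.proj (R := 𝕜) (φ := fun _ => 𝕜) i) t := by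
  induction n generalizing p with
  | zero =>
    have h := (hε p).hasFDerivAt.comp t
      (ContinuousLinearMap.proj (R := 𝕜) (φ := fun _ : Fin g => 𝕜) 0).hasFDerivAt
    refine h.congr_fderiv ?_
    ext v
    simp only [flowTermD, flowTerm, if_true, ContinuousLinearMap.comp_apply, sum_apply,
      ContinuousLinearMap.proj_apply, ite_smul]
    rw [Finset.sum_eq_single 0]
    · simp [mul_comm]
    · intro i _ hi
      simp [hi]
    · simp
  | succ n ih =>
    have h : HasFDerivAt (fun s => ((n : 𝕜) + 1)⁻¹ * ∑ i ∈ Finset.univ.erase 0,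
        s i * flowTerm Y ε n (Y i p) s) _ t :=
      (HasFDerivAt.fun_sum fun i (_ : i ∈ Finset.univ.erase (0 : Fin g)) =>
        (ContinuousLinearMap.proj (R := 𝕜) (φ := fun _ : Fin g => 𝕜) i).hasFDerivAt.mul
          (ih (Y i p))).const_mul _
    refine h.congr_fderiv ?_
    ext v
    simp only [smul_apply, sum_apply, add_apply, ContinuousLinearMap.proj_apply, smul_eq_mul]
    rw [inv_mul_eq_iff_eq_mul₀ (Nat.cast_add_one_ne_zero n), Finset.sum_add_distrib]
    have hj : ∀ j : Fin g, ((n : 𝕜) + 1) * flowTermD Y ε j (n + 1) p t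
        = (∑ i ∈ Finset.univ.erase 0, t i * flowTermD Y ε j n (Y i p) t)
          + if j = 0 then 0 else flowTerm Y ε n (Y j p) t := by
      intro j
      by_cases hj : j = 0
      · simp only [flowTermD, hj, if_true, add_zero, succ_mul_flowTerm_succ, hY 0]
      · cases n with
        | zero => simp [flowTermD, hj]
        | succ m =>
          simp only [flowTermD, hj, if_false, Nat.succ_ne_zero, Nat.add_sub_cancel, hY j]
          rw [← succ_mul_flowTerm_succ]
          push_cast
          ring
    simp_rw [Finset.mul_sum, ← mul_assoc, hj, add_mul, Finset.sum_add_distrib, Finset.sum_mul]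
    rw [Finset.sum_comm]
    congr 1
    rw [← Finset.add_sum_erase _ _ (Finset.mem_univ (0 : Fin g)), if_pos rfl, zero_mul, zero_add]
    exact Finset.sum_congr rfl fun i hi => by rw [if_neg (Finset.ne_of_mem_erase hi)]

end Flow

end

noncomputable section

/-! ### Summation of the Taylor series along commuting flows -/

section FlowSum

open MvPolynomial TopologicalSpace

variable {𝕜 : Type*} [RCLike 𝕜] {σ : Type*} {g : ℕ} [NeZero g]

/-- The points near which the Taylor series converge normally. -/
def flowDomain (Y : Fin g → Derivation 𝕜 (MvPolynomial σ 𝕜) (MvPolynomial σ 𝕜))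
    (ε : MvPolynomial σ 𝕜 → 𝕜 → 𝕜) (Ω : Opens 𝕜) : Opens (Fin g → 𝕜) where
  carrier := {t | ∃ U : Set (Fin g → 𝕜), IsOpen U ∧ t ∈ U ∧ (∀ s ∈ U, s 0 ∈ Ω) ∧
    ∀ p, ∃ b : ℕ → ℝ, Summable b ∧ ∀ n, ∀ s ∈ U, ‖flowTerm Y ε n p s‖ ≤ b n}
  is_open' := isOpen_iff_forall_mem_open.mpr fun _ ⟨U, hU, ht, h⟩ =>
    ⟨U, fun _ hs => ⟨U, hU, hs, h⟩, hU, ht⟩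

/-- The sum of the Taylor series. -/
def flowSum (Y : Fin g → Derivation 𝕜 (MvPolynomial σ 𝕜) (MvPolynomial σ 𝕜))
    (ε : MvPolynomial σ 𝕜 → 𝕜 → 𝕜) (p : MvPolynomial σ 𝕜) (t : Fin g → 𝕜) : 𝕜 :=
  ∑' n, flowTerm Y ε n p t

variable {Y : Fin g → Derivation 𝕜 (MvPolynomial σ 𝕜) (MvPolynomial σ 𝕜)}
  {ε : MvPolynomial σ 𝕜 → 𝕜 → 𝕜} {Ω : Opens 𝕜}

theorem summable_norm_flowTerm {t : Fin g → 𝕜} (ht : t ∈ flowDomain Y ε Ω)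
    (p : MvPolynomial σ 𝕜) : Summable fun n => ‖flowTerm Y ε n p t‖ := by
  obtain ⟨U, -, htU, -, h⟩ := ht
  obtain ⟨b, hb, hle⟩ := h p
  exact .of_nonneg_of_le (fun _ => norm_nonneg _) (fun n => hle n t htU) hb

theorem apply_zero_mem_of_mem_flowDomain {t : Fin g → 𝕜} (ht : t ∈ flowDomain Y ε Ω) :
    t 0 ∈ Ω := by
  obtain ⟨U, -, htU, h, -⟩ := ht
  exact h t htU

/-- Near a point of the line the finitely many generators are bounded by some r, by continuity, and
t₂, …, t_g are small. The Taylor series is then dominated by a geometric series. -/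
theorem single_mem_flowDomain [Finite σ] (hε : ∀ x ∈ Ω, ∃ φ : MvPolynomial σ 𝕜 →ₐ[𝕜] 𝕜, ∀ p, ε p x = φ p)
    (hc : ∀ p, ContinuousOn (ε p) Ω) {x : 𝕜} (hx : x ∈ Ω) :
    Pi.single 0 x ∈ flowDomain (g := g) Y ε Ω := by
  have := Fintype.ofFinite σ
  obtain ⟨r, hr, hrx⟩ : ∃ r : ℝ, 1 ≤ r ∧ ∀ k, ‖ε (X k) x‖ < r := by
    refine ⟨1 + ∑ k, ‖ε (X k) x‖,
      le_add_of_nonneg_right (Finset.sum_nonneg fun _ _ => norm_nonneg _), fun k => ?_⟩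
    have := Finset.single_le_sum (f := fun k => ‖ε (X k) x‖) (fun _ _ => norm_nonneg _)
      (Finset.mem_univ k)
    linarith
  obtain ⟨e, M, he, hM, hY⟩ := exists_majorized_family hr fun i k => Y i (X k)
  have h0 : (Pi.single 0 x : Fin g → 𝕜) 0 = x := by simp
  have hτ : Continuous fun s : Fin g → 𝕜 => 2 * e * M * ∑ i ∈ Finset.univ.erase 0, ‖s i‖ := by
    fun_prop
  have hτ0 : 2 * e * M * ∑ i ∈ Finset.univ.erase (0 : Fin g),
      ‖(Pi.single 0 x : Fin g → 𝕜) i‖ < 1 / 2 := by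
    rw [Finset.sum_eq_zero fun i hi => by
      rw [Pi.single_eq_of_ne (Finset.ne_of_mem_erase hi), norm_zero]]
    norm_num
  have hev : ∀ᶠ s : Fin g → 𝕜 in nhds (Pi.single 0 x), s 0 ∈ Ω ∧ (∀ k, ‖ε (X k) (s 0)‖ < r) ∧
      2 * e * M * ∑ i ∈ Finset.univ.erase 0, ‖s i‖ < 1 / 2 := by
    have hcont : Filter.Tendsto (fun s : Fin g → 𝕜 => s 0) (nhds (Pi.single 0 x)) (nhds x) := by
      have := (continuous_apply (A := fun _ : Fin g => 𝕜) 0).tendsto (Pi.single 0 x)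
      rwa [h0] at this
    refine (hcont.eventually (Ω.isOpen.mem_nhds hx)).and
      ((Filter.eventually_all.mpr fun k => ?_).and (hτ.continuousAt.eventually_lt_const hτ0))
    exact hcont.eventually
      (((hc (X k)).continuousAt (Ω.isOpen.mem_nhds hx)).norm.eventually_lt_const (hrx k))
  obtain ⟨U, hU, hUo, hxU⟩ := eventually_nhds_iff.mp hev
  refine ⟨U, hUo, hxU, fun s hs => (hU s hs).1, fun p => ?_⟩
  obtain ⟨d, c, hp⟩ := exists_majorized r p
  refine ⟨fun n => (1 / 2) ^ n * (2 ^ d * c), summable_geometric_two.mul_right _, fun n s hs => ?_⟩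
  obtain ⟨φ, hφ⟩ := hε _ (hU s hs).1
  exact norm_flowTerm_le hφ hr hM he hY (fun k => by rw [← hφ]; exact ((hU s hs).2.1 k).le)
    (hU s hs).2.2.le hp n

/-- The series of partial derivatives are, up to a shift of the order, the Taylor series of the Yᵢp,
which converge normally on the same neighbourhood. -/
theorem hasFDerivAt_flowSum (hY : ∀ i j p, Y i (Y j p) = Y j (Y i p))
    (hε : ∀ x ∈ Ω, ∀ p, HasDerivAt (ε p) (ε (Y 0 p) x) x) {t : Fin g → 𝕜}
    (ht : t ∈ flowDomain Y ε Ω) (p : MvPolynomial σ 𝕜) :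
    HasFDerivAt (flowSum Y ε p) (∑ i, flowSum Y ε (Y i p) t •
      ContinuousLinearMap.proj (R := 𝕜) (φ := fun _ => 𝕜) i) t := by
  obtain ⟨U, hUo, htU, hUΩ, hU⟩ := id ht
  have hbound : ∀ i : Fin g, ∃ b : ℕ → ℝ, Summable b ∧
      ∀ n, ∀ s ∈ U, ‖flowTermD Y ε i n p s‖ ≤ b n := by
    intro i
    obtain ⟨b, hb, hle⟩ := hU (Y i p)
    by_cases hi : i = 0
    · subst hi
      exact ⟨b, hb, fun n s hs => by simpa [flowTermD] using hle n s hs⟩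
    · refine ⟨fun n => if n = 0 then 0 else b (n - 1), (summable_nat_add_iff 1).mp (by simpa using hb),
        fun n s hs => ?_⟩
      rw [flowTermD, if_neg hi]
      cases n with
      | zero => simp
      | succ n => simpa using hle n s hs
  have hsum : ∀ i : Fin g, HasSum (fun n => flowTermD Y ε i n p t) (flowSum Y ε (Y i p) t) := by
    intro i
    have h : HasSum (fun n => flowTerm Y ε n (Y i p) t) (flowSum Y ε (Y i p) t) :=
      (summable_norm_flowTerm ht (Y i p)).of_norm.hasSum
    by_cases hi : i = 0
    · subst hi
      simpa [flowTermD] using h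
    · rw [← hasSum_nat_add_iff' 1]
      simpa [flowTermD, hi] using h
  choose b hb hle using hbound
  obtain ⟨ρ, hρ, hball⟩ := Metric.isOpen_iff.mp hUo t htU
  have hsub : ∀ s ∈ Metric.ball t ρ, s ∈ U := fun s hs => hball hs
  have hpre : IsPreconnected (Metric.ball t ρ) := (convex_ball t ρ).isPreconnected
  have hd := fun n (s : Fin g → 𝕜) (hs : s ∈ Metric.ball t ρ) =>
    hasFDerivAt_flowTerm hY (hε _ (hUΩ s (hsub s hs))) n p
  let P : Fin g → (Fin g → 𝕜) →L[𝕜] 𝕜 := fun i => ContinuousLinearMap.proj i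
  change ∀ n, ∀ s ∈ Metric.ball t ρ,
    HasFDerivAt (flowTerm Y ε n p) (∑ i, flowTermD Y ε i n p s • P i) s at hd
  have hn : ∀ n, ∀ s ∈ Metric.ball t ρ,
      ‖∑ i, flowTermD Y ε i n p s • P i‖ ≤ ∑ i, b i n * ‖P i‖ := fun n s hs =>
    (norm_sum_le _ _).trans (Finset.sum_le_sum fun i _ => by
      rw [norm_smul]
      exact mul_le_mul_of_nonneg_right (hle i n s (hsub s hs)) (norm_nonneg _))
  have hu : Summable fun n => ∑ i, b i n * ‖P i‖ := summable_sum fun i _ => (hb i).mul_right _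
  have key := hasFDerivAt_tsum_of_isPreconnected hu Metric.isOpen_ball
    hpre hd hn
    (Metric.mem_ball_self hρ) (summable_norm_flowTerm ht p).of_norm (Metric.mem_ball_self hρ)
  have hP : HasSum (fun n => ∑ i, flowTermD Y ε i n p t • P i)
      (∑ i, flowSum Y ε (Y i p) t • P i) := hasSum_sum fun i _ => (hsum i).smul_const (P i)
  rw [hP.tsum_eq] at key
  exact key

/-- The partial derivatives are again sums of this kind, so regularity improves by induction. -/
theorem contDiffOn_flowSum (hY : ∀ i j p, Y i (Y j p) = Y j (Y i p))
    (hε : ∀ x ∈ Ω, ∀ p, HasDerivAt (ε p) (ε (Y 0 p) x) x) (p : MvPolynomial σ 𝕜) :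
    ContDiffOn 𝕜 ∞ (flowSum Y ε p) (flowDomain Y ε Ω) := by
  rw [contDiffOn_infty]
  intro n
  induction n generalizing p with
  | zero =>
    exact contDiffOn_zero.mpr fun t ht =>
      (hasFDerivAt_flowSum hY hε ht p).continuousAt.continuousWithinAt
  | succ n ih =>
    rw [Nat.cast_add, Nat.cast_one, contDiffOn_succ_iff_fderiv_of_isOpen (flowDomain Y ε Ω).isOpen]
    refine ⟨fun t ht => (hasFDerivAt_flowSum hY hε ht p).differentiableAt.differentiableWithinAt,
      fun h => absurd h (by simp), ?_⟩
    refine ContDiffOn.congr (f := fun t => ∑ i, flowSum Y ε (Y i p) t •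
      ContinuousLinearMap.proj (R := 𝕜) (φ := fun _ : Fin g => 𝕜) i) ?_
      fun t ht => (hasFDerivAt_flowSum hY hε ht p).fderiv
    exact ContDiffOn.sum fun i _ => (ih (Y i p)).smul contDiffOn_const

/-- This solves the initial value problem for commuting polynomial vector fields, given an integral
curve of Y₀. A solution is an algebra homomorphism that intertwines the fields with the partial
derivatives. -/
theorem exists_flow [Finite σ] (hY : ∀ i j p, Y i (Y j p) = Y j (Y i p))
    (π : MvPolynomial σ 𝕜 →ₐ[𝕜] smoothAlg 𝕜 Ω) (hπ : ∀ p, π (Y 0 p) = dirD 𝕜 Ω 1 (π p)) :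
    ∃ (D : Opens (Fin g → 𝕜)) (hD : ∀ x ∈ Ω, Pi.single 0 x ∈ D)
      (Φ : MvPolynomial σ 𝕜 →ₐ[𝕜] smoothAlg 𝕜 D),
      (∀ i p, Φ (Y i p) = dirD 𝕜 D (Pi.single i 1) (Φ p)) ∧
      ∀ (x : Ω) p, (Φ p).1 ⟨Pi.single 0 x, hD x x.2⟩ = (π p).1 x := by
  let ε : MvPolynomial σ 𝕜 → 𝕜 → 𝕜 := fun p => zeroExt Ω (π p).1
  have hε0 : ∀ x ∈ Ω, ∃ φ : MvPolynomial σ 𝕜 →ₐ[𝕜] 𝕜, ∀ p, ε p x = φ p := fun x hx =>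
    ⟨(Pi.evalAlgHom 𝕜 (fun _ : Ω => 𝕜) ⟨x, hx⟩).comp ((smoothAlg 𝕜 Ω).val.comp π),
      fun p => zeroExt_apply (π p).1 ⟨x, hx⟩⟩
  have hε1 : ∀ x ∈ Ω, ∀ p, HasDerivAt (ε p) (ε (Y 0 p) x) x := fun x hx p => by
    have h := (smoothAlg_differentiableAt (π p) ⟨x, hx⟩).hasDerivAt
    have h2 : ε (Y 0 p) x = deriv (zeroExt Ω (π p).1) x := by
      rw [show ε (Y 0 p) x = (π (Y 0 p)).1 ⟨x, hx⟩ from zeroExt_apply _ (⟨x, hx⟩ : Ω), hπ]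
      rfl
    rw [h2]
    exact h
  have hc : ∀ p, ContinuousOn (ε p) Ω := fun p => (smoothAlg_contDiffOn (π p)).continuousOn
  have hF := contDiffOn_flowSum hY hε1
  have key : ∀ t : flowDomain Y ε Ω, ∃ φ : MvPolynomial σ 𝕜 →ₐ[𝕜] 𝕜, ∀ p, ε p (t.1 0) = φ p :=
    fun t => hε0 _ (apply_zero_mem_of_mem_flowDomain t.2)
  have hs : ∀ (t : flowDomain Y ε Ω) (p : MvPolynomial σ 𝕜), Summable fun n => flowTerm Y ε n p t.1 := fun t p =>
    (summable_norm_flowTerm t.2 p).of_norm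
  refine ⟨flowDomain Y ε Ω, fun x hx => single_mem_flowDomain hε0 hc hx,
    AlgHom.ofLinearMap { toFun := fun p => toSmooth (hF p), map_add' := ?_, map_smul' := ?_ } ?_ ?_,
    ?_, ?_⟩
  · refine fun p q => smoothAlg_ext fun t => ?_
    obtain ⟨φ, hφ⟩ := key t
    change ∑' n, flowTerm Y ε n (p + q) t.1
      = ∑' n, flowTerm Y ε n p t.1 + ∑' n, flowTerm Y ε n q t.1
    simp only [flowTerm_add hφ]
    exact (hs t p).tsum_add (hs t q)
  · refine fun a p => smoothAlg_ext fun t => ?_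
    obtain ⟨φ, hφ⟩ := key t
    change ∑' n, flowTerm Y ε n (a • p) t.1 = a * ∑' n, flowTerm Y ε n p t.1
    simp only [flowTerm_smul hφ]
    exact tsum_mul_left
  · refine smoothAlg_ext fun t => ?_
    obtain ⟨φ, hφ⟩ := key t
    change ∑' n, flowTerm Y ε n 1 t.1 = (1 : 𝕜)
    simp only [flowTerm_one hφ]
    exact tsum_ite_eq 0 _
  · refine fun p q => smoothAlg_ext fun t => ?_
    obtain ⟨φ, hφ⟩ := key t
    change ∑' n, flowTerm Y ε n (p * q) t.1
      = (∑' n, flowTerm Y ε n p t.1) * ∑' n, flowTerm Y ε n q t.1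
    rw [tsum_mul_tsum_eq_tsum_sum_antidiagonal_of_summable_norm (summable_norm_flowTerm t.2 p)
      (summable_norm_flowTerm t.2 q)]
    exact tsum_congr fun n => flowTerm_mul hφ n p q
  · refine fun i p => smoothAlg_ext fun t => ?_
    rw [dirD_apply (F := flowSum Y ε p) _ (fun t => rfl), (hasFDerivAt_flowSum hY hε1 t.2 p).fderiv]
    simp [Pi.single_apply]
  · intro x p
    change ∑' n, _ = _
    rw [tsum_eq_single 0]
    · change zeroExt Ω (π p).1 ((Pi.single 0 (x : 𝕜) : Fin g → 𝕜) 0) = _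
      rw [Pi.single_eq_same, zeroExt_apply]
    · intro n hn
      obtain ⟨n, rfl⟩ := Nat.exists_eq_succ_of_ne_zero hn
      rw [flowTerm, Finset.sum_eq_zero, mul_zero]
      intro i hi
      exact mul_eq_zero_of_left (Pi.single_eq_of_ne (Finset.ne_of_mem_erase hi) _) _

end FlowSum

end

noncomputable section

/-! ### Functions of several variables and the differential algebra -/

section Bridge

open TopologicalSpace PowerSeries

variable {𝕜 : Type*} [RCLike 𝕜] {g : ℕ}

/-- The partial derivatives on the smooth functions. -/
def coordD (D : Opens (Fin g → 𝕜)) (i : Fin g) : Derivation 𝕜 (smoothAlg 𝕜 D) (smoothAlg 𝕜 D) :=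
  dirD 𝕜 D (Pi.single i 1)

variable {D : Opens (Fin g → 𝕜)}

theorem coordD_comm (i j : Fin g) (f : smoothAlg 𝕜 D) :
    coordD D i (coordD D j f) = coordD D j (coordD D i f) := dirD_comm _ _ f

theorem exists_coordD_eq_one [NeZero g] : ∃ x : smoothAlg 𝕜 D, coordD D 0 x = 1 := by
  have h : ContDiffOn 𝕜 ∞ (ContinuousLinearMap.proj (R := 𝕜) (φ := fun _ : Fin g => 𝕜) 0) D :=
    ContinuousLinearMap.contDiff _ |>.contDiffOn
  refine ⟨toSmooth h, smoothAlg_ext fun t => ?_⟩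
  rw [coordD, dirD_apply _ (toSmooth_apply h), ContinuousLinearMap.fderiv]
  simp

theorem exists_eq_algebraMap_of_coordD_eq_zero (hD : IsPreconnected (D : Set (Fin g → 𝕜)))
    {f : smoothAlg 𝕜 D} (h : ∀ j, coordD D j f = 0) : ∃ k : 𝕜, f = algebraMap 𝕜 _ k := by
  refine exists_eq_algebraMap_of_dirD_eq_zero hD fun t => ?_
  refine ContinuousLinearMap.coe_injective (LinearMap.pi_ext' fun j => LinearMap.ext_ring ?_)
  have : fderiv 𝕜 (zeroExt D f.1) t (Pi.single j 1) = 0 :=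
    congrArg (fun f : smoothAlg 𝕜 D => f.1 t) (h j)
  simpa using this

/-- `f` is the restriction of `F` to `D`. -/
def IsRestr (f : smoothAlg 𝕜 D) (F : (Fin g → 𝕜) → 𝕜) : Prop := ∀ t : D, f.1 t = F t

theorem isRestr_zeroExt (f : smoothAlg 𝕜 D) : IsRestr f (zeroExt D f.1) := fun t =>
  (zeroExt_apply f.1 t).symm

namespace IsRestr

variable {f f' : smoothAlg 𝕜 D} {F F' : (Fin g → 𝕜) → 𝕜}

theorem add (h : IsRestr f F) (h' : IsRestr f' F') : IsRestr (f + f') (F + F') := fun t =>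
  congrArg₂ (· + ·) (h t) (h' t)

theorem sub (h : IsRestr f F) (h' : IsRestr f' F') : IsRestr (f - f') (F - F') := fun t =>
  congrArg₂ (· - ·) (h t) (h' t)

theorem mul (h : IsRestr f F) (h' : IsRestr f' F') : IsRestr (f * f') (F * F') := fun t =>
  congrArg₂ (· * ·) (h t) (h' t)

theorem smul (c : 𝕜) (h : IsRestr f F) : IsRestr (c • f) (c • F) := fun t =>
  congrArg (c * ·) (h t)

theorem partialD (h : IsRestr f F) (i : Fin g) : IsRestr (coordD D i f) (partialD i F) := fun t =>
  dirD_apply _ h t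

theorem iterate_partialD [NeZero g] (h : IsRestr f F) (n : ℕ) :
    IsRestr ((coordD D 0)^[n] f) ((_root_.partialD 0)^[n] F) := by
  induction n with
  | zero => exact h
  | succ n ih =>
    rw [Function.iterate_succ_apply', Function.iterate_succ_apply']
    exact ih.partialD 0

theorem nextPartialD (h : IsRestr f F) (i : Fin g) :
    IsRestr (nextDer (coordD D) i f) (nextPartialD i F) := by
  rw [nextDer, _root_.nextPartialD]
  split_ifs
  · exact h.partialD _
  · exact fun t => rfl

variable [NeZero g] {U : Fin g → smoothAlg 𝕜 D} {u : Fin g → (Fin g → 𝕜) → 𝕜}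

theorem schrodingerOp (hU : ∀ i, IsRestr (U i) (u i)) (h : IsRestr f F) :
    IsRestr (algL (coordD D) U f) (schrodingerOp u F) :=
  ((h.partialD 0).partialD 0).sub ((hU 0).mul h)

theorem multiOp (hU : ∀ i, IsRestr (U i) (u i)) (i : Fin g) (h : IsRestr f F) :
    IsRestr ((1 / 4 : 𝕜) • algU (coordD D) U i f) (multiOp u i F) := by
  have e : (1 / 4 : 𝕜) • algU (coordD D) U i f = coordD D 0 (coordD D 0 (coordD D i f))
      - (1 / 2 : 𝕜) • (U 0 * coordD D i f + coordD D i (U 0 * f))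
      - (1 / 4 : 𝕜) • (U i * coordD D 0 f + coordD D 0 (U i * f))
      - nextDer (coordD D) i f := by
    refine smoothAlg_ext fun t => ?_
    change (1 / 4 : 𝕜) * (4 * _ - 2 * _ - _ - 4 * _) = _ - (1 / 2 : 𝕜) * _ - (1 / 4 : 𝕜) * _ - _
    ring
  rw [e]
  exact ((((h.partialD i).partialD 0).partialD 0).sub ((((hU 0).mul (h.partialD i)).add
    (((hU 0).mul h).partialD i)).smul _)).sub ((((hU i).mul (h.partialD 0)).add
    (((hU i).mul h).partialD 0)).smul _) |>.sub (h.nextPartialD i)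

end IsRestr

/-- The operators induce operators on restrictions to D, and extension by zero turns an element of
the algebra into an admissible test function. -/
theorem commuteOn_iff {A B : ((Fin g → 𝕜) → 𝕜) → ((Fin g → 𝕜) → 𝕜)}
    {a b : smoothAlg 𝕜 D → smoothAlg 𝕜 D} (hA : ∀ f F, IsRestr f F → IsRestr (a f) (A F))
    (hB : ∀ f F, IsRestr f F → IsRestr (b f) (B F)) :
    CommuteOn D A B ↔ ∀ f, a (b f) = b (a f) := by
  constructor
  · intro h f
    refine smoothAlg_ext fun t => ?_
    rw [hA _ _ (hB _ _ (isRestr_zeroExt f)) t, hB _ _ (hA _ _ (isRestr_zeroExt f)) t]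
    exact h _ (smoothAlg_contDiffOn f) t t.2
  · intro h F hF t ht
    have hf : IsRestr (toSmooth hF) F := toSmooth_apply hF
    rw [← hA _ _ (hB _ _ hf) ⟨t, ht⟩, ← hB _ _ (hA _ _ hf) ⟨t, ht⟩, h]

section Operators

variable {R : Type*} [CommRing R] [Algebra 𝕜 R] [NeZero g]

theorem algL_smul (d : Fin g → Derivation 𝕜 R R) (u : Fin g → R) (c : 𝕜) (f : R) :
    algL d u (c • f) = c • algL d u f := by
  simp only [algL, Derivation.map_smul, mul_smul_comm, smul_sub]

theorem algU_smul (d : Fin g → Derivation 𝕜 R R) (u : Fin g → R) (i : Fin g) (c : 𝕜) (f : R) :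
    algU d u i (c • f) = c • algU d u i f := by
  simp only [algU, Derivation.map_smul, mul_smul_comm, ← smul_add, ← smul_sub]

end Operators

theorem quarter_smul_injective : Function.Injective fun f : smoothAlg 𝕜 D => (1 / 4 : 𝕜) • f :=
  smul_right_injective _ (by norm_num)

variable [NeZero g] {U : Fin g → smoothAlg 𝕜 D} {u : Fin g → (Fin g → 𝕜) → 𝕜}

theorem schrodingerCommutes_iff_forall (hU : ∀ i, IsRestr (U i) (u i)) :
    SchrodingerCommutes D u ↔ ∀ i f, algL (coordD D) U (algU (coordD D) U i f)
      = algU (coordD D) U i (algL (coordD D) U f) := by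
  refine forall_congr' fun i => ?_
  rw [commuteOn_iff (fun f F => IsRestr.schrodingerOp hU) fun f F => IsRestr.multiOp hU i]
  refine forall_congr' fun f => ?_
  rw [algL_smul]
  exact quarter_smul_injective.eq_iff

theorem schrodingerCommutes_iff (hU : ∀ i, IsRestr (U i) (u i)) :
    SchrodingerCommutes D u ↔ IsLaxCompatible (coordD D) U := by
  obtain ⟨x, hx⟩ := exists_coordD_eq_one (D := D)
  rw [schrodingerCommutes_iff_forall hU, forall_algL_algU_iff coordD_comm U hx]

theorem allCommute_iff (hU : ∀ i, IsRestr (U i) (u i)) :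
    AllCommute D u ↔ IsKdVSystem (coordD D) U := by
  obtain ⟨x, hx⟩ := exists_coordD_eq_one (D := D)
  rw [← forall_algU_algU_iff coordD_comm U hx, AllCommute, schrodingerCommutes_iff_forall hU]
  refine and_congr_right fun _ => forall_congr' fun i => forall_congr' fun j => ?_
  rw [commuteOn_iff (fun f F => IsRestr.multiOp hU i) fun f F => IsRestr.multiOp hU j]
  refine forall_congr' fun f => ?_
  rw [algU_smul, algU_smul, quarter_smul_injective.eq_iff, quarter_smul_injective.eq_iff]

end Bridge

end

noncomputable section

/-! ### The quadratic relation -/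

section QuadraticForm

open PowerSeries

variable {𝕜 R S : Type*} [Field 𝕜] [CommRing R] [Algebra 𝕜 R] [CommRing S] [Algebra 𝕜 S]

theorem map_serD {δ : Derivation 𝕜 R R} {ε : Derivation 𝕜 S S} (φ : R →ₐ[𝕜] S)
    (h : ∀ f, φ (δ f) = ε (φ f)) (F : R⟦X⟧) :
    map (φ : R →+* S) (serD δ F) = serD ε (map (φ : R →+* S) F) := by
  ext n
  simp [h]

theorem map_quadForm {δ : Derivation 𝕜 R R} {ε : Derivation 𝕜 S S} (φ : R →ₐ[𝕜] S)
    (h : ∀ f, φ (δ f) = ε (φ f)) (u : R) (F : R⟦X⟧) :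
    map (φ : R →+* S) (quadForm δ u F) = quadForm ε (φ u) (map (φ : R →+* S) F) := by
  simp only [quadForm, map_add, map_sub, map_mul, map_pow, map_X, map_serD φ h, map_C, map_ofNat]
  rfl

theorem exists_eq_map_algebraMap {F : R⟦X⟧} (h : ∀ n, ∃ k : 𝕜, coeff n F = algebraMap 𝕜 R k) :
    ∃ M : 𝕜⟦X⟧, F = map (algebraMap 𝕜 R) M := by
  choose k hk using h
  exact ⟨mk k, by ext n; simp [hk]⟩

theorem coeff_zero_quadForm (δ : Derivation 𝕜 R R) (u : R) {F : R⟦X⟧} (h : constantCoeff F = 2) :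
    coeff 0 (quadForm δ u F) = 16 := by
  rw [coeff_zero_eq_constantCoeff_apply, quadForm]
  simp only [map_add, map_mul, map_pow, constantCoeff_X, zero_mul, zero_add, h, map_ofNat]
  norm_num

/-- The contributions 16u from 4uF² and -16u from 4F² cancel exactly when F₁ = -u. Hence (∗) has no
term of degree zero on the left. -/
theorem coeff_one_quadForm (δ : Derivation 𝕜 R R) (u : R) {F : R⟦X⟧} (h : constantCoeff F = 2)
    (h1 : coeff 1 F = -u) : coeff 1 (quadForm δ u F) = 0 := by
  have four : (4 : R⟦X⟧) = C (4 : R) := (map_ofNat C 4).symm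
  have h0 : constantCoeff (serD δ F) = 0 := by
    rw [← coeff_zero_eq_constantCoeff_apply, coeff_serD, coeff_zero_eq_constantCoeff_apply, h,
      derivation_ofNat]
  have h2 : constantCoeff (serD δ (serD δ F)) = 0 := by
    rw [← coeff_zero_eq_constantCoeff_apply, coeff_serD, coeff_zero_eq_constantCoeff_apply, h0,
      map_zero]
  have e : coeff 1 (F ^ 2) = -(4 * u) := by
    rw [pow_two, coeff_mul, Finset.Nat.sum_antidiagonal_eq_sum_range_succ_mk,
      Finset.sum_range_succ, Finset.sum_range_one]
    simp only [coeff_zero_eq_constantCoeff_apply, h, h1, Nat.sub_zero, Nat.sub_self]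
    ring
  rw [quadForm, map_add, coeff_succ_X_mul, coeff_zero_eq_constantCoeff_apply]
  simp only [map_add, map_sub, map_mul, map_pow, h0, h2, h, map_ofNat, constantCoeff_C]
  rw [four, coeff_C_mul, e]
  ring

theorem coeff_mul_eq_zero_of_lt {F G : R⟦X⟧} {a b n : ℕ} (hF : ∀ k, a < k → coeff k F = 0)
    (hG : ∀ k, b < k → coeff k G = 0) (hn : a + b < n) : coeff n (F * G) = 0 := by
  rw [coeff_mul]
  refine Finset.sum_eq_zero fun p hp => ?_
  have := Finset.HasAntidiagonal.mem_antidiagonal.mp hp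
  rcases lt_or_ge a p.1 with h | h
  · rw [hF _ h, zero_mul]
  · rw [hG _ (by omega), mul_zero]

theorem coeff_quadForm_of_lt (δ : Derivation 𝕜 R R) (u : R) {F : R⟦X⟧} {g n : ℕ}
    (hF : ∀ k, g < k → coeff k F = 0) (hn : 2 * g + 1 < n) : coeff n (quadForm δ u F) = 0 := by
  have four : (4 : R⟦X⟧) = C (4 : R) := (map_ofNat C 4).symm
  have two : (2 : R⟦X⟧) = C (2 : R) := (map_ofNat C 2).symm
  have h1 : ∀ k, g < k → coeff k (serD δ F) = 0 := fun k hk => by rw [coeff_serD, hF k hk, map_zero]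
  have h2 : ∀ k, g < k → coeff k (serD δ (serD δ F)) = 0 := fun k hk => by
    rw [coeff_serD, h1 k hk, map_zero]
  obtain ⟨n, rfl⟩ : ∃ m, n = m + 1 := ⟨n - 1, by omega⟩
  rw [quadForm, four, two, map_add, coeff_succ_X_mul, map_add, map_sub]
  simp only [coeff_C_mul, pow_two]
  rw [coeff_mul_eq_zero_of_lt h1 h1 (by omega), coeff_mul_eq_zero_of_lt hF h2 (by omega),
    coeff_mul_eq_zero_of_lt hF hF (by omega), coeff_mul_eq_zero_of_lt hF hF (by omega)]
  simp

end QuadraticForm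

/-! ### The pointwise relation (∗) as an identity of power series -/

section Relation

open TopologicalSpace

variable {𝕜 : Type*} [RCLike 𝕜] {g : ℕ}

/-- The polynomial `4 ξ μ(ξ)`. -/
def relationPoly (g : ℕ) (μ : ℕ → 𝕜) : Polynomial 𝕜 :=
  .C 16 + ∑ i ∈ Finset.Icc 1 (2 * g), .C (4 * μ i) * .X ^ (i + 1)

theorem coeff_relationPoly (g : ℕ) (μ : ℕ → 𝕜) (n : ℕ) : (relationPoly g μ).coeff n
    = if n = 0 then 16 else if n ∈ Finset.Icc 2 (2 * g + 1) then 4 * μ (n - 1) else 0 := by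
  rw [relationPoly, Polynomial.coeff_add, Polynomial.coeff_C, Polynomial.finsetSum_coeff]
  simp only [Polynomial.coeff_C_mul_X_pow]
  cases n with
  | zero => simp
  | succ n =>
    simp only [Nat.succ_ne_zero, if_false, zero_add, Nat.add_right_cancel_iff, Finset.sum_ite_eq,
      Nat.add_sub_cancel, Finset.mem_Icc]
    congr 1
    simp only [eq_iff_iff]
    omega

section Polynomial

variable {R : Type*} [CommRing R] [Algebra 𝕜 R]

/-- The polynomial `∑ uᵢ ξⁱ`. -/
def genPoly (u : Fin g → R) : Polynomial R := ∑ i : Fin g, .C (u i) * .X ^ ((i : ℕ) + 1)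

theorem coeff_genPoly (u : Fin g → R) (n : ℕ) : (genPoly u).coeff n
    = if h : n ≠ 0 ∧ n - 1 < g then u ⟨n - 1, h.2⟩ else 0 := by
  rw [genPoly, Polynomial.finsetSum_coeff]
  simp only [Polynomial.coeff_C_mul_X_pow]
  split_ifs with h
  · rw [Finset.sum_eq_single ⟨n - 1, h.2⟩]
    · rw [if_pos (by simp only; omega)]
    · intro i _ hi
      rw [if_neg]
      rintro rfl
      exact hi (by simp)
    · simp
  · refine Finset.sum_eq_zero fun i _ => if_neg ?_
    rintro rfl
    exact h ⟨by simp, by simp⟩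

theorem wSeries_eq_coe (u : Fin g → R) : wSeries u = ((2 - genPoly u : Polynomial R) : PowerSeries R) := by
  ext n
  have two : (2 : Polynomial R) = .C 2 := (map_ofNat Polynomial.C 2).symm
  rw [Polynomial.coeff_coe, two, Polynomial.coeff_sub, Polynomial.coeff_C, coeff_genPoly, wSeries,
    PowerSeries.coeff_mk]
  by_cases h : n = 0 <;> by_cases h' : n - 1 < g <;> simp [h, h']

theorem serD_coe_genPoly (δ : Derivation 𝕜 R R) (u : Fin g → R) :
    serD δ (genPoly u : PowerSeries R) = (genPoly fun i => δ (u i) : Polynomial R) := by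
  ext n
  rw [coeff_serD, Polynomial.coeff_coe, Polynomial.coeff_coe, coeff_genPoly, coeff_genPoly]
  split_ifs <;> simp

theorem quadForm_wSeries_eq_coe [NeZero g] (δ : Derivation 𝕜 R R) (u : Fin g → R) :
    quadForm δ (u 0) (wSeries u) = ((.X * ((genPoly fun i => δ (u i)) ^ 2
      + 2 * (genPoly fun i => δ (δ (u i))) * (2 - genPoly u) + 4 * (.C (u 0) * (2 - genPoly u) ^ 2))
      + 4 * (2 - genPoly u) ^ 2 : Polynomial R) : PowerSeries R) := by
  have hofNat : ∀ n : ℕ, [n.AtLeastTwo] →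
      ((OfNat.ofNat n : Polynomial R) : PowerSeries R) = OfNat.ofNat n := fun n _ =>
    map_ofNat (Polynomial.coeToPowerSeries.ringHom (R := R)) n
  have hsub : ∀ p q : Polynomial R, ((p - q : Polynomial R) : PowerSeries R) = p - q :=
    fun p q => map_sub (Polynomial.coeToPowerSeries.ringHom (R := R)) p q
  rw [quadForm, wSeries_eq_coe]
  simp only [hsub, hofNat, Polynomial.coe_add, Polynomial.coe_mul, Polynomial.coe_pow,
    Polynomial.coe_X, Polynomial.coe_C, map_sub, derivation_ofNat, serD_coe_genPoly, map_neg,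
    zero_sub]
  ring

end Polynomial

variable {D : Opens (Fin g → 𝕜)}

/-- Evaluation at a point. -/
def smoothEval (t : D) : smoothAlg 𝕜 D →ₐ[𝕜] 𝕜 :=
  (Pi.evalAlgHom 𝕜 (fun _ : D => 𝕜) t).comp (smoothAlg 𝕜 D).val

theorem IsRestr.eval_map_genPoly {U : Fin g → smoothAlg 𝕜 D} {u : Fin g → (Fin g → 𝕜) → 𝕜}
    (hU : ∀ i, IsRestr (U i) (u i)) (t : D) (ξ : 𝕜) :
    ((genPoly U).map (smoothEval t : smoothAlg 𝕜 D →+* 𝕜)).eval ξ = genFun u ξ t := by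
  rw [genPoly, genFun, Polynomial.map_sum, Polynomial.eval_finsetSum]
  refine Finset.sum_congr rfl fun i _ => ?_
  simp only [Polynomial.map_mul, Polynomial.map_C, Polynomial.map_pow, Polynomial.map_X,
    Polynomial.eval_mul, Polynomial.eval_C, Polynomial.eval_pow, Polynomial.eval_X]
  exact congrArg (· * _) (hU i t)

/-- Multiplied by ξ, both sides are polynomials in ξ at each point; equality for all ξ ≠ 0 is
equality at infinitely many places, hence of coefficients. -/
theorem quadraticRelation_iff [NeZero g] {U : Fin g → smoothAlg 𝕜 D}
    {u : Fin g → (Fin g → 𝕜) → 𝕜} (hU : ∀ i, IsRestr (U i) (u i)) (μ : ℕ → 𝕜) :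
    QuadraticRelation D u μ ↔ quadForm (coordD D 0) (U 0) (wSeries U)
      = PowerSeries.map (algebraMap 𝕜 _) (relationPoly g μ : PowerSeries 𝕜) := by
  set Q : Polynomial (smoothAlg 𝕜 D) := .X * ((genPoly fun i => coordD D 0 (U i)) ^ 2
      + 2 * (genPoly fun i => coordD D 0 (coordD D 0 (U i))) * (2 - genPoly U)
      + 4 * (.C (U 0) * (2 - genPoly U) ^ 2)) + 4 * (2 - genPoly U) ^ 2 with hQ
  have hM : PowerSeries.map (algebraMap 𝕜 (smoothAlg 𝕜 D)) (relationPoly g μ : PowerSeries 𝕜)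
      = ((relationPoly g μ).map (algebraMap 𝕜 _) : Polynomial (smoothAlg 𝕜 D)) := by
    ext n
    simp
  rw [quadForm_wSeries_eq_coe, ← hQ, hM, Polynomial.coe_inj]
  have h1 : ∀ i, IsRestr (coordD D 0 (U i)) (partialD 0 (u i)) := fun i => (hU i).partialD 0
  have h2 : ∀ i, IsRestr (coordD D 0 (coordD D 0 (U i))) (partialD 0 (partialD 0 (u i))) :=
    fun i => (h1 i).partialD 0
  have hQe : ∀ (t : D) (ξ : 𝕜), (Q.map (smoothEval t : smoothAlg 𝕜 D →+* 𝕜)).eval ξ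
      = ξ * (genFun (fun i => partialD 0 (u i)) ξ t ^ 2
        + 2 * genFun (fun i => partialD 0 (partialD 0 (u i))) ξ t * (2 - genFun u ξ t)
        + 4 * (u 0 t * (2 - genFun u ξ t) ^ 2)) + 4 * (2 - genFun u ξ t) ^ 2 := by
    intro t ξ
    have e0 : (smoothEval t : smoothAlg 𝕜 D →+* 𝕜) (U 0) = u 0 t := hU 0 t
    simp only [hQ, Polynomial.map_add, Polynomial.map_mul, Polynomial.map_sub, Polynomial.map_pow,
      Polynomial.map_X, Polynomial.map_C, Polynomial.map_ofNat, Polynomial.eval_add,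
      Polynomial.eval_mul, Polynomial.eval_sub, Polynomial.eval_pow, Polynomial.eval_X,
      Polynomial.eval_C, Polynomial.eval_ofNat, IsRestr.eval_map_genPoly hU,
      IsRestr.eval_map_genPoly h1, IsRestr.eval_map_genPoly h2, e0]
  have hMe : ∀ ξ : 𝕜, ξ ≠ 0 → (relationPoly g μ).eval ξ
      = ξ * (4 * (4 * ξ⁻¹ + ∑ i ∈ Finset.Icc 1 (2 * g), μ i * ξ ^ i)) := by
    intro ξ hξ
    rw [relationPoly, Polynomial.eval_add, Polynomial.eval_finsetSum]
    simp only [Polynomial.eval_mul, Polynomial.eval_C, Polynomial.eval_pow, Polynomial.eval_X]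
    rw [mul_add, mul_add, Finset.mul_sum, Finset.mul_sum]
    congr 1
    · field_simp
      norm_num
    · exact Finset.sum_congr rfl fun i _ => by ring
  have hMm : ∀ t : D, ((relationPoly g μ).map (algebraMap 𝕜 (smoothAlg 𝕜 D))).map
      (smoothEval t : smoothAlg 𝕜 D →+* 𝕜) = relationPoly g μ := by
    intro t
    ext n
    simp
  constructor
  · intro h
    ext n : 1
    refine smoothAlg_ext fun t => ?_
    have key : Q.map (smoothEval t : smoothAlg 𝕜 D →+* 𝕜) = relationPoly g μ := by
      refine Polynomial.eq_of_infinite_eval_eq _ _ (Set.Infinite.mono (s := {0}ᶜ) ?_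
        (Set.finite_singleton (0 : 𝕜)).infinite_compl)
      intro ξ hξ
      change _ = _
      rw [hQe, hMe ξ hξ, h t t.2 ξ hξ]
      have hξ' : ξ ≠ 0 := hξ
      field_simp
      ring
    have := congrArg (Polynomial.coeff · n) (key.trans (hMm t).symm)
    simp only [Polynomial.coeff_map] at this
    rw [Polynomial.coeff_map]
    exact this
  · intro h t ht ξ hξ
    have key := congrArg (fun P => (P.map (smoothEval (⟨t, ht⟩ : D) :
      smoothAlg 𝕜 D →+* 𝕜)).eval ξ) h
    simp only [hMm, hQe] at key
    rw [hMe ξ hξ] at key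
    refine mul_left_cancel₀ hξ (key.symm.trans ?_)
    field_simp
    ring

theorem exists_quadraticRelation [NeZero g] {U : Fin g → smoothAlg 𝕜 D} {u : Fin g → (Fin g → 𝕜) → 𝕜} (hU : ∀ i, IsRestr (U i) (u i))
    {M : PowerSeries 𝕜}
    (h : quadForm (coordD D 0) (U 0) (wSeries U) = PowerSeries.map (algebraMap 𝕜 _) M) :
    ∃ μ : ℕ → 𝕜, QuadraticRelation D u μ := by
  -- The shift and the division undo the factor 4ξ. The remaining coefficients are forced: 16 in
  -- degree 0, zero in degree 1 and above 2g + 1.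
  refine ⟨fun i => PowerSeries.coeff (i + 1) M / 4, (quadraticRelation_iff hU _).mpr ?_⟩
  have hc := constantCoeff_wSeries U
  ext n : 1
  rw [PowerSeries.coeff_map, Polynomial.coeff_coe, coeff_relationPoly]
  split_ifs with h0 h1
  · rw [h0, coeff_zero_quadForm _ _ hc, map_ofNat]
  · have := Finset.mem_Icc.mp h1
    rw [h, PowerSeries.coeff_map, Nat.sub_add_cancel (by omega)]
    congr 1
    ring
  · rw [map_zero]
    rw [Finset.mem_Icc] at h1
    rcases Nat.lt_or_ge n 2 with hn | hn
    · obtain rfl : n = 1 := by omega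
      exact coeff_one_quadForm _ _ hc (coeff_one_wSeries U)
    · exact coeff_quadForm_of_lt _ _ (fun k hk => coeff_wSeries_of_lt U hk) (by omega)

end Relation

end

noncomputable section

/-! ### Stationary equations in the differential algebra -/

section Stationary

open TopologicalSpace

variable {𝕜 : Type*} [RCLike 𝕜]

/-- `r_g + ∑_{k < m} a_k r_k` in a differential algebra. -/
def novikovExpr {R : Type*} [CommRing R] [Algebra 𝕜 R] (δ : Derivation 𝕜 R R) (u : R) (g m : ℕ)
    (a : ℕ → 𝕜) : R :=
  kdvAt δ u g + ∑ k ∈ Finset.range m, algebraMap 𝕜 R (a k) * kdvAt δ u k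

theorem map_evDiff {R S : Type*} [CommRing R] [Algebra 𝕜 R] [CommRing S] [Algebra 𝕜 S]
    (φ : R →ₐ[𝕜] S) {δ : Derivation 𝕜 R R} {ε : Derivation 𝕜 S S} (h : ∀ f, φ (δ f) = ε (φ f))
    (u : R) (p : DiffPoly) : φ (evDiff δ u p) = evDiff ε (φ u) p := by
  induction p using MvPolynomial.induction_on with
  | C q => rw [evDiff_C, evDiff_C, AlgHom.commutes]
  | add p q hp hq => simp only [map_add, hp, hq]
  | mul_X p n hp =>
    rw [map_mul, map_mul, map_mul, hp, evDiff_X, evDiff_X]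
    congr 1
    induction n with
    | zero => rfl
    | succ n ih => rw [Function.iterate_succ_apply', Function.iterate_succ_apply', h, ih]

theorem map_novikovExpr {R S : Type*} [CommRing R] [Algebra 𝕜 R] [CommRing S] [Algebra 𝕜 S]
    (φ : R →ₐ[𝕜] S) {δ : Derivation 𝕜 R R} {ε : Derivation 𝕜 S S} (h : ∀ f, φ (δ f) = ε (φ f))
    (u : R) (g m : ℕ) (a : ℕ → 𝕜) :
    φ (novikovExpr δ u g m a) = novikovExpr ε (φ u) g m a := by
  simp only [novikovExpr, kdvAt, map_add, map_sum, map_mul, map_evDiff φ h, AlgHom.commutes]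

theorem map_evDiff_eq_evalJet {R : Type*} [CommRing R] [Algebra 𝕜 R] (φ : R →ₐ[𝕜] 𝕜)
    (δ : Derivation 𝕜 R R) (u : R) (p : DiffPoly) :
    φ (evDiff δ u p) = evalJet (fun n => φ (δ^[n] u)) p := by
  rw [evalJet]
  induction p using MvPolynomial.induction_on with
  | C q => rw [evDiff_C, AlgHom.commutes, MvPolynomial.aeval_C]; simp
  | add p q hp hq => simp only [map_add, hp, hq]
  | mul_X p n hp => rw [map_mul, map_mul, map_mul, hp, evDiff_X, MvPolynomial.aeval_X]

theorem novikovAt_iff {R : Type*} [CommRing R] [Algebra 𝕜 R] (φ : R →ₐ[𝕜] 𝕜)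
    (δ : Derivation 𝕜 R R) (u : R) (g m : ℕ) (a : ℕ → 𝕜) :
    NovikovAt g m a (fun n => φ (δ^[n] u)) ↔ φ (novikovExpr δ u g m a) = 0 := by
  simp only [NovikovAt, novikovExpr, kdvAt, map_add, map_sum, map_mul, map_evDiff_eq_evalJet,
    AlgHom.commutes, Algebra.algebraMap_self_apply]

theorem forall_novikovAt_iff {E : Type*} [NormedAddCommGroup E] [NormedSpace 𝕜 E] {D : Opens E}
    {δ : Derivation 𝕜 (smoothAlg 𝕜 D) (smoothAlg 𝕜 D)} {u : smoothAlg 𝕜 D} {jet : E → ℕ → 𝕜}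
    (h : ∀ (t : D) n, (δ^[n] u).1 t = jet t n) (g m : ℕ) (a : ℕ → 𝕜) :
    (∀ t ∈ D, NovikovAt g m a (jet t)) ↔ novikovExpr δ u g m a = 0 := by
  have key : ∀ t : D, NovikovAt g m a (jet t) ↔ (novikovExpr δ u g m a).1 t = 0 := by
    intro t
    have := novikovAt_iff ((Pi.evalAlgHom 𝕜 (fun _ : D => 𝕜) t).comp (smoothAlg 𝕜 D).val) δ u g m a
    rwa [show (fun n => ((Pi.evalAlgHom 𝕜 (fun _ : D => 𝕜) t).comp (smoothAlg 𝕜 D).val) (δ^[n] u))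
      = jet t from funext (h t)] at this
  constructor
  · exact fun h => smoothAlg_ext fun t => (key t).mp (h t t.2)
  · exact fun h t ht => (key ⟨t, ht⟩).mpr (by rw [h]; rfl)

theorem iterate_dirD_apply {Ω : Opens 𝕜} {v : 𝕜 → 𝕜} {f : smoothAlg 𝕜 Ω}
    (hf : ∀ x : Ω, f.1 x = v x) (x : Ω) (n : ℕ) :
    ((dirD 𝕜 Ω 1)^[n] f).1 x = iteratedDeriv n v x := by
  induction n generalizing x with
  | zero => simpa using hf x
  | succ n ih =>
    rw [Function.iterate_succ_apply', iteratedDeriv_succ, dirD_apply 1 ih]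
    rfl

theorem exists_eq_algebraMap_of_dirD_one_eq_zero {Ω : Opens 𝕜}
    (hΩ : IsPreconnected (Ω : Set 𝕜)) (f : smoothAlg 𝕜 Ω) (h : dirD 𝕜 Ω 1 f = 0) :
    ∃ k : 𝕜, f = algebraMap 𝕜 _ k := by
  refine exists_eq_algebraMap_of_dirD_eq_zero hΩ fun x => ContinuousLinearMap.ext_ring ?_
  exact congrArg (fun f : smoothAlg 𝕜 Ω => f.1 x) h

/-- On a connected set the first integral Q(W) has constant coefficients, so `novikov_of_quadForm`
applies. -/
theorem exists_novikovExpr_of_isLenard {Ω : Opens 𝕜} (hΩ : IsPreconnected (Ω : Set 𝕜)) {g : ℕ}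
    {v : smoothAlg 𝕜 Ω} {W : PowerSeries (smoothAlg 𝕜 Ω)} (h0 : PowerSeries.constantCoeff W = 2)
    (h1 : PowerSeries.coeff 1 W = -v) (hg : ∀ k, g < k → PowerSeries.coeff k W = 0)
    (h : IsLenard (dirD 𝕜 Ω 1) v W) (hne : (Ω : Set 𝕜).Nonempty) :
    ∃ a : ℕ → 𝕜, novikovExpr (dirD 𝕜 Ω 1) v g (g - 1) a = 0 := by
  obtain ⟨M, hM⟩ := exists_eq_map_algebraMap fun n =>
    exists_eq_algebraMap_of_dirD_one_eq_zero hΩ (PowerSeries.coeff n (quadForm (dirD 𝕜 Ω 1) v W)) (by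
      rw [← coeff_serD, h.serD_quadForm, map_zero])
  obtain ⟨x, hx⟩ := hne
  -- A point of Ω is needed so that the coefficients 16 and 0 can be read off in 𝕜.
  have hinj : Function.Injective (algebraMap 𝕜 (smoothAlg 𝕜 Ω)) := fun a b hab =>
    congrArg (fun f : smoothAlg 𝕜 Ω => f.1 ⟨x, hx⟩) hab
  obtain ⟨a, ha⟩ := novikov_of_quadForm g M (hinj (by
      rw [← PowerSeries.coeff_map, ← hM, coeff_zero_quadForm _ _ h0, map_ofNat])) (hinj (by
      rw [← PowerSeries.coeff_map, ← hM, coeff_one_quadForm _ _ h0 h1, map_zero]))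
  exact ⟨a, ha _ _ W h0 (hg _ (Nat.lt_succ_self g)) hM⟩

variable {g : ℕ} [NeZero g]

/-- Restriction to the line `t₂ = … = t_g = 0`. -/
def restrLine {D : Opens (Fin g → 𝕜)} {Ω : Opens 𝕜} (h : ∀ x ∈ Ω, Pi.single 0 x ∈ D) :
    smoothAlg 𝕜 D →ₐ[𝕜] smoothAlg 𝕜 Ω :=
  smoothPull (ContinuousLinearMap.single 𝕜 (fun _ : Fin g => 𝕜) 0) h

theorem restrLine_coordD {D : Opens (Fin g → 𝕜)} {Ω : Opens 𝕜} (h : ∀ x ∈ Ω, Pi.single 0 x ∈ D)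
    (f : smoothAlg 𝕜 D) : restrLine h (coordD D 0 f) = dirD 𝕜 Ω 1 (restrLine h f) :=
  (dirD_smoothPull (ContinuousLinearMap.single 𝕜 (fun _ : Fin g => 𝕜) 0) h 1 f).symm

theorem restrLine_apply {D : Opens (Fin g → 𝕜)} {Ω : Opens 𝕜} (h : ∀ x ∈ Ω, Pi.single 0 x ∈ D)
    (f : smoothAlg 𝕜 D) (x : Ω) : (restrLine h f).1 x = f.1 ⟨Pi.single 0 (x : 𝕜), h x x.2⟩ :=
  smoothPull_apply _ h f x

theorem isKdVSystem_iff_exists {D : Opens (Fin g → 𝕜)}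
    (hD : IsPreconnected (D : Set (Fin g → 𝕜))) {U : Fin g → smoothAlg 𝕜 D} :
    IsKdVSystem (coordD D) U ↔ (∀ i j, coordD D i (U j) = coordD D j (U i)) ∧
      ∃ M, quadForm (coordD D 0) (U 0) (wSeries U) = PowerSeries.map (algebraMap 𝕜 _) M := by
  constructor
  · refine fun h => ⟨h.symm, exists_eq_map_algebraMap fun n =>
      exists_eq_algebraMap_of_coordD_eq_zero hD fun j => ?_⟩
    rw [← coeff_serD, h.serD_quadForm coordD_comm j, map_zero]
  · rintro ⟨hs, M, hM⟩
    refine isKdVSystem_of_serD_quadForm coordD_comm hs fun j => ?_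
    rw [hM, serD_map_algebraMap]

/-- The constants come from μ alone, so they are the same at all points and for all solutions; no
connectedness is needed. -/
theorem exists_novikovExpr_of_quadraticRelation {μ : ℕ → 𝕜} : ∃ a : ℕ → 𝕜,
    ∀ (D : Opens (Fin g → 𝕜)) (U : Fin g → smoothAlg 𝕜 D) (u : Fin g → (Fin g → 𝕜) → 𝕜),
      (∀ i, IsRestr (U i) (u i)) → QuadraticRelation D u μ →
      novikovExpr (coordD D 0) (U 0) g (g - 1) a = 0 := by
  obtain ⟨a, ha⟩ := novikov_of_quadForm g (relationPoly g μ : PowerSeries 𝕜)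
    (by rw [Polynomial.coeff_coe, coeff_relationPoly, if_pos rfl])
    (by rw [Polynomial.coeff_coe, coeff_relationPoly, if_neg one_ne_zero, if_neg (by simp)])
  exact ⟨a, fun D U u hU h => ha _ _ _ (constantCoeff_wSeries U)
    (coeff_wSeries_of_lt U (Nat.lt_succ_self g)) ((quadraticRelation_iff hU μ).mp h)⟩

end Stationary

end

noncomputable section

/-! ### Proof of the equivalences for functions on Ω and on D -/

section Main

open TopologicalSpace

variable {𝕜 : Type*} [RCLike 𝕜] {g : ℕ}

theorem isNormalizedStationaryKdV_iff {v : 𝕜 → 𝕜} {Ω : Opens 𝕜} (hv : ContDiffOn 𝕜 ∞ v Ω) :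
    IsNormalizedStationaryKdV g Ω v ↔
      ∃ a, novikovExpr (dirD 𝕜 Ω 1) (toSmooth hv) g (g - 1) a = 0 :=
  exists_congr fun a => forall_novikovAt_iff (iterate_dirD_apply (toSmooth_apply hv)) g (g - 1) a

theorem isStationaryKdV_iff {v : 𝕜 → 𝕜} {Ω : Opens 𝕜} (hv : ContDiffOn 𝕜 ∞ v Ω) :
    IsStationaryKdV g Ω v ↔ ∃ a, novikovExpr (dirD 𝕜 Ω 1) (toSmooth hv) g g a = 0 :=
  exists_congr fun a => forall_novikovAt_iff (iterate_dirD_apply (toSmooth_apply hv)) g g a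

variable [NeZero g]

theorem allCommute_iff_quadraticRelation {D : Set (Fin g → 𝕜)} {u : Fin g → (Fin g → 𝕜) → 𝕜}
    (hDo : IsOpen D) (hD : IsPreconnected D) (hu : ∀ i, ContDiffOn 𝕜 ∞ (u i) D) :
    AllCommute D u ↔ (∀ i j, ∀ t ∈ D, partialD i (u j) t = partialD j (u i) t) ∧
      ∃ μ : ℕ → 𝕜, QuadraticRelation D u μ := by
  let D' : Opens (Fin g → 𝕜) := ⟨D, hDo⟩
  let U : Fin g → smoothAlg 𝕜 D' := fun i => toSmooth (hu i)
  have hU : ∀ i, IsRestr (U i) (u i) := fun i => toSmooth_apply (hu i)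
  rw [show AllCommute D u ↔ _ from allCommute_iff (D := D') hU, isKdVSystem_iff_exists hD]
  refine and_congr ?_ ⟨fun ⟨M, hM⟩ => exists_quadraticRelation hU hM,
    fun ⟨μ, hμ⟩ => ⟨_, (quadraticRelation_iff hU μ).mp hμ⟩⟩
  refine forall_congr' fun i => forall_congr' fun j => ⟨fun h t ht => ?_, fun h => ?_⟩
  · rw [← (hU j).partialD i ⟨t, ht⟩, ← (hU i).partialD j ⟨t, ht⟩, h]
  · refine smoothAlg_ext fun t => ?_
    rw [(hU j).partialD i t, (hU i).partialD j t]
    exact h t t.2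

theorem exists_novikovAt_of_quadraticRelation {D : Set (Fin g → 𝕜)}
    {u : Fin g → (Fin g → 𝕜) → 𝕜} (hDo : IsOpen D) (hu : ∀ i, ContDiffOn 𝕜 ∞ (u i) D) {μ : ℕ → 𝕜}
    (h : QuadraticRelation D u μ) :
    ∃ a : ℕ → 𝕜, ∀ t ∈ D, NovikovAt g (g - 1) a (fun n => (partialD 0)^[n] (u 0) t) := by
  let D' : Opens (Fin g → 𝕜) := ⟨D, hDo⟩
  let U : Fin g → smoothAlg 𝕜 D' := fun i => toSmooth (hu i)
  have hU : ∀ i, IsRestr (U i) (u i) := fun i => toSmooth_apply (hu i)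
  obtain ⟨a, ha⟩ := exists_novikovExpr_of_quadraticRelation (𝕜 := 𝕜) (g := g) (μ := μ)
  exact ⟨a, (forall_novikovAt_iff (D := D') (fun t n => (hU 0).iterate_partialD n t) _ _ _).mpr
    (ha D' U u hU h)⟩

/-- A test function on the smaller set need not extend to the larger one. The equations satisfied by
the uᵢ, however, restrict. -/
theorem AllCommute.mono {D D' : Set (Fin g → 𝕜)} {u : Fin g → (Fin g → 𝕜) → 𝕜} (hD : IsOpen D)
    (hD' : IsOpen D') (hsub : D' ⊆ D) (hu : ∀ i, ContDiffOn 𝕜 ∞ (u i) D) (h : AllCommute D u) :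
    AllCommute D' u := by
  let E : Opens (Fin g → 𝕜) := ⟨D, hD⟩
  let E' : Opens (Fin g → 𝕜) := ⟨D', hD'⟩
  have hU : ∀ i, IsRestr (toSmooth (D := E) (hu i)) (u i) := fun i => toSmooth_apply (hu i)
  have hid : ∀ t ∈ E', ContinuousLinearMap.id 𝕜 (Fin g → 𝕜) t ∈ E := hsub
  let ρ : smoothAlg 𝕜 E →ₐ[𝕜] smoothAlg 𝕜 E' := smoothPull (.id 𝕜 _) hid
  have hρ : ∀ i, IsRestr (ρ (toSmooth (D := E) (hu i))) (u i) := fun i =>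
    smoothPull_apply _ hid _
  exact (allCommute_iff (D := E') hρ).mpr (((allCommute_iff (D := E) hU).mp h).map ρ fun i f =>
    (dirD_smoothPull _ hid _ f).symm)

section Line

variable {Ω : Set 𝕜} {v : 𝕜 → 𝕜} {D : Set (Fin g → 𝕜)} {u : Fin g → (Fin g → 𝕜) → 𝕜}

theorem IsExtension.restrLine_eq {Ω : Opens 𝕜} (hv : ContDiffOn 𝕜 ∞ v Ω)
    (h : IsExtension Ω v D u) :
    restrLine (D := ⟨D, h.isOpen⟩) h.mem (toSmooth (h.smooth 0)) = toSmooth hv :=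
  smoothAlg_ext fun x => (restrLine_apply _ _ x).trans (h.restrict x x.2)

/-- The truncated resolvent gives a curve in the phase space, the flows extend it to several
variables, and the homomorphism carries the system valid on the phase space to the resulting
functions. -/
theorem IsExtension.exists_of_isNormalizedStationaryKdV (hΩ : IsOpen Ω)
    (hv : ContDiffOn 𝕜 ∞ v Ω) (h : IsNormalizedStationaryKdV g Ω v) :
    ∃ (D : Set (Fin g → 𝕜)) (u : Fin g → (Fin g → 𝕜) → 𝕜), IsExtension Ω v D u ∧ AllCommute D u := by
  let Ω' : Opens 𝕜 := ⟨Ω, hΩ⟩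
  obtain ⟨m, hm⟩ : ∃ m, g = m + 1 := Nat.exists_eq_succ_of_ne_zero (NeZero.ne g)
  obtain ⟨a, ha⟩ := (isNormalizedStationaryKdV_iff (Ω := Ω') hv).mp h
  have ha' : kdvAt (dirD 𝕜 Ω' 1) (toSmooth hv) (m + 1) + ∑ k ∈ Finset.range m,
      algebraMap 𝕜 _ (a k) * kdvAt (dirD 𝕜 Ω' 1) (toSmooth hv) k = 0 := by
    subst hm
    exact ha
  obtain ⟨W, hW0, hW1, hW, hL⟩ := exists_lenard_of_novikov m _ _ a ha'
  rw [← hm] at hW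
  obtain ⟨π, hπ, hπX⟩ := exists_phase_hom (g := g) _ hW0 hW1 hW hL
  obtain ⟨D, hD, Φ, hΦ, hΦπ⟩ := exists_flow (Ω := Ω') (Y := fun i : Fin g => phaseD 𝕜 g i)
    (fun i j p => phaseD_comm i.2 j.2 p) π fun p => by
      rw [← hπX, ← phaseD_zero_eq]
      rfl
  have hK := (isKdVSystem_phase (𝕜 := 𝕜) (g := g)).map (e := coordD D) Φ hΦ
  refine ⟨D, fun i => zeroExt D (Φ (-phaseVar 𝕜 g 0 ((i : ℕ) + 1))).1,
    ⟨D.isOpen, hD, fun i => smoothAlg_contDiffOn _, fun x hx => ?_⟩,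
    (allCommute_iff (D := D) fun i => isRestr_zeroExt _).mpr hK⟩
  have e := hΦπ ⟨x, hx⟩ (-phaseVar 𝕜 g 0 (0 + 1))
  rw [map_neg π, hπ, zero_add, hW1, neg_neg] at e
  have e2 := zeroExt_apply (Φ (-phaseVar 𝕜 g 0 (0 + 1))).1 ⟨Pi.single 0 x, hD x hx⟩
  have e3 : (((0 : Fin g) : ℕ)) = 0 := rfl
  simp only [e3]
  exact e2.trans e

/-- Commutation with L alone already gives Q(W)' = 0. This is restricted to the line, so that only
Ω, and not D, has to be connected. -/
theorem IsExtension.isNormalizedStationaryKdV (hΩ : IsOpen Ω) (hc : IsConnected Ω)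
    (hv : ContDiffOn 𝕜 ∞ v Ω) (h : IsExtension Ω v D u) (hL : SchrodingerCommutes D u) :
    IsNormalizedStationaryKdV g Ω v := by
  let Ω' : Opens 𝕜 := ⟨Ω, hΩ⟩
  let D' : Opens (Fin g → 𝕜) := ⟨D, h.isOpen⟩
  let U : Fin g → smoothAlg 𝕜 D' := fun i => toSmooth (h.smooth i)
  have hU : ∀ i, IsRestr (U i) (u i) := fun i => toSmooth_apply (h.smooth i)
  have hq := ((schrodingerCommutes_iff (D := D') hU).mp hL).isLenard.serD_quadForm
  let ρ := restrLine (D := D') (Ω := Ω') h.mem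
  have hρ : ∀ f, ρ (coordD D' 0 f) = dirD 𝕜 Ω' 1 (ρ f) := restrLine_coordD (D := D') (Ω := Ω') h.mem
  have hρU : ρ (U 0) = toSmooth hv := h.restrLine_eq (Ω := Ω') hv
  have h0 : PowerSeries.constantCoeff (PowerSeries.map (ρ : smoothAlg 𝕜 D' →+* smoothAlg 𝕜 Ω')
      (wSeries U)) = 2 := by
    rw [← PowerSeries.coeff_zero_eq_constantCoeff_apply, PowerSeries.coeff_map, coeff_zero_wSeries,
      map_ofNat]
  refine (isNormalizedStationaryKdV_iff (Ω := Ω') hv).mpr ?_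
  rw [← hρU]
  refine exists_novikovExpr_of_isLenard hc.isPreconnected h0 ?_ ?_
    (isLenard_of_serD_quadForm h0 ?_) hc.nonempty
  · rw [PowerSeries.coeff_map, coeff_one_wSeries, map_neg]
    rfl
  · intro k hk
    rw [PowerSeries.coeff_map, coeff_wSeries_of_lt _ hk, map_zero]
  · rw [← map_quadForm ρ hρ, ← map_serD ρ hρ, hq, map_zero]

theorem IsExtension.exists_quadraticRelation (hc : IsConnected Ω) (h : IsExtension Ω v D u)
    (hA : AllCommute D u) : ∃ (D : Set (Fin g → 𝕜)) (u : Fin g → (Fin g → 𝕜) → 𝕜) (μ : ℕ → 𝕜),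
      IsExtension Ω v D u ∧ QuadraticRelation D u μ := by
  obtain ⟨x, hx⟩ := hc.nonempty
  -- The μᵢ are constant only on connected sets, so D is replaced by its component that contains the
  -- connected set Ω × {0}.
  let D' := connectedComponentIn D (Pi.single 0 x)
  have hD' : IsOpen D' := h.isOpen.connectedComponentIn
  have hsub : D' ⊆ D := connectedComponentIn_subset _ _
  have hmem : ∀ y ∈ Ω, Pi.single 0 y ∈ D' := by
    have hpre : IsPreconnected ((fun y : 𝕜 => (Pi.single 0 y : Fin g → 𝕜)) '' Ω) :=
      hc.isPreconnected.image _ (continuous_single (A := fun _ : Fin g => 𝕜) 0).continuousOn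
    have := hpre.subset_connectedComponentIn (Set.mem_image_of_mem _ hx)
      (by rintro _ ⟨y, hy, rfl⟩; exact h.mem y hy)
    exact fun y hy => this (Set.mem_image_of_mem _ hy)
  have hu : ∀ i, ContDiffOn 𝕜 ∞ (u i) D' := fun i => (h.smooth i).mono hsub
  obtain ⟨-, μ, hμ⟩ := (allCommute_iff_quadraticRelation hD' isPreconnected_connectedComponentIn
    hu).mp (hA.mono h.isOpen hD' hsub h.smooth)
  exact ⟨D', u, μ, ⟨hD', hmem, hu, h.restrict⟩, hμ⟩

theorem IsExtension.isNormalizedStationaryKdV_of_quadraticRelation (hΩ : IsOpen Ω)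
    (hv : ContDiffOn 𝕜 ∞ v Ω) (h : IsExtension Ω v D u) {μ : ℕ → 𝕜}
    (hμ : QuadraticRelation D u μ) : IsNormalizedStationaryKdV g Ω v := by
  let Ω' : Opens 𝕜 := ⟨Ω, hΩ⟩
  let D' : Opens (Fin g → 𝕜) := ⟨D, h.isOpen⟩
  obtain ⟨a, ha⟩ := exists_novikovExpr_of_quadraticRelation (𝕜 := 𝕜) (g := g) (μ := μ)
  refine (isNormalizedStationaryKdV_iff (Ω := Ω') hv).mpr ⟨a, ?_⟩
  have := ha D' (fun i => toSmooth (h.smooth i)) u (fun i => toSmooth_apply (h.smooth i)) hμ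
  rw [← h.restrLine_eq (Ω := Ω') hv,
    ← map_novikovExpr _ (restrLine_coordD (D := D') (Ω := Ω') h.mem), this, map_zero]

theorem isStationaryKdV_iff_exists_add_const (hΩ : IsOpen Ω) (hc : IsConnected Ω)
    (hv : ContDiffOn 𝕜 ∞ v Ω) : IsStationaryKdV g Ω v ↔
      ∃ c : 𝕜, IsNormalizedStationaryKdV g Ω (fun x => v x + c) := by
  let Ω' : Opens 𝕜 := ⟨Ω, hΩ⟩
  obtain ⟨m, rfl⟩ : ∃ m, g = m + 1 := Nat.exists_eq_succ_of_ne_zero (NeZero.ne g)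
  have hker := exists_eq_algebraMap_of_dirD_one_eq_zero (Ω := Ω') hc.isPreconnected
  have hvc : ∀ c : 𝕜, ContDiffOn 𝕜 ∞ (fun x => v x + c) Ω := fun c => hv.add contDiffOn_const
  have hadd : ∀ c, toSmooth (D := Ω') (hvc c) = toSmooth (D := Ω') hv + algebraMap 𝕜 _ c :=
    fun c => rfl
  have hpos : ((m : 𝕜) + 3 / 2) ≠ 0 := by
    have : ((2 * m + 3 : ℕ) : 𝕜) ≠ 0 := Nat.cast_ne_zero.mpr (by omega)
    refine fun h => this ?_
    push_cast
    linear_combination 2 * h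
  refine (isStationaryKdV_iff (Ω := Ω') hv).trans (Iff.trans ?_
    (exists_congr fun c => (isNormalizedStationaryKdV_iff (Ω := Ω') (hvc c)).symm))
  simp only [Nat.add_sub_cancel, hadd]
  constructor
  · rintro ⟨a, ha⟩
    -- The shift lemma is applied to v = (v + c) + (-c), and c is chosen to annihilate the new
    -- coefficient of r_m.
    obtain ⟨c, hcm⟩ : ∃ c : 𝕜, a m - -c * (m + 3 / 2) = 0 :=
      ⟨-(a m / (m + 3 / 2)), by rw [neg_neg, div_mul_cancel₀ _ hpos, sub_self]⟩
    obtain ⟨a', ha', h⟩ := novikov_add_const _ hker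
      (toSmooth (D := Ω') hv + algebraMap 𝕜 _ c) (-c) m a
    rw [map_neg, add_neg_cancel_right] at h
    refine ⟨c, a', ?_⟩
    rw [Finset.sum_range_succ (fun k => algebraMap 𝕜 _ (a' k) * _), ha', hcm, map_zero,
      zero_mul, add_zero] at h
    exact h.symm.trans ha
  · rintro ⟨c, a, ha⟩
    obtain ⟨a', -, h⟩ := novikov_add_const _ hker (toSmooth (D := Ω') hv) c m
      -- The normalized equation is regarded as a general one whose top coefficient is zero.
      (fun k => if k < m then a k else 0)
    refine ⟨a', h.symm.trans ?_⟩
    rw [Finset.sum_range_succ, if_neg (lt_irrefl m), map_zero, zero_mul, add_zero, ← ha]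
    refine congrArg _ (Finset.sum_congr rfl fun k hk => ?_)
    rw [if_pos (Finset.mem_range.mp hk)]

end Line

end Main

end

theorem mainTheorem1 {𝕜 : Type*} [RCLike 𝕜] (g : ℕ) [NeZero g] :
    -- the equivalence for a function `v` of `x` on an interval or domain `Ω`
    (∀ (Ω : Set 𝕜) (v : 𝕜 → 𝕜), IsOpen Ω → IsConnected Ω → ContDiffOn 𝕜 ∞ v Ω →
      List.TFAE [
        IsNormalizedStationaryKdV g Ω v,
        ∃ (D : Set (Fin g → 𝕜)) (u : Fin g → (Fin g → 𝕜) → 𝕜),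
          IsExtension Ω v D u ∧ AllCommute D u,
        ∃ (D : Set (Fin g → 𝕜)) (u : Fin g → (Fin g → 𝕜) → 𝕜),
          IsExtension Ω v D u ∧ SchrodingerCommutes D u,
        ∃ (D : Set (Fin g → 𝕜)) (u : Fin g → (Fin g → 𝕜) → 𝕜) (μ : ℕ → 𝕜),
          IsExtension Ω v D u ∧ QuadraticRelation D u μ]) ∧
    -- removal of the normalization
    (∀ (Ω : Set 𝕜) (v : 𝕜 → 𝕜), IsOpen Ω → IsConnected Ω → ContDiffOn 𝕜 ∞ v Ω →
      (IsStationaryKdV g Ω v ↔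
        ∃ c : 𝕜, IsNormalizedStationaryKdV g Ω (fun x => v x + c))) ∧
    -- the relation between the conditions for given functions of `t₁, …, t_g`
    (∀ (D : Set (Fin g → 𝕜)) (u : Fin g → (Fin g → 𝕜) → 𝕜), IsOpen D → IsConnected D →
      (∀ i, ContDiffOn 𝕜 ∞ (u i) D) →
      (AllCommute D u ↔
        (∀ i j, ∀ t ∈ D, partialD i (u j) t = partialD j (u i) t) ∧
          ∃ μ : ℕ → 𝕜, QuadraticRelation D u μ) ∧
      ((∃ μ : ℕ → 𝕜, QuadraticRelation D u μ) →
        ∃ a : ℕ → 𝕜, ∀ t ∈ D, NovikovAt g (g - 1) a (fun n => (partialD 0)^[n] (u 0) t))) := by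

  refine ⟨fun Ω v hΩ hc hv => ?_, fun Ω v hΩ hc hv => isStationaryKdV_iff_exists_add_const hΩ hc hv,
    fun D u hD hc hu => ⟨allCommute_iff_quadraticRelation hD hc.isPreconnected hu,
      fun ⟨μ, hμ⟩ => exists_novikovAt_of_quadraticRelation hD hu hμ⟩⟩
  tfae_have 1 → 2 := IsExtension.exists_of_isNormalizedStationaryKdV hΩ hv
  tfae_have 2 → 3 := fun ⟨D, u, h, hA⟩ => ⟨D, u, h, hA.1⟩
  tfae_have 3 → 1 := fun ⟨D, u, h, hL⟩ => h.isNormalizedStationaryKdV hΩ hc hv hL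
  tfae_have 2 → 4 := fun ⟨D, u, h, hA⟩ => h.exists_quadraticRelation hc hA
  tfae_have 4 → 1 := fun ⟨D, u, μ, h, hμ⟩ => h.isNormalizedStationaryKdV_of_quadraticRelation hΩ hv hμ
  tfae_finish
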